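/- Let $d\ge 2$ and $C_{\rm reg}\in\mathbb R$. There is a constant $C>0$, depending only on $d$ and $C_{\rm reg}$, such that the following holds for every bounded simply connected Lipschitz domain $\emptyset\ne\Omega\subset\mathbb R^d$ and every regular (conforming, finite) mesh $\mathcal T$ of $\Omega$ into open simplices with $\overline\Omega=\bigcup_{T\in\mathcal T}\overline T$ and $\operatorname{diam}(T)^d/|T|\le C_{\rm reg}$ for all $T\in\mathcal T$. Notation. For a bounded open set $\omega$, $\|\cdot\|_\omega$ is the norm of $L^2(\omega)$ or $L^2(\omega)^d$, $H_0^1(\omega)$ is the closure of $C_c^\infty(\omega)$ in $H^1(\omega)$, $H^{-1}(\omega)$ is its dual space, and $\|\phi\|_{-1,\omega}=\sup_{0\ne v\in H^1_0(\omega)}\langle\phi,v\rangle_\omega/\|\nabla v\|_\omega$, where functions in $L^2(\omega)$ act by the $L^2(\omega)$ inner product; the index $\omega=\Omega$ is omitted. Let $h_T=\operatorname{diam}(T)$ and $h_{\mathcal T}|_T=h_T$. Let $\mathcal P^0(\mathcal T)$ be the space of $\mathcal T$-piecewise constant functions and $\Pi^0_{\mathcal T}$ the $L^2(\Omega)$-orthogonal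 projection onto it. For $S\subseteq\overline\Omega$ let $\omega_{\mathcal T}(S)=\{T\in\mathcal T:\overline T\cap\overline S\ne\emptyset\}$ and let $\Omega_{\mathcal T}(S)$ be the interior of $\bigcup_{T\in\omega_{\mathcal T}(S)}\overline T$; for a vertex $z$ put $\omega_{\mathcal T}(z)=\omega_{\mathcal T}(\{z\})$. Let $\mathcal N^\Omega_{\mathcal T}$ be the set of vertices of $\mathcal T$ not on $\partial\Omega$, let $\eta_z$ be the continuous piecewise affine hat function of the vertex $z$ (so $\eta_z(z')=\delta_{z,z'}$ for all vertices $z'$), let $\eta_{b,T}=\prod_{z\text{ vertex of }T}\eta_z$, and let $\psi_{T,z}$ be the affine function on $T$ with $\langle\psi_{T,z},\eta_{z'}\rangle_T=\delta_{z,z'}$ for all vertices $z'$ of $T$. For $v\in L^2(\Omega)$ define $$J_{\mathcal T}v=\sum_{z\in\mathcal N^\Omega_{\mathcal T}}\ \sum_{T\in\omega_{\mathcal T}(z)}\frac{|T|\,\langle v,\psi_{T,z}\rangle_T}{\sum_{T'\in\omega_{\mathcal T}(z)}|T'|}\,\eta_z,\qquad P_{\mathcal T}v=J_{\mathcal T}v+\sum_{T\in\mathcal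 T}\frac{\langle v-J_{\mathcal T}v,1\rangle_T}{\langle\eta_{b,T},1\rangle_T}\,\eta_{b,T},$$ let $P_{\mathcal T}'$ be the adjoint of $P_{\mathcal T}$ in $L^2(\Omega)$, and put $Q_{\mathcal T}=\Pi^0_{\mathcal T}P_{\mathcal T}'$. Then: (a) $Q_{\mathcal T}^2=Q_{\mathcal T}$, and the range of $Q_{\mathcal T}$ is $\mathcal P^0(\mathcal T)$. (b) $\|(1-Q_{\mathcal T})\phi\|_{-1}\le C\,\|h_{\mathcal T}\phi\|$ for all $\phi\in L^2(\Omega)$. (c) $\|Q_{\mathcal T}\phi\|_T\le C\,\|\phi\|_{\Omega_{\mathcal T}(T)}$ and $\|Q_{\mathcal T}\phi\|_{-1,T}\le C\,\|\phi\|_{-1,\Omega_{\mathcal T}(T)}$ for all $T\in\mathcal T$ and $\phi\in L^2(\Omega)$. (d) $P_{\mathcal T}$ maps $L^2(\Omega)$ into $H^1_0(\Omega)$, and there is a (unique) bounded operator $P_{\mathcal T}'\colon H^{-1}(\Omega)\to L^2(\Omega)$ with $\langle P_{\mathcal T}'\phi,v\rangle=\langle\phi,P_{\mathcal T}v\rangle$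 for all $\phi\in H^{-1}(\Omega)$ and $v\in L^2(\Omega)$; it extends the adjoint of $P_{\mathcal T}$ in $L^2(\Omega)$. The operator $Q_{\mathcal T}=\Pi^0_{\mathcal T}P_{\mathcal T}'$, so extended to $H^{-1}(\Omega)$, satisfies $Q_{\mathcal T}^2=Q_{\mathcal T}$ and $\|Q_{\mathcal T}\phi\|_{-1}\le C\,\|\phi\|_{-1}$ for all $\phi\in H^{-1}(\Omega)$. -/

import Mathlib

open MeasureTheory Set
open scoped ENNReal NNReal

noncomputable section

namespace NegSobolev

/-- The Euclidean space of dimension `d`. -/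
abbrev E (d : ℕ) : Type := EuclideanSpace ℝ (Fin d)

/-- `L²(ω)`. -/
abbrev L2 {d : ℕ} (ω : Set (E d)) : Type := Lp ℝ 2 (volume.restrict ω)

/-- `L²(ω)^d`. -/
abbrev L2Vec {d : ℕ} (ω : Set (E d)) : Type := Lp (E d) 2 (volume.restrict ω)

/-! ### Lipschitz domains -/

/-- A bounded open set whose boundary is locally the graph of a Lipschitz function, the set lying
on one side of it: near each boundary point there are a unit direction `e` and a Lipschitz
function `γ` of the component orthogonal to `e` such that locally the set is the open epigraph
of `γ` in the direction `e`. -/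
structure IsBoundedLipschitz {d : ℕ} (Ω : Set (E d)) : Prop where
  isOpen : IsOpen Ω
  isBounded : Bornology.IsBounded Ω
  locally_graph : ∀ x ∈ frontier Ω, ∃ (e : E d) (γ : E d → ℝ) (K : ℝ≥0) (r : ℝ),
    ‖e‖ = 1 ∧ LipschitzWith K γ ∧ 0 < r ∧
      ∀ y ∈ Metric.ball x r, (y ∈ Ω ↔ γ (y - inner ℝ e y • e) < inner ℝ e y)

/-! ### The space `H₀¹` and the norms of negative order -/

/-- The pairs `(u, ∇u)` for test functions `u ∈ C_c^∞(ω)`. -/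
def testPairs {d : ℕ} (ω : Set (E d)) : Set (WithLp 2 (L2 ω × L2Vec ω)) :=
  {p | ∃ u : E d → ℝ, ContDiff ℝ (⊤ : ℕ∞) u ∧ HasCompactSupport u ∧ tsupport u ⊆ ω ∧
    p.fst =ᵐ[volume.restrict ω] u ∧ p.snd =ᵐ[volume.restrict ω] gradient u}

/-- `H₀¹(ω)`, the closure of `C_c^∞(ω)` with respect to the norm `(‖u‖² + ‖∇u‖²)^{1/2}`.
Its elements are recorded as pairs of a function and its weak gradient, so that the norm
and inner product of `L²(ω) × L²(ω)^d` restrict to those of `H¹(ω)`.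
(The span changes nothing: the set of pairs is a linear subspace already.) -/
def H10 {d : ℕ} (ω : Set (E d)) : Submodule ℝ (WithLp 2 (L2 ω × L2Vec ω)) :=
  (Submodule.span ℝ (testPairs ω)).topologicalClosure

/-- The function underlying an element of `H₀¹(ω)`. -/
def fn {d : ℕ} {ω : Set (E d)} (v : H10 ω) : L2 ω := v.1.fst

/-- The weak gradient of an element of `H₀¹(ω)`. -/
def grad {d : ℕ} {ω : Set (E d)} (v : H10 ω) : L2Vec ω := v.1.snd

/-- `H⁻¹(ω)`, the dual space of `H₀¹(ω)`. -/
abbrev HNeg {d : ℕ} (ω : Set (E d)) : Type := StrongDual ℝ (H10 ω)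

/-- The dual norm `sup_{v ≠ 0} F(v) / ‖∇v‖_ω`, as an extended nonnegative number
(the element `v = 0` contributes `0 / 0 = 0`). -/
def dualNorm {d : ℕ} {ω : Set (E d)} (F : H10 ω → ℝ) : ℝ≥0∞ :=
  ⨆ v : H10 ω, ENNReal.ofReal (F v) / ENNReal.ofReal ‖grad v‖

/-- The `L²` pairing `v ↦ ∫_ω f v` on `H₀¹(ω)`. -/
def pairing {d : ℕ} (ω : Set (E d)) (f : E d → ℝ) (v : H10 ω) : ℝ :=
  ∫ x in ω, f x * fn v x

/-- The norm `‖f‖_{-1,ω}` of a function `f` that is square integrable on `ω`. -/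
def negNorm {d : ℕ} (ω : Set (E d)) (f : E d → ℝ) : ℝ≥0∞ := dualNorm (pairing ω f)

/-- The norm `‖f‖_ω` of `L²(ω)`. -/
def l2Norm {d : ℕ} (ω : Set (E d)) (f : E d → ℝ) : ℝ≥0∞ := eLpNorm f 2 (volume.restrict ω)

/-- The embedding of `L²(ω)` into `H⁻¹(ω)` by the inner product of `L²(ω)`. -/
def toHNeg {d : ℕ} {ω : Set (E d)} (f : L2 ω) : HNeg ω :=
  (innerSL ℝ f).comp ((WithLp.fstL 2 ℝ (L2 ω) (L2Vec ω)).comp (H10 ω).subtypeL)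

/-! ### Meshes -/

/-- A regular mesh of `Ω` into simplices, each given by the set of its `d + 1` vertices. The
intersection of two closed elements is the convex hull of the common vertices. -/
structure Mesh {d : ℕ} (Ω : Set (E d)) where
  cells : Finset (Finset (E d))
  card_eq : ∀ T ∈ cells, T.card = d + 1
  indep : ∀ T ∈ cells, AffineIndependent ℝ ((↑) : T → E d)
  conforming : ∀ T ∈ cells, ∀ T' ∈ cells,
    convexHull ℝ (T : Set (E d)) ∩ convexHull ℝ (T' : Set (E d)) ⊆
      convexHull ℝ ((T : Set (E d)) ∩ (T' : Set (E d)))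
  covers : closure Ω = ⋃ T ∈ cells, convexHull ℝ (T : Set (E d))

/-- The closed simplex with vertex set `T`. -/
def closedSimplex {d : ℕ} (T : Finset (E d)) : Set (E d) := convexHull ℝ (T : Set (E d))

/-- The open simplex with vertex set `T`. -/
def openSimplex {d : ℕ} (T : Finset (E d)) : Set (E d) := interior (closedSimplex T)

/-- `h_T = diam(T)`. -/
def diam {d : ℕ} (T : Finset (E d)) : ℝ := Metric.diam (closedSimplex T)

/-- `|T|`, the volume. -/
def vol {d : ℕ} (T : Finset (E d)) : ℝ := volume.real (openSimplex T)

theorem isCompact_closedSimplex {d : ℕ} (T : Finset (E d)) : IsCompact (closedSimplex T) :=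
  T.finite_toSet.isCompact_convexHull ℝ

/-- A bounded measurable function. -/
def BddMeas {d : ℕ} (f : E d → ℝ) : Prop := Measurable f ∧ ∃ B : ℝ, ∀ x, ‖f x‖ ≤ B

theorem BddMeas.sum {d : ℕ} {ι : Type*} (s : Finset ι) (f : ι → E d → ℝ)
    (h : ∀ i ∈ s, BddMeas (f i)) : BddMeas (fun x => ∑ i ∈ s, f i x) := by
  refine ⟨Finset.measurable_fun_sum s fun i hi => (h i hi).1, ?_⟩
  choose! B hB using fun i hi => (h i hi).2
  exact ⟨∑ i ∈ s, B i, fun x => norm_sum_le_of_le s fun i hi => hB i hi x⟩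

theorem BddMeas.prod {d : ℕ} {ι : Type*} (s : Finset ι) (f : ι → E d → ℝ)
    (h : ∀ i ∈ s, BddMeas (f i)) : BddMeas (fun x => ∏ i ∈ s, f i x) := by
  refine ⟨Finset.measurable_fun_prod s fun i hi => (h i hi).1, ?_⟩
  choose! B hB using fun i hi => (h i hi).2
  refine ⟨∏ i ∈ s, B i, fun x => ?_⟩
  rw [norm_prod]
  exact Finset.prod_le_prod (fun i _ => norm_nonneg _) fun i hi => hB i hi x

theorem bddMeas_indicator {d : ℕ} (T : Finset (E d)) (a : E d →ᵃ[ℝ] ℝ) :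
    BddMeas ((openSimplex T).indicator a) := by
  have hc : Continuous a := a.continuous_of_finiteDimensional
  refine ⟨hc.measurable.indicator isOpen_interior.measurableSet, ?_⟩
  obtain ⟨B, hB⟩ := (isCompact_closedSimplex T).exists_bound_of_continuousOn hc.continuousOn
  refine ⟨max B 0, fun x => ?_⟩
  by_cases hx : x ∈ openSimplex T
  · rw [indicator_of_mem hx]
    exact (hB x (interior_subset hx)).trans (le_max_left _ _)
  · rw [indicator_of_notMem hx, norm_zero]
    exact le_max_right _ _

namespace Mesh

variable {d : ℕ} {Ω : Set (E d)} (M : Mesh Ω)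

/-- The mesh is shape regular with constant `Creg`: `diam(T)^d / |T| ≤ Creg`. -/
def ShapeRegular (Creg : ℝ) : Prop := ∀ T ∈ M.cells, diam T ^ d / vol T ≤ Creg

/-- The mesh-size function `h` with `h|_T = h_T`. -/
def meshSize (x : E d) : ℝ := ∑ T ∈ M.cells, (openSimplex T).indicator (fun _ => diam T) x

open Classical in
/-- The element patch `ω(S)`: all elements whose closure meets the closure of `S`. -/
def patch (S : Set (E d)) : Finset (Finset (E d)) :=
  M.cells.filter fun T => (closedSimplex T ∩ closure S).Nonempty

/-- The domain `Ω(S)` of the element patch, the interior of the union of its closed elements. -/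
def patchDomain (S : Set (E d)) : Set (E d) := interior (⋃ T ∈ M.patch S, closedSimplex T)

open Classical in
/-- The vertices of the mesh that do not lie on the boundary of `Ω`. -/
def interiorVertices : Finset (E d) := (M.cells.biUnion id).filter fun z => z ∉ frontier Ω

/-! ### Barycentric coordinates -/

/-- The vertices of an element as an affine basis. -/
def basis (T : M.cells) : AffineBasis T.1 ℝ (E d) where
  toFun := (↑)
  ind' := M.indep T.1 T.2
  tot' := by
    rw [(M.indep T.1 T.2).affineSpan_eq_top_iff_card_eq_finrank_add_one]
    simp [M.card_eq T.1 T.2]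

open Classical in
/-- The barycentric coordinate of the element `T` that belongs to its vertex `z`: the affine
function with value `1` at `z` and `0` at the other vertices (zero if `z` is no vertex of `T`). -/
def bary (T : M.cells) (z : E d) : E d →ᵃ[ℝ] ℝ :=
  if h : z ∈ T.1 then (M.basis T).coord ⟨z, h⟩ else 0

theorem openSimplex_nonempty (T : M.cells) : (openSimplex T.1).Nonempty := by
  have h := (M.basis T).tot
  have hr : range (M.basis T) = (T.1 : Set (E d)) := by
    change range ((↑) : T.1 → E d) = _
    simp
  rw [hr] at h
  exact interior_convexHull_nonempty_iff_affineSpan_eq_top.2 h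

theorem integrableOn_affine_mul (T : M.cells) (a b : E d →ᵃ[ℝ] ℝ) :
    IntegrableOn (fun x => a x * b x) (openSimplex T.1) := by
  have hc : Continuous fun x => a x * b x :=
    a.continuous_of_finiteDimensional.mul b.continuous_of_finiteDimensional
  exact (hc.continuousOn.integrableOn_compact (isCompact_closedSimplex T.1)).mono_set
    interior_subset

theorem affine_eq_sum (T : M.cells) (a : E d →ᵃ[ℝ] ℝ) (x : E d) :
    a x = ∑ z : T.1, a z * (M.basis T).coord z x := by
  have h1 := (M.basis T).linear_combination_coord_eq_self
  have h := congrArg a ((M.basis T).affineCombination_coord_eq_self x)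
  rw [Finset.map_affineCombination _ _ _ ((M.basis T).sum_coord_apply_eq_one x),
    Finset.affineCombination_eq_linear_combination _ _ _
      ((M.basis T).sum_coord_apply_eq_one x)] at h
  rw [← h]
  refine Finset.sum_congr rfl fun z _ => ?_
  simp only [smul_eq_mul, Function.comp]
  exact mul_comm _ _

theorem affine_eq_zero (T : M.cells) (a : E d →ᵃ[ℝ] ℝ)
    (h : ∀ z ∈ T.1, ∫ x in openSimplex T.1, a x * M.bary T z x = 0) : a = 0 := by
  have hb : ∀ z : T.1, (M.basis T).coord z = M.bary T z.1 := fun z => by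
    simp [bary]
  have hint : ∫ x in openSimplex T.1, a x * a x = 0 := by
    have : ∀ x, a x * a x = ∑ z : T.1, a z * (a x * M.bary T z x) := fun x => by
      conv_lhs => rw [M.affine_eq_sum T a x]
      rw [Finset.sum_mul]
      refine Finset.sum_congr rfl fun z _ => ?_
      rw [← hb, ← M.affine_eq_sum T a x]
      ring
    simp_rw [this]
    rw [integral_finsetSum Finset.univ fun (z : T.1) _ =>
      ((M.integrableOn_affine_mul T a (M.bary T z)).integrable.const_mul (a z))]
    refine Finset.sum_eq_zero fun z _ => ?_
    rw [integral_const_mul, h z z.2, mul_zero]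
  have hc : Continuous a := a.continuous_of_finiteDimensional
  have hae : (fun x => a x * a x) =ᵐ[volume.restrict (openSimplex T.1)] 0 :=
    (integral_eq_zero_iff_of_nonneg (fun x => mul_self_nonneg (a x))
      (M.integrableOn_affine_mul T a a)).1 hint
  have heq : EqOn (fun x => a x * a x) 0 (openSimplex T.1) :=
    Measure.eqOn_open_of_ae_eq hae isOpen_interior (hc.mul hc).continuousOn continuousOn_const
  have hz : EqOn a (0 : E d →ᵃ[ℝ] ℝ) (openSimplex T.1) := fun x hx => by
    simpa using heq hx
  have hspan : affineSpan ℝ (openSimplex T.1) = ⊤ :=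
    isOpen_interior.affineSpan_eq_top (M.openSimplex_nonempty T)
  exact AffineMap.ext_on hspan hz

/-- There is exactly one affine function `ψ` whose `L²(T)` inner product is `1` with the
barycentric coordinate of `z` and `0` with those of the other vertices. -/
theorem existsUnique_dualFunction (T : M.cells) (z : E d) :
    ∃! ψ : E d →ᵃ[ℝ] ℝ, ∀ z' ∈ T.1,
      ∫ x in openSimplex T.1, ψ x * M.bary T z' x = if z' = z then 1 else 0 := by
  classical
  let Λ : (E d →ᵃ[ℝ] ℝ) →ₗ[ℝ] (T.1 → ℝ) :=
    { toFun := fun a z' => ∫ x in openSimplex T.1, a x * M.bary T z' x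
      map_add' := fun a b => by
        funext z'
        simp only [AffineMap.coe_add, Pi.add_apply, add_mul]
        exact integral_add (M.integrableOn_affine_mul T a _) (M.integrableOn_affine_mul T b _)
      map_smul' := fun c a => by
        funext z'
        simp only [AffineMap.coe_smul, Pi.smul_apply, smul_eq_mul, mul_assoc, RingHom.id_apply]
        exact integral_const_mul _ _ }
  let S : (T.1 → ℝ) →ₗ[ℝ] (E d →ᵃ[ℝ] ℝ) :=
    Fintype.linearCombination ℝ fun z' : T.1 => (M.basis T).coord z'
  have hΛ : ∀ a, Λ a = 0 → a = 0 := fun a ha =>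
    M.affine_eq_zero T a fun z' hz' => congrFun ha ⟨z', hz'⟩
  have hS : ∀ c, S c = 0 → c = 0 := fun c hc => by
    funext i
    have h0 := congrArg (fun a : E d →ᵃ[ℝ] ℝ => a (M.basis T i)) hc
    have happ : ∀ x, S c x = ∑ z' : T.1, c z' * (M.basis T).coord z' x := fun x => by
      simp only [S, Fintype.linearCombination_apply]
      rw [← AffineMap.toFun_eq_coe]
      induction (Finset.univ : Finset T.1) using Finset.induction_on with
      | empty => simp
      | insert a s ha ih =>
        rw [Finset.sum_insert ha, Finset.sum_insert ha, ← ih]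
        simp
    simpa [happ, AffineBasis.coord_apply] using h0
  have hsurj : Function.Surjective (Λ ∘ₗ S) :=
    LinearMap.injective_iff_surjective.1 <|
      (injective_iff_map_eq_zero _).2 fun c hc => hS c (hΛ _ hc)
  obtain ⟨c, hc⟩ := hsurj fun z' => if z'.1 = z then 1 else 0
  refine ⟨S c, fun z' hz' => congrFun hc ⟨z', hz'⟩, fun b hb => ?_⟩
  refine sub_eq_zero.1 (hΛ _ ?_)
  rw [map_sub, sub_eq_zero, show Λ (S c) = _ from hc]
  funext z'
  exact hb z' z'.2

/-- The function `ψ_{T,z} ∈ P¹(T)` with `⟨ψ_{T,z}, η_{z'}⟩_T = δ_{z,z'}` for all vertices `z'`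
of `T` (on `T` the hat function `η_{z'}` is the barycentric coordinate). -/
def dualFunction (T : M.cells) (z : E d) : E d →ᵃ[ℝ] ℝ :=
  (M.existsUnique_dualFunction T z).choose

/-! ### Functions on the mesh as elements of `L²(Ω)` -/

theorem isFiniteMeasure {d : ℕ} {Ω : Set (E d)} (M : Mesh Ω) : IsFiniteMeasure (volume.restrict Ω) := by
  have h : IsCompact (closure Ω) := by
    rw [M.covers]
    exact M.cells.isCompact_biUnion fun T _ => isCompact_closedSimplex T
  exact ⟨by
    rw [Measure.restrict_apply_univ]
    exact (measure_mono subset_closure).trans_lt h.measure_lt_top⟩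

theorem memLp {d : ℕ} {Ω : Set (E d)} (M : Mesh Ω) {f : E d → ℝ} (hf : BddMeas f) : MemLp f 2 (volume.restrict Ω) := by
  have := M.isFiniteMeasure
  obtain ⟨B, hB⟩ := hf.2
  exact MemLp.of_bound hf.1.aestronglyMeasurable B (Filter.Eventually.of_forall hB)

/-- The hat function `η_z`, the piecewise affine function with `η_z(z') = δ_{z,z'}` for all
vertices `z'` (up to the null set of all element boundaries, where it is set to zero). -/
def hat (z : E d) (x : E d) : ℝ :=
  ∑ T : M.cells, (openSimplex T.1).indicator (M.bary T z) x

/-- The bubble function `η_{b,T}`, the product of the hat functions of the vertices of `T`. -/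
def bubble (T : M.cells) (x : E d) : ℝ := ∏ z ∈ T.1, M.hat z x

theorem bddMeas_hat (z : E d) : BddMeas (M.hat z) :=
  BddMeas.sum _ _ fun T _ => bddMeas_indicator T.1 (M.bary T z)

theorem bddMeas_bubble (T : M.cells) : BddMeas (M.bubble T) :=
  BddMeas.prod _ _ fun z _ => M.bddMeas_hat z

/-- The hat function as an element of `L²(Ω)`. -/
def hatL2 (z : E d) : L2 Ω := (M.memLp (M.bddMeas_hat z)).toLp _

/-- The bubble function as an element of `L²(Ω)`. -/
def bubbleL2 (T : M.cells) : L2 Ω := (M.memLp (M.bddMeas_bubble T)).toLp _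

/-- The restriction of an affine function to `T`, extended by zero, as an element of `L²(Ω)`. -/
def affineL2 (T : M.cells) (a : E d →ᵃ[ℝ] ℝ) : L2 Ω :=
  (M.memLp (bddMeas_indicator T.1 a)).toLp _

/-- The indicator function `χ_T` as an element of `L²(Ω)`. -/
def charL2 (T : M.cells) : L2 Ω := M.affineL2 T (AffineMap.const ℝ (E d) 1)

/-! ### The operators -/

/-- The weight `|T| / ∑_{T' ∈ ω(z)} |T'|`. -/
def weight (T : Finset (E d)) (z : E d) : ℝ := vol T / ∑ T' ∈ M.patch {z}, vol T'

/-- The functional `v ↦ α_z = ∑_{T ∈ ω(z)} |T| ⟨v, ψ_{T,z}⟩_T / ∑_{T' ∈ ω(z)} |T'|`. -/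
def alpha (z : E d) : StrongDual ℝ (L2 Ω) :=
  ∑ T : M.cells with T.1 ∈ M.patch {z},
    M.weight T.1 z • innerSL ℝ (M.affineL2 T (M.dualFunction T z))

/-- The Scott–Zhang type operator `J v = ∑_z α_z(v) η_z`, the sum over the interior vertices. -/
def J : L2 Ω →L[ℝ] L2 Ω := ∑ z ∈ M.interiorVertices, (M.alpha z).smulRight (M.hatL2 z)

/-- `B v = ∑_T (⟨v, 1⟩_T / ⟨η_{b,T}, 1⟩_T) η_{b,T}`. -/
def B : L2 Ω →L[ℝ] L2 Ω :=
  ∑ T : M.cells, ((∫ x in openSimplex T.1, M.bubble T x)⁻¹ • innerSL ℝ (M.charL2 T)).smulRight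
    (M.bubbleL2 T)

/-- `P = J + B (1 - J)`. -/
def P : L2 Ω →L[ℝ] L2 Ω := M.J + M.B ∘L (ContinuousLinearMap.id ℝ (L2 Ω) - M.J)

/-- `P'`, the adjoint of `P` in `L²(Ω)`. -/
def P' : L2 Ω →L[ℝ] L2 Ω := ContinuousLinearMap.adjoint M.P

/-- `P⁰(𝒯)`, the space of piecewise constant functions, spanned by the indicator functions of
the elements. -/
def P0 : Submodule ℝ (L2 Ω) := Submodule.span ℝ (range M.charL2)

instance : FiniteDimensional ℝ M.P0 := FiniteDimensional.span_of_finite ℝ (finite_range _)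

/-- `Π⁰`, the `L²(Ω)` orthogonal projection onto the piecewise constant functions. -/
def Pi0 : L2 Ω →L[ℝ] L2 Ω := M.P0.starProjection

/-- `Q = Π⁰ P'` on `L²(Ω)`. -/
def Q : L2 Ω →L[ℝ] L2 Ω := M.Pi0 ∘L M.P'

/-- `R : H⁻¹(Ω) → L²(Ω)` is the adjoint of `P` regarded as a map from `L²(Ω)` to `H₀¹(Ω)`:
for all `v ∈ L²(Ω)` the function `P v` belongs to `H₀¹(Ω)`, and `⟨R φ, v⟩ = φ(P v)` for all
`φ ∈ H⁻¹(Ω)`. At most one `R` has this property. -/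
def IsAdjointOnHNeg (R : HNeg Ω →L[ℝ] L2 Ω) : Prop :=
  ∀ v : L2 Ω, ∃ w : H10 Ω, fn w = M.P v ∧ ∀ φ : HNeg Ω, inner ℝ (R φ) v = φ w

end Mesh

end NegSobolev

end

open NegSobolev

/-!
The operator `P` preserves the mean value over each element, because the bubble functions correct
the means of `J v`. Dually, `P'` is the identity on the piecewise constant functions, so that
`Q = Π⁰ P'` is a projection onto them (`P'_Pi0`, `Q_comp_Q`, `range_Q`).

Moving `Q` to the other side of the inner product gives `⟨Q φ, v⟩ = ⟨φ, P Π⁰ v⟩` (`inner_Q_left`).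
All estimates are therefore statements about `P` applied to piecewise constant functions, which is
the explicit quasi-interpolation `quasi`: its vertex values are weighted averages over the elements
at an interior vertex and zero at a boundary vertex, and bubble functions restore the means.
On an element it differs from the given constant by at most a multiple of the oscillation `osc`, the
differences between the vertex values and that constant (`abs_quasi_sub_le`), and its gradient is
bounded by the oscillation divided by the diameter (`norm_grad_sq_le`).

For the mean values of a test function `u` on `Ω` the oscillation is controlled by the energy
`‖∇u‖²` on the elements around a vertex. Mean values on two elements with a common facet are compared
through the mean of `u` on the facet (`abs_mean_sub_mean_le_of_adj`), and the mean value on an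
element with a facet on `∂Ω` is compared with zero (`abs_mean_le_of_isFreeFacet`). It remains to see
that such steps lead far enough: any two elements at an interior vertex are connected by a chain
through common facets (`starGraph_reachable`), and from any element at a boundary vertex there is
a chain to one with a facet on the boundary (`exists_reachable_isFreeFacet`). Both hold because
a family of elements at a vertex that cannot be left through a facet fills a neighbourhood of this
vertex (`biUnion_mem_nhds_of_closed`). Shape regularity bounds the number of elements at a vertex
(`card_star_le`), and the ratio of their sizes along a chain (`diam_le_mul_diam`); the latter needs
two common vertices of neighbours, hence `d ≥ 2`. The result is `sq_vertexValue_sub_mean_le` and,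
summed over the mesh, `sum_sq_osc_mean_le`.

Together with the Poincaré inequality on simplices (`integral_sq_sub_mean_le`) this bounds the error
of the quasi-interpolation by `h ‖∇u‖` and its gradient by `‖∇u‖`. The former is the approximation
property (`negNorm_sub_Q_le`). The latter makes `P Π⁰` bounded on `H₀¹(Ω)` with respect to the norm
of the gradient, which is the stability of `Q` on `H⁻¹(Ω)` (`norm_grad_lift_Pi0_le`,
`exists_isAdjointOnHNeg`). For the local bounds, the constant value of `Q φ` on `T` is
`⟨φ, P χ_T⟩ / |T|`, and `P χ_T` belongs to `H₀¹` of the patch of `T` (`isH10Rep_quasi_single`) with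
explicit bounds on its norms (`l2Norm_Q_le`, `negNorm_Q_le`).

Membership in `H₀¹` is obtained for nonnegative Lipschitz functions by truncation and mollification
(`isH10Rep_of_lipschitz`), and the estimates pass from test functions to `H₀¹` because they are
closed conditions (`H10_induction`).
-/

noncomputable section

namespace NegSobolev

open Filter Topology

/-! ### Geometry of simplices and of conforming meshes -/

/-- A bounded Lipschitz set lies on one side of its boundary, so closing it adds no interior
points. -/
theorem IsBoundedLipschitz.interior_closure {d : ℕ} {Ω : Set (E d)} (h : IsBoundedLipschitz Ω) :
    interior (closure Ω) = Ω := by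
  refine Subset.antisymm (fun x hx => ?_) (interior_maximal subset_closure h.isOpen)
  by_contra hxΩ
  have hxf : x ∈ frontier Ω := by
    rw [frontier, h.isOpen.interior_eq]
    exact ⟨interior_subset hx, hxΩ⟩
  obtain ⟨e, γ, K, r, he, hγ, hr, hball⟩ := h.locally_graph x hxf
  have hee : inner ℝ e e = (1 : ℝ) := by rw [real_inner_self_eq_norm_sq, he]; norm_num
  -- the points `x - t e` with small `t > 0` lie in the interior of the complement of `Ω`
  let p : ℝ → E d := fun t => x - t • e
  have hp : Continuous p := by fun_prop
  have hp0 : p 0 = x := by simp [p]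
  have h1 : ∀ᶠ t in 𝓝 (0 : ℝ), p t ∈ interior (closure Ω) ∩ Metric.ball x r := by
    refine hp.continuousAt.eventually_mem ?_
    rw [hp0]
    exact inter_mem (isOpen_interior.mem_nhds hx) (Metric.ball_mem_nhds x hr)
  obtain ⟨t, ht, ht0⟩ := ((h1.filter_mono nhdsWithin_le_nhds).and
    (self_mem_nhdsWithin : Ioi (0 : ℝ) ∈ 𝓝[>] (0 : ℝ))).exists
  have hγx : inner ℝ e x ≤ γ (x - inner ℝ e x • e) := by
    by_contra hlt
    exact hxΩ ((hball x (Metric.mem_ball_self hr)).2 (not_le.1 hlt))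
  have hpt : inner ℝ e (p t) < γ (p t - inner ℝ e (p t) • e) := by
    have h2 : inner ℝ e (p t) = inner ℝ e x - t := by
      simp only [p, inner_sub_right, real_inner_smul_right, hee, mul_one]
    have h3 : p t - inner ℝ e (p t) • e = x - inner ℝ e x • e := by
      rw [h2]; simp only [p]; module
    rw [h3, h2]
    have : (0 : ℝ) < t := ht0
    linarith
  have hopen : ∀ᶠ y in 𝓝 (p t), y ∉ Ω := by
    have hc : Continuous fun y : E d => γ (y - inner ℝ e y • e) :=
      hγ.continuous.comp (by fun_prop)
    have hc' : Continuous fun y : E d => inner ℝ e y := by fun_prop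
    filter_upwards [hc'.continuousAt.eventually_lt hc.continuousAt hpt,
      Metric.isOpen_ball.mem_nhds ht.2] with y hy hyb hyΩ
    exact absurd ((hball y hyb).1 hyΩ) (not_lt.2 hy.le)
  have hcl : p t ∈ closure Ω := interior_subset ht.1
  rw [mem_closure_iff_frequently] at hcl
  exact hcl hopen

namespace Mesh

variable {d : ℕ} {Ω : Set (E d)} (M : Mesh Ω)

theorem range_basis (T : M.cells) : range (M.basis T) = (T.1 : Set (E d)) := by
  change range ((↑) : T.1 → E d) = _
  simp

theorem bary_of_mem {T : M.cells} {z : E d} (h : z ∈ T.1) :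
    M.bary T z = (M.basis T).coord ⟨z, h⟩ := by
  simp [bary, h]

theorem bary_of_notMem {T : M.cells} {z : E d} (h : z ∉ T.1) : M.bary T z = 0 := by
  simp [bary, h]

theorem bary_self {T : M.cells} {z : E d} (h : z ∈ T.1) : M.bary T z z = 1 := by
  rw [M.bary_of_mem h]
  exact (M.basis T).coord_apply_eq ⟨z, h⟩

theorem bary_of_ne (T : M.cells) {z y : E d} (hy : y ∈ T.1) (h : z ≠ y) : M.bary T z y = 0 := by
  by_cases hz : z ∈ T.1
  · rw [M.bary_of_mem hz]
    refine (M.basis T).coord_apply_ne (i := ⟨z, hz⟩) (j := ⟨y, hy⟩) ?_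
    simpa [Subtype.ext_iff] using h
  · simp [M.bary_of_notMem hz]

theorem continuous_bary (T : M.cells) (z : E d) : Continuous (M.bary T z) :=
  (M.bary T z).continuous_of_finiteDimensional

theorem mem_closedSimplex_iff {T : M.cells} {x : E d} :
    x ∈ closedSimplex T.1 ↔ ∀ z ∈ T.1, 0 ≤ M.bary T z x := by
  rw [closedSimplex, ← M.range_basis T, AffineBasis.convexHull_eq_nonneg_coord]
  refine ⟨fun h z hz => by rw [M.bary_of_mem hz]; exact h _, fun h z => ?_⟩
  have := h z z.2
  rwa [M.bary_of_mem z.2] at this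

theorem mem_openSimplex_iff {T : M.cells} {x : E d} :
    x ∈ openSimplex T.1 ↔ ∀ z ∈ T.1, 0 < M.bary T z x := by
  rw [openSimplex, closedSimplex, ← M.range_basis T, AffineBasis.interior_convexHull]
  refine ⟨fun h z hz => by rw [M.bary_of_mem hz]; exact h _, fun h z => ?_⟩
  have := h z z.2
  rwa [M.bary_of_mem z.2] at this

/-- An affine function is determined by its values at the vertices of an element. -/
theorem affine_eq_sum_bary (T : M.cells) (a : E d →ᵃ[ℝ] ℝ) (x : E d) :
    a x = ∑ z ∈ T.1, a z * M.bary T z x := by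
  rw [M.affine_eq_sum T a x, ← Finset.sum_coe_sort T.1]
  exact Finset.sum_congr rfl fun z _ => by rw [M.bary_of_mem z.2]

theorem affine_ext {T : M.cells} {a b : E d →ᵃ[ℝ] ℝ} (h : ∀ z ∈ T.1, a z = b z) (x : E d) :
    a x = b x := by
  rw [M.affine_eq_sum_bary T a, M.affine_eq_sum_bary T b]
  exact Finset.sum_congr rfl fun z hz => by rw [h z hz]

theorem sum_bary (T : M.cells) (x : E d) : ∑ z ∈ T.1, M.bary T z x = 1 := by
  simpa using (M.affine_eq_sum_bary T (AffineMap.const ℝ (E d) 1) x).symm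

theorem bary_nonneg {T : M.cells} {x : E d} (hx : x ∈ closedSimplex T.1) (z : E d) :
    0 ≤ M.bary T z x := by
  by_cases hz : z ∈ T.1
  · exact M.mem_closedSimplex_iff.1 hx z hz
  · simp [M.bary_of_notMem hz]

theorem bary_le_one {T : M.cells} {x : E d} (hx : x ∈ closedSimplex T.1) (z : E d) :
    M.bary T z x ≤ 1 := by
  by_cases hz : z ∈ T.1
  · rw [← M.sum_bary T x]
    exact Finset.single_le_sum (f := fun z => M.bary T z x) (fun y _ => M.bary_nonneg hx y) hz
  · simp [M.bary_of_notMem hz]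

theorem _root_.AffineMap.apply_add_smul_sub (a : E d →ᵃ[ℝ] ℝ) (x y : E d) (t : ℝ) :
    a (x + t • (y - x)) = (1 - t) * a x + t * a y := by
  have h := AffineMap.apply_lineMap a x y t
  rw [AffineMap.lineMap_apply, AffineMap.lineMap_apply] at h
  simp only [vsub_eq_sub, vadd_eq_add, smul_eq_mul] at h
  rw [add_comm x, h]; ring

theorem subset_closedSimplex (T : Finset (E d)) : (T : Set (E d)) ⊆ closedSimplex T :=
  subset_convexHull ℝ _

theorem convex_closedSimplex (T : Finset (E d)) : Convex ℝ (closedSimplex T) :=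
  convex_convexHull ℝ _

theorem isClosed_closedSimplex (T : Finset (E d)) : IsClosed (closedSimplex T) :=
  (isCompact_closedSimplex T).isClosed

theorem convex_openSimplex (T : Finset (E d)) : Convex ℝ (openSimplex T) :=
  (convex_closedSimplex T).interior

theorem isOpen_openSimplex (T : Finset (E d)) : IsOpen (openSimplex T) := isOpen_interior

theorem closure_openSimplex (T : M.cells) : closure (openSimplex T.1) = closedSimplex T.1 := by
  rw [openSimplex, (convex_closedSimplex T.1).closure_interior_eq_closure_of_nonempty_interior
    (M.openSimplex_nonempty T), (isClosed_closedSimplex T.1).closure_eq]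

/-- Conformity in terms of coordinates: a common point of two elements has nonzero coordinates
only for common vertices. -/
theorem bary_eq_zero_of_mem_inter {T T' : M.cells} {x : E d} (hx : x ∈ closedSimplex T.1)
    (hx' : x ∈ closedSimplex T'.1) {z : E d} (hz' : z ∉ T'.1) : M.bary T z x = 0 := by
  have h := M.conforming T.1 T.2 T'.1 T'.2 ⟨hx, hx'⟩
  have hc : Convex ℝ {y | M.bary T z y = 0} :=
    (convex_singleton (0 : ℝ)).affine_preimage (M.bary T z)
  exact convexHull_min (fun y hy => M.bary_of_ne T hy.1 (ne_of_mem_of_not_mem hy.2 hz').symm) hc h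

/-- Barycentric coordinates of two elements agree where the elements meet, so the hat functions
are continuous. -/
theorem bary_eq_of_mem_inter {T T' : M.cells} {x : E d} (hx : x ∈ closedSimplex T.1)
    (hx' : x ∈ closedSimplex T'.1) (z : E d) : M.bary T z x = M.bary T' z x := by
  have h := M.conforming T.1 T.2 T'.1 T'.2 ⟨hx, hx'⟩
  have hc : Convex ℝ {y | (M.bary T z - M.bary T' z) y = 0} :=
    (convex_singleton (0 : ℝ)).affine_preimage (M.bary T z - M.bary T' z)
  have : x ∈ {y | (M.bary T z - M.bary T' z) y = 0} := by
    refine convexHull_min (fun y hy => ?_) hc h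
    by_cases hzy : z = y
    · subst hzy
      simp [M.bary_self (T := T) hy.1, M.bary_self (T := T') hy.2]
    · simp [M.bary_of_ne T hy.1 hzy, M.bary_of_ne T' hy.2 hzy]
  simpa [sub_eq_zero] using this

/-- An interior point of an element has no vanishing coordinate, so it belongs to no other
element. -/
theorem subset_of_mem_open_of_mem_closed {T T' : M.cells} {x : E d} (hx : x ∈ openSimplex T.1)
    (hx' : x ∈ closedSimplex T'.1) : T = T' := by
  have hsub : T.1 ⊆ T'.1 := fun z hz => by
    by_contra hz'
    exact (M.mem_openSimplex_iff.1 hx z hz).ne'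
      (M.bary_eq_zero_of_mem_inter (interior_subset hx) hx' hz')
  exact Subtype.ext (Finset.eq_of_subset_of_card_le hsub
    (by rw [M.card_eq T.1 T.2, M.card_eq T'.1 T'.2]))

theorem pairwise_disjoint_openSimplex :
    Pairwise (Function.onFun Disjoint fun T : M.cells => openSimplex T.1) :=
  fun _ _ h => disjoint_left.2 fun _ hx hx' =>
    h (M.subset_of_mem_open_of_mem_closed hx (interior_subset hx'))

theorem mem_of_mem_closedSimplex {T T' : M.cells} {z : E d} (hz : z ∈ T.1)
    (hz' : z ∈ closedSimplex T'.1) : z ∈ T'.1 := by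
  by_contra h
  have := M.bary_eq_zero_of_mem_inter (subset_closedSimplex _ hz) hz' h
  rw [M.bary_self hz] at this
  exact one_ne_zero this

theorem mem_patch_singleton_iff {T T' : M.cells} {z : E d} (hz : z ∈ T.1) :
    T'.1 ∈ M.patch {z} ↔ z ∈ T'.1 := by
  simp only [patch, Finset.mem_filter, T'.2, true_and, closure_singleton]
  rw [inter_singleton_nonempty]
  exact ⟨M.mem_of_mem_closedSimplex hz, fun h => subset_closedSimplex _ h⟩

theorem closedSimplex_subset_closure (T : M.cells) : closedSimplex T.1 ⊆ closure Ω := by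
  rw [M.covers]
  exact subset_biUnion_of_mem (u := fun T : Finset (E d) => convexHull ℝ (T : Set (E d))) T.2

theorem exists_mem_closedSimplex {x : E d} (hx : x ∈ closure Ω) :
    ∃ T : M.cells, x ∈ closedSimplex T.1 := by
  rw [M.covers] at hx
  simp only [mem_iUnion, exists_prop] at hx
  obtain ⟨T, hT, h⟩ := hx
  exact ⟨⟨T, hT⟩, h⟩

theorem openSimplex_subset (hΩ : IsBoundedLipschitz Ω) (T : M.cells) : openSimplex T.1 ⊆ Ω := by
  exact (interior_mono (M.closedSimplex_subset_closure T)).trans hΩ.interior_closure.subset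

/-- The patch domain is an interior of a subset of `closure Ω`; it lies in `Ω` since the Lipschitz
domain is regular open. -/
theorem patchDomain_subset (hΩ : IsBoundedLipschitz Ω) (S : Set (E d)) :
    M.patchDomain S ⊆ Ω := by
  refine (interior_mono (iUnion₂_subset fun T hT => ?_)).trans hΩ.interior_closure.subset
  classical
  exact M.closedSimplex_subset_closure ⟨T, (Finset.mem_filter.1 hT).1⟩

/-- Near any point only the elements whose closure contains that point occur. -/
theorem eventually_mem_closedSimplex {x : E d} (hx : x ∈ interior (closure Ω)) :
    ∀ᶠ y in 𝓝 x, ∃ T : M.cells, x ∈ closedSimplex T.1 ∧ y ∈ closedSimplex T.1 := by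
  have h : ∀ᶠ y in 𝓝 x, ∀ T : M.cells, x ∉ closedSimplex T.1 → y ∉ closedSimplex T.1 := by
    refine eventually_all.2 fun T => ?_
    by_cases hT : x ∈ closedSimplex T.1
    · simp [hT]
    · filter_upwards [(isClosed_closedSimplex T.1).isOpen_compl.mem_nhds hT] with y hy _
      exact hy
  filter_upwards [h, isOpen_interior.mem_nhds hx] with y hy hyΩ
  obtain ⟨T, hT⟩ := M.exists_mem_closedSimplex (interior_subset hyΩ)
  exact ⟨T, by_contra fun hxT => hy T hxT hT, hT⟩

theorem volume_closedSimplex_diff (T : Finset (E d)) :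
    volume (closedSimplex T \ openSimplex T) = 0 := by
  refine measure_mono_null ?_ ((convex_closedSimplex T).addHaar_frontier volume)
  rw [frontier, (isClosed_closedSimplex T).closure_eq]
  rfl

theorem ae_exists_mem_openSimplex (hΩ : IsOpen Ω) :
    ∀ᵐ x ∂volume.restrict Ω, ∃ T : M.cells, x ∈ openSimplex T.1 := by
  have h0 : volume (⋃ T : M.cells, closedSimplex T.1 \ openSimplex T.1) = 0 :=
    measure_iUnion_null fun T => volume_closedSimplex_diff T.1
  refine (ae_restrict_iff' hΩ.measurableSet).2 ?_
  filter_upwards [measure_eq_zero_iff_ae_notMem.1 h0] with x hx hxΩ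
  obtain ⟨T, hT⟩ := M.exists_mem_closedSimplex (subset_closure hxΩ)
  by_contra hne
  push Not at hne
  exact hx (mem_iUnion.2 ⟨T, hT, hne T⟩)

theorem restrict_eq_sum (hΩ : IsBoundedLipschitz Ω) :
    volume.restrict Ω = ∑ T : M.cells, volume.restrict (openSimplex T.1) := by
  have h : (Ω : Set (E d)) =ᵐ[volume] ⋃ T : M.cells, openSimplex T.1 := by
    refine (ae_eq_set (s := Ω)).2 ⟨?_, ?_⟩
    · have := M.ae_exists_mem_openSimplex hΩ.isOpen
      rw [ae_restrict_iff' hΩ.isOpen.measurableSet] at this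
      refine measure_mono_null (fun x hx => ?_) (ae_iff.1 this)
      simpa using hx
    · rw [sdiff_eq_empty.2 (iUnion_subset fun T => M.openSimplex_subset hΩ T), measure_empty]
  rw [Measure.restrict_congr_set h, Measure.restrict_iUnion M.pairwise_disjoint_openSimplex
    (fun T => (isOpen_openSimplex T.1).measurableSet), Measure.sum_fintype]

theorem lintegral_eq_sum (hΩ : IsBoundedLipschitz Ω) (f : E d → ℝ≥0∞) :
    ∫⁻ x in Ω, f x = ∑ T : M.cells, ∫⁻ x in openSimplex T.1, f x := by
  rw [M.restrict_eq_sum hΩ, lintegral_finsetSum_measure]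

theorem isFiniteMeasure_cell (T : Finset (E d)) :
    IsFiniteMeasure (volume.restrict (openSimplex T)) :=
  ⟨by
    rw [Measure.restrict_apply_univ]
    exact (measure_mono interior_subset).trans_lt (isCompact_closedSimplex T).measure_lt_top⟩

theorem volume_openSimplex_ne_top (T : Finset (E d)) : volume (openSimplex T) ≠ ∞ :=
  ((measure_mono interior_subset).trans_lt (isCompact_closedSimplex T).measure_lt_top).ne

theorem vol_pos (T : M.cells) : 0 < vol T.1 :=
  ENNReal.toReal_pos ((isOpen_openSimplex T.1).measure_pos volume (M.openSimplex_nonempty T)).ne'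
    (volume_openSimplex_ne_top T.1)

theorem vol_nonneg (T : Finset (E d)) : 0 ≤ vol T := measureReal_nonneg

theorem norm_sub_le_diam {T : Finset (E d)} {x y : E d} (hx : x ∈ closedSimplex T)
    (hy : y ∈ closedSimplex T) : ‖x - y‖ ≤ diam T := by
  rw [← dist_eq_norm]
  exact Metric.dist_le_diam_of_mem (isCompact_closedSimplex T).isBounded hx hy

theorem diam_pos (hd : 1 ≤ d) (T : M.cells) : 0 < diam T.1 := by
  have hc : 1 < T.1.card := by rw [M.card_eq T.1 T.2]; omega
  obtain ⟨a, ha, b, hb, hab⟩ := Finset.one_lt_card.1 hc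
  exact (norm_pos_iff.2 (sub_ne_zero.2 hab)).trans_le
    (norm_sub_le_diam (subset_closedSimplex _ ha) (subset_closedSimplex _ hb))

end Mesh

/-! ### Shape regularity -/

/-- The volume of the unit ball. -/
def ballVol (d : ℕ) : ℝ := volume.real (Metric.closedBall (0 : E d) 1)

theorem ballVol_nonneg (d : ℕ) : 0 ≤ ballVol d := measureReal_nonneg

theorem volumeReal_closedBall {d : ℕ} (x : E d) {r : ℝ} (hr : 0 ≤ r) :
    volume.real (Metric.closedBall x r) = r ^ d * ballVol d := by
  rw [ballVol, Measure.real, Measure.real, Measure.addHaar_closedBall' _ _ hr, ENNReal.toReal_mul,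
    ENNReal.toReal_ofReal (pow_nonneg hr _)]
  simp

namespace Mesh

variable {d : ℕ} {Ω : Set (E d)} (M : Mesh Ω)

theorem vol_le_ballVol (T : M.cells) : vol T.1 ≤ diam T.1 ^ d * ballVol d := by
  obtain ⟨x, hx⟩ := M.openSimplex_nonempty T
  rw [diam, ← volumeReal_closedBall x Metric.diam_nonneg]
  refine measureReal_mono (fun y hy => ?_) (isCompact_closedBall x _).measure_lt_top.ne
  rw [mem_closedBall_iff_norm]
  exact norm_sub_le_diam (interior_subset hy) (interior_subset hx)

/-- The edges of an element that emanate from one of its vertices form a basis. -/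
theorem exists_edgeBasis (T : M.cells) {z₀ : E d} (hz₀ : z₀ ∈ T.1) :
    ∃ (b : Module.Basis (Fin d) ℝ (E d)) (y : Fin d → E d), Function.Injective y ∧
      (∀ i, y i ∈ T.1 ∧ y i ≠ z₀) ∧ (∀ z ∈ T.1, z ≠ z₀ → ∃ i, y i = z) ∧
      ∀ i, b i = y i - z₀ := by
  classical
  let b₀ := (M.basis T).basisOf ⟨z₀, hz₀⟩
  have hcard : Fintype.card {j : T.1 // j ≠ ⟨z₀, hz₀⟩} = d := by
    rw [← Module.finrank_eq_card_basis b₀]; simp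
  let e := Fintype.equivFinOfCardEq hcard
  refine ⟨b₀.reindex e, fun i => (e.symm i).1.1, fun i j h => ?_, fun i => ⟨(e.symm i).1.2, ?_⟩,
    fun z hz hne => ⟨e ⟨⟨z, hz⟩, ?_⟩, ?_⟩, fun i => ?_⟩
  · exact e.symm.injective (Subtype.ext (Subtype.ext h))
  · exact fun h => (e.symm i).2 (Subtype.ext h)
  · simpa [Subtype.ext_iff] using hne
  · simp
  · rw [Module.Basis.reindex_apply, AffineBasis.basisOf_apply]
    rfl

/-- A quantitative form of Cramer's rule: the slope of a barycentric coordinate is a quotient of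
two determinants; the numerator is bounded by Hadamard's inequality, the denominator from below
by the volume of the simplex, which is contained in a parallelepiped. -/
theorem abs_bary_linear_mul_vol_le (hd : 1 ≤ d) (T : M.cells) {z : E d} (hz : z ∈ T.1) (u : E d) :
    |(M.bary T z).linear u| * vol T.1 ≤ ‖u‖ * diam T.1 ^ (d - 1) := by
  classical
  have hc : 1 < T.1.card := by rw [M.card_eq T.1 T.2]; omega
  obtain ⟨z₀, hz₀, hne⟩ := Finset.exists_mem_ne hc z
  obtain ⟨b, y, hyinj, hy, hysurj, hb⟩ := M.exists_edgeBasis T hz₀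
  obtain ⟨i, rfl⟩ := hysurj z hz hne.symm
  have : Fact (Module.finrank ℝ (E d) = d) := ⟨by simp⟩
  let o := (EuclideanSpace.basisFun (Fin d) ℝ).toBasis.orientation
  have hlin : ∀ j k, (M.bary T (y j)).linear (b k) = if j = k then 1 else 0 := fun j k => by
    rw [hb k, ← vsub_eq_sub, AffineMap.linearMap_vsub, M.bary_of_ne T hz₀ (hy j).2]
    split_ifs with h
    · rw [h, M.bary_self (hy k).1]; simp
    · rw [M.bary_of_ne T (hy k).1 fun h' => h (hyinj h')]; simp
  -- the simplex lies in the parallelepiped spanned by its edges at `z₀`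
  have hvol : vol T.1 ≤ |o.volumeForm b| := by
    have hsub : openSimplex T.1 ⊆ (z₀ + ·) '' parallelepiped b := by
      intro x hx
      have hx := interior_subset hx
      refine ⟨x - z₀, ?_, by simp⟩
      rw [mem_parallelepiped_iff]
      refine ⟨fun j => M.bary T (y j) x, ⟨fun j => M.bary_nonneg hx _, fun j => M.bary_le_one hx _⟩,
        ?_⟩
      have h1 : ∀ j, b.repr (x - z₀) j = M.bary T (y j) x := by
        have h2 : ∀ j, (b.coord j) = (M.bary T (y j)).linear := fun j => b.ext fun k => by
          rw [hlin, b.coord_apply, b.repr_self, Finsupp.single_apply]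
          simp only [eq_comm]
        intro j
        have := congrArg (fun f => f (x - z₀)) (h2 j)
        simp only [Module.Basis.coord_apply] at this
        rw [this, ← vsub_eq_sub, AffineMap.linearMap_vsub, M.bary_of_ne T hz₀ (hy j).2]
        simp
      conv_lhs => rw [← b.sum_repr (x - z₀)]
      simp_rw [h1]
    have h3 : volume (openSimplex T.1) ≤ ENNReal.ofReal |o.volumeForm b| := by
      refine (measure_mono hsub).trans ?_
      rw [image_add_left, measure_preimage_add, ← o.measure_eq_volume,
        AlternatingMap.measure_parallelepiped]
    exact ENNReal.toReal_le_of_le_ofReal (abs_nonneg _) h3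
  have hcramer : o.volumeForm (Function.update b i u)
      = (M.bary T (y i)).linear u * o.volumeForm b := by
    have : o.volumeForm.toMultilinearMap.toLinearMap b i
        = (o.volumeForm b) • (M.bary T (y i)).linear := by
      refine b.ext fun k => ?_
      rw [LinearMap.smul_apply, hlin, MultilinearMap.toLinearMap_apply]
      split_ifs with h
      · subst h; simp
      · simpa using o.volumeForm.map_update_self b h
    have := congrArg (fun f => f u) this
    simp only [MultilinearMap.toLinearMap_apply, LinearMap.smul_apply, smul_eq_mul] at this
    rw [mul_comm]
    exact this
  have hbn : ∀ j, ‖b j‖ ≤ diam T.1 := fun j => by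
    rw [hb j]
    exact norm_sub_le_diam (subset_closedSimplex _ (hy j).1) (subset_closedSimplex _ hz₀)
  calc |(M.bary T (y i)).linear u| * vol T.1
      ≤ |(M.bary T (y i)).linear u| * |o.volumeForm b| :=
        mul_le_mul_of_nonneg_left hvol (abs_nonneg _)
    _ = |o.volumeForm (Function.update b i u)| := by rw [hcramer, abs_mul]
    _ ≤ ∏ j, ‖Function.update b i u j‖ := o.abs_volumeForm_apply_le _
    _ = ‖u‖ * ∏ j ∈ Finset.univ.erase i, ‖b j‖ := by
        rw [← Finset.mul_prod_erase _ _ (Finset.mem_univ i), Function.update_self]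
        congr 1
        refine Finset.prod_congr rfl fun j hj => ?_
        rw [Function.update_of_ne (Finset.ne_of_mem_erase hj)]
    _ ≤ ‖u‖ * diam T.1 ^ (d - 1) := by
        gcongr
        calc ∏ j ∈ Finset.univ.erase i, ‖b j‖ ≤ ∏ _j ∈ Finset.univ.erase i, diam T.1 :=
              Finset.prod_le_prod (fun _ _ => norm_nonneg _) fun j _ => hbn j
          _ = diam T.1 ^ (d - 1) := by simp

variable {M} {Creg : ℝ}

theorem ShapeRegular.pow_diam_le (h : M.ShapeRegular Creg) (T : M.cells) :
    diam T.1 ^ d ≤ Creg * vol T.1 :=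
  (div_le_iff₀ (M.vol_pos T)).1 (h T.1 T.2)

theorem ShapeRegular.pos (h : M.ShapeRegular Creg) (hd : 1 ≤ d) (T : M.cells) : 0 < Creg :=
  (div_pos (pow_pos (M.diam_pos hd T) d) (M.vol_pos T)).trans_le (h T.1 T.2)

/-- Barycentric coordinates vary on the scale of the element. -/
theorem ShapeRegular.abs_bary_sub_le (h : M.ShapeRegular Creg) (hd : 1 ≤ d) (T : M.cells)
    (z x y : E d) : |M.bary T z x - M.bary T z y| ≤ Creg / diam T.1 * ‖x - y‖ := by
  have hC := h.pos hd T
  have hD := M.diam_pos hd T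
  by_cases hz : z ∈ T.1
  · have h1 := M.abs_bary_linear_mul_vol_le hd T hz (x - y)
    rw [← vsub_eq_sub x y, AffineMap.linearMap_vsub, vsub_eq_sub, vsub_eq_sub] at h1
    rw [div_mul_eq_mul_div, le_div_iff₀ hD]
    have h2 := h.pow_diam_le T
    have hp : 0 < diam T.1 ^ (d - 1) := pow_pos hD _
    have hpd : diam T.1 ^ d = diam T.1 ^ (d - 1) * diam T.1 := by
      rw [← pow_succ]; congr 1; omega
    refine le_of_mul_le_mul_right ?_ hp
    calc |M.bary T z x - M.bary T z y| * diam T.1 * diam T.1 ^ (d - 1)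
        = |M.bary T z x - M.bary T z y| * diam T.1 ^ d := by rw [hpd]; ring
      _ ≤ |M.bary T z x - M.bary T z y| * (Creg * vol T.1) := by gcongr
      _ = Creg * (|M.bary T z x - M.bary T z y| * vol T.1) := by ring
      _ ≤ Creg * (‖x - y‖ * diam T.1 ^ (d - 1)) := by gcongr
      _ = _ := by ring
  · rw [M.bary_of_notMem hz]
    simp only [AffineMap.coe_zero, Pi.zero_apply, sub_self, abs_zero]
    positivity

/-- Every edge of an element is comparable to its diameter. -/
theorem ShapeRegular.diam_le_mul_norm_sub (h : M.ShapeRegular Creg) (hd : 1 ≤ d) (T : M.cells)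
    {y z : E d} (hy : y ∈ T.1) (hz : z ∈ T.1) (hyz : y ≠ z) : diam T.1 ≤ Creg * ‖y - z‖ := by
  have h1 := h.abs_bary_sub_le hd T y y z
  rw [M.bary_self hy, M.bary_of_ne T hz hyz, div_mul_eq_mul_div,
    le_div_iff₀ (M.diam_pos hd T)] at h1
  simpa using h1

/-- Two elements with a common edge are of comparable size. -/
theorem ShapeRegular.diam_le_mul_diam (h : M.ShapeRegular Creg) (hd : 1 ≤ d) {T T' : M.cells}
    {y z : E d} (hy : y ∈ T.1) (hz : z ∈ T.1) (hy' : y ∈ T'.1) (hz' : z ∈ T'.1) (hyz : y ≠ z) :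
    diam T.1 ≤ Creg * diam T'.1 := by
  refine (h.diam_le_mul_norm_sub hd T hy hz hyz).trans ?_
  have := h.pos hd T
  gcongr
  exact norm_sub_le_diam (subset_closedSimplex _ hy') (subset_closedSimplex _ hz')

theorem homothety_image_subset (T : M.cells) {z : E d} (hz : z ∈ closedSimplex T.1) {t : ℝ}
    (ht : 0 < t) (ht1 : t ≤ 1) :
    AffineMap.homothety z t '' openSimplex T.1 ⊆ openSimplex T.1 := by
  rintro _ ⟨x, hx, rfl⟩
  rw [M.mem_openSimplex_iff] at hx ⊢
  intro y hy
  have h1 : AffineMap.homothety z t x = z + t • (x - z) := by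
    simp [AffineMap.homothety_apply, add_comm]
  rw [h1, AffineMap.apply_add_smul_sub]
  have h2 := mul_pos ht (hx y hy)
  have h3 := mul_nonneg (sub_nonneg.2 ht1) (M.bary_nonneg hz y)
  linarith

/-- The number of elements at a vertex is bounded: scaled to a common size about the vertex, they
are disjoint subsets of a ball, each filling a fixed proportion of it. -/
theorem ShapeRegular.card_star_le (h : M.ShapeRegular Creg) (hd : 1 ≤ d) (z : E d)
    (s : Finset M.cells)
    (hne : s.Nonempty) (hs : ∀ T ∈ s, z ∈ T.1) : (s.card : ℝ) ≤ Creg * ballVol d := by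
  classical
  obtain ⟨T₀, hT₀, hmin⟩ := s.exists_min_image (fun T => diam T.1) hne
  set r := diam T₀.1 with hr
  have hrpos : 0 < r := M.diam_pos hd T₀
  have hC := h.pos hd T₀
  -- each element shrunk towards `z` to the size of the smallest one
  let A : M.cells → Set (E d) := fun T => AffineMap.homothety z (r / diam T.1) '' openSimplex T.1
  have ht : ∀ T ∈ s, 0 < r / diam T.1 ∧ r / diam T.1 ≤ 1 := fun T hT =>
    ⟨div_pos hrpos (M.diam_pos hd T), (div_le_one (M.diam_pos hd T)).2 (hmin T hT)⟩
  have hsub : ∀ T ∈ s, A T ⊆ openSimplex T.1 := fun T hT =>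
    homothety_image_subset T (subset_closedSimplex _ (hs T hT)) (ht T hT).1 (ht T hT).2
  have hball : ∀ T ∈ s, A T ⊆ Metric.closedBall z r := by
    rintro T hT _ ⟨x, hx, rfl⟩
    rw [mem_closedBall_iff_norm, AffineMap.homothety_apply]
    simp only [vsub_eq_sub, vadd_eq_add, add_sub_cancel_right, norm_smul, Real.norm_eq_abs,
      abs_of_pos (ht T hT).1]
    rw [div_mul_eq_mul_div, div_le_iff₀ (M.diam_pos hd T)]
    gcongr
    exact norm_sub_le_diam (interior_subset hx) (subset_closedSimplex _ (hs T hT))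
  have hvol : ∀ T ∈ s, r ^ d / Creg ≤ volume.real (A T) := fun T hT => by
    have hD := M.diam_pos hd T
    rw [Measure.real, Measure.addHaar_image_homothety, ENNReal.toReal_mul,
      ENNReal.toReal_ofReal (abs_nonneg _), abs_of_nonneg (pow_nonneg (ht T hT).1.le _)]
    simp only [finrank_euclideanSpace, Fintype.card_fin]
    change _ ≤ _ * vol T.1
    rw [div_le_iff₀ hC, div_pow, div_mul_eq_mul_div, div_mul_eq_mul_div, le_div_iff₀ (pow_pos hD d)]
    calc r ^ d * diam T.1 ^ d ≤ r ^ d * (Creg * vol T.1) := by gcongr; exact h.pow_diam_le T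
      _ = _ := by ring
  have hmeas : ∀ T ∈ s, MeasurableSet (A T) := fun T hT => by
    have : IsUnit (r / diam T.1) := (ht T hT).1.ne'.isUnit
    exact ((AffineMap.homothety_isOpenMap z _ this.ne_zero) _ (isOpen_openSimplex T.1)).measurableSet
  have hdisj : (s : Set M.cells).PairwiseDisjoint A := fun T hT T' hT' hTT' =>
    (M.pairwise_disjoint_openSimplex hTT').mono (hsub T hT) (hsub T' hT')
  have h1 : ∑ T ∈ s, volume.real (A T) ≤ r ^ d * ballVol d := by
    rw [← volumeReal_closedBall z hrpos.le, ← measureReal_biUnion_finset hdisj hmeas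
      (fun T hT => ((measure_mono (hball T hT)).trans_lt
        (isCompact_closedBall z r).measure_lt_top).ne)]
    exact measureReal_mono (iUnion₂_subset hball) (isCompact_closedBall z r).measure_lt_top.ne
  have h2 : s.card * (r ^ d / Creg) ≤ r ^ d * ballVol d := by
    refine le_trans ?_ h1
    rw [← nsmul_eq_mul]
    exact Finset.card_nsmul_le_sum _ _ _ hvol
  have h3 : s.card * r ^ d ≤ Creg * ballVol d * r ^ d := by
    calc s.card * r ^ d = Creg * (s.card * (r ^ d / Creg)) := by field_simp
      _ ≤ Creg * (r ^ d * ballVol d) := by gcongr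
      _ = _ := by ring
  exact le_of_mul_le_mul_right h3 (pow_pos hrpos d)

theorem exists_bary_eq (T : M.cells) :
    ∃ m ∈ closedSimplex T.1, ∀ z ∈ T.1, M.bary T z m = ((d : ℝ) + 1)⁻¹ := by
  have h1 : ∀ z ∈ T.1, M.bary T z (Finset.univ.centroid ℝ (M.basis T)) = ((d : ℝ) + 1)⁻¹ := by
    intro z hz
    rw [M.bary_of_mem hz, AffineBasis.coord_apply_centroid _ (Finset.mem_univ _)]
    simp [M.card_eq T.1 T.2]
  refine ⟨_, M.mem_closedSimplex_iff.2 fun z hz => ?_, h1⟩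
  rw [h1 z hz]; positivity

/-- The mean of the bubble function is bounded below: on the concentric simplex of half the size
all barycentric coordinates are at least `1 / (2 (d + 1))`. -/
theorem le_integral_prod_bary (M : Mesh Ω) (T : M.cells) :
    (2 * ((d : ℝ) + 1))⁻¹ ^ (d + 1) * 2⁻¹ ^ d * vol T.1
      ≤ ∫ x in openSimplex T.1, ∏ z ∈ T.1, M.bary T z x := by
  obtain ⟨m, hm, hmz⟩ := exists_bary_eq T
  set S := AffineMap.homothety m (2⁻¹ : ℝ) '' openSimplex T.1 with hS
  have hsub : S ⊆ openSimplex T.1 := homothety_image_subset T hm (by norm_num) (by norm_num)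
  have hcont : Continuous fun x => ∏ z ∈ T.1, M.bary T z x :=
    continuous_finsetProd _ fun z _ => M.continuous_bary T z
  have hint : IntegrableOn (fun x => ∏ z ∈ T.1, M.bary T z x) (openSimplex T.1) :=
    (hcont.continuousOn.integrableOn_compact (isCompact_closedSimplex T.1)).mono_set
      interior_subset
  have hvolS : volume.real S = 2⁻¹ ^ d * vol T.1 := by
    rw [Measure.real, Measure.addHaar_image_homothety, ENNReal.toReal_mul,
      ENNReal.toReal_ofReal (abs_nonneg _), abs_of_nonneg (by positivity)]
    simp only [finrank_euclideanSpace, Fintype.card_fin]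
    rfl
  have hmeas : MeasurableSet S :=
    ((AffineMap.homothety_isOpenMap m _ (by norm_num)) _ (isOpen_openSimplex T.1)).measurableSet
  have hSfin : volume S ≠ ∞ := ne_top_of_le_ne_top (volume_openSimplex_ne_top T.1) (measure_mono hsub)
  calc (2 * ((d : ℝ) + 1))⁻¹ ^ (d + 1) * 2⁻¹ ^ d * vol T.1
      = ∫ x in S, (2 * ((d : ℝ) + 1))⁻¹ ^ (d + 1) := by
        rw [setIntegral_const, hvolS, smul_eq_mul]; ring
    _ ≤ ∫ x in S, ∏ z ∈ T.1, M.bary T z x := by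
        refine setIntegral_mono_on (integrableOn_const hSfin) (hint.mono_set hsub) hmeas ?_
        rintro _ ⟨x, hx, rfl⟩
        rw [← M.card_eq T.1 T.2, ← Finset.prod_const]
        refine Finset.prod_le_prod (fun _ _ => by positivity) fun z hz => ?_
        have h1 : AffineMap.homothety m (2⁻¹ : ℝ) x = m + (2⁻¹ : ℝ) • (x - m) := by
          simp [AffineMap.homothety_apply, add_comm]
        rw [h1, AffineMap.apply_add_smul_sub, hmz z hz, mul_inv]
        have := M.bary_nonneg (interior_subset hx) z
        norm_num
        exact this
    _ ≤ ∫ x in openSimplex T.1, ∏ z ∈ T.1, M.bary T z x := by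
        refine setIntegral_mono_set hint ?_ hsub.eventuallyLE
        filter_upwards [ae_restrict_mem (isOpen_openSimplex T.1).measurableSet] with x hx
        exact Finset.prod_nonneg fun z _ => M.bary_nonneg (interior_subset hx) z

end Mesh

/-! ### Chains of elements in the star of a vertex -/

theorem volume_affine_zero_set {d : ℕ} (a : E d →ᵃ[ℝ] ℝ) (ha : ∃ x, a x ≠ 0) :
    volume {x | a x = 0} = 0 := by
  have h : {x | a x = 0} = ((AffineSubspace.mk' (0 : ℝ) ⊥).comap a : AffineSubspace ℝ (E d)) := by
    ext x
    simp [AffineSubspace.mem_mk']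
  rw [h]
  refine Measure.addHaar_affineSubspace _ _ fun htop => ?_
  obtain ⟨x, hx⟩ := ha
  have : x ∈ ((AffineSubspace.mk' (0 : ℝ) ⊥).comap a : AffineSubspace ℝ (E d)) := by
    rw [htop]; trivial
  rw [← SetLike.mem_coe, ← h] at this
  exact hx this

namespace Mesh

variable {d : ℕ} {Ω : Set (E d)} (M : Mesh Ω)

open Classical in
/-- Two elements with a common facet, which has all the vertices of the first one except `z₀`,
lie on opposite sides of it, so together they are a neighbourhood of each point of its relative
interior. -/
theorem union_mem_nhds {T T' : M.cells} (hne : T ≠ T') {z₀ : E d} (hz₀ : z₀ ∈ T.1)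
    (hsub : T.1.erase z₀ ⊆ T'.1) {x : E d} (hx0 : M.bary T z₀ x = 0)
    (hx : ∀ y ∈ T.1, y ≠ z₀ → 0 < M.bary T y x) :
    closedSimplex T.1 ∪ closedSimplex T'.1 ∈ 𝓝 x := by
  have hxT : x ∈ closedSimplex T.1 := M.mem_closedSimplex_iff.2 fun y hy => by
    by_cases h : y = z₀
    · rw [h, hx0]
    · exact (hx y hy h).le
  -- the vertex of `T'` off the common facet
  obtain ⟨z₁, hz₁, hz₁T⟩ : ∃ z₁ ∈ T'.1, z₁ ∉ T.1 := by
    by_contra! hcon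
    exact hne (Subtype.ext (Finset.eq_of_subset_of_card_le hcon
      (by rw [M.card_eq T.1 T.2, M.card_eq T'.1 T'.2])).symm)
  have hT' : ∀ y ∈ T'.1, y ≠ z₁ → y ∈ T.1.erase z₀ := by
    have hz₁e : z₁ ∉ T.1.erase z₀ := fun h => hz₁T (Finset.mem_of_mem_erase h)
    have hins : insert z₁ (T.1.erase z₀) = T'.1 := by
      refine Finset.eq_of_subset_of_card_le (Finset.insert_subset hz₁ hsub) ?_
      rw [Finset.card_insert_of_notMem hz₁e, Finset.card_erase_of_mem hz₀, M.card_eq T.1 T.2,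
        M.card_eq T'.1 T'.2]
      omega
    intro y hy hyz
    rw [← hins] at hy
    exact (Finset.mem_insert.1 hy).resolve_left hyz
  set μ := M.bary T z₀ z₁ with hμ
  -- on the other side, the two barycentric coordinates are proportional
  have hprop : ∀ y, M.bary T z₀ y = μ * M.bary T' z₁ y := fun y => by
    refine M.affine_ext (T := T') (a := M.bary T z₀) (b := μ • M.bary T' z₁) (fun v hv => ?_) y
    by_cases hv1 : v = z₁
    · subst hv1; simp [M.bary_self hv, hμ]
    · have := hT' v hv hv1
      have h1 := M.bary_of_ne T (Finset.mem_of_mem_erase this) (Finset.ne_of_mem_erase this).symm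
      simp [h1, M.bary_of_ne T' hv (Ne.symm hv1)]
  have hxT' : x ∈ closedSimplex T'.1 := by
    have h1 : ∀ v, M.bary T' v x = ∑ y ∈ T.1, M.bary T' v y * M.bary T y x := fun v =>
      M.affine_eq_sum_bary T (M.bary T' v) x
    refine M.mem_closedSimplex_iff.2 fun v hv => ?_
    rw [h1]
    refine Finset.sum_nonneg fun y hy => ?_
    by_cases hyz : y = z₀
    · rw [hyz, hx0, mul_zero]
    · exact mul_nonneg (M.bary_nonneg (subset_closedSimplex _
        (hsub (Finset.mem_erase.2 ⟨hyz, hy⟩))) v) (hx y hy hyz).le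
  have hμneg : μ < 0 := by
    by_contra! hμ0
    -- otherwise the two elements would overlap near `x`
    have hcont : ∀ y, Continuous fun ε : ℝ => M.bary T y (x + ε • (z₁ - x)) := fun y =>
      (M.continuous_bary T y).comp (by fun_prop)
    have hev : ∀ᶠ ε : ℝ in 𝓝[>] 0, ∀ y ∈ T.1, y ≠ z₀ → 0 < M.bary T y (x + ε • (z₁ - x)) := by
      refine nhdsWithin_le_nhds ((Finset.eventually_all T.1).2 fun y hy => ?_)
      by_cases hyz : y = z₀
      · simp [hyz]
      · filter_upwards [(hcont y).continuousAt.eventually_const_lt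
          (show 0 < M.bary T y (x + (0 : ℝ) • (z₁ - x)) by simpa using hx y hy hyz)] with ε h _
        exact h
    obtain ⟨ε, ⟨hε, hε0⟩, hε1⟩ := ((hev.and self_mem_nhdsWithin).and
      (nhdsWithin_le_nhds (eventually_le_nhds (zero_lt_one' ℝ)))).exists
    have hε0 : 0 < ε := hε0
    have hpT : x + ε • (z₁ - x) ∈ closedSimplex T.1 := M.mem_closedSimplex_iff.2 fun y hy => by
      by_cases hyz : y = z₀
      · rw [hyz, AffineMap.apply_add_smul_sub, hx0, ← hμ]
        positivity
      · exact (hε y hy hyz).le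
    have hpT' : x + ε • (z₁ - x) ∈ closedSimplex T'.1 :=
      (convex_closedSimplex T'.1).add_smul_sub_mem hxT' (subset_closedSimplex _ hz₁) ⟨hε0.le, hε1⟩
    have h0 := M.bary_eq_zero_of_mem_inter hpT' hpT hz₁T
    rw [AffineMap.apply_add_smul_sub, M.bary_self hz₁] at h0
    have := mul_nonneg (sub_nonneg.2 hε1) (M.bary_nonneg hxT' z₁)
    linarith
  have h1 : ∀ᶠ y in 𝓝 x, ∀ v ∈ T.1, v ≠ z₀ → 0 < M.bary T v y ∧ 0 < M.bary T' v y := by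
    refine (Finset.eventually_all T.1).2 fun v hv => ?_
    by_cases hvz : v = z₀
    · simp [hvz]
    · have h2 := hx v hv hvz
      have h3 : 0 < M.bary T' v x := by rwa [← M.bary_eq_of_mem_inter hxT hxT' v]
      filter_upwards [(M.continuous_bary T v).continuousAt.eventually_const_lt h2,
        (M.continuous_bary T' v).continuousAt.eventually_const_lt h3] with y hy hy' _
      exact ⟨hy, hy'⟩
  filter_upwards [h1] with y hy
  by_cases hs : 0 ≤ M.bary T z₀ y
  · left
    refine M.mem_closedSimplex_iff.2 fun v hv => ?_
    by_cases hvz : v = z₀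
    · rwa [hvz]
    · exact (hy v hv hvz).1.le
  · right
    refine M.mem_closedSimplex_iff.2 fun v hv => ?_
    by_cases hvz : v = z₁
    · rw [hprop y] at hs
      rw [hvz]
      by_contra! hneg
      exact hs (mul_nonneg_of_nonpos_of_nonpos hμneg.le hneg.le)
    · have := hT' v hv hvz
      exact (hy v (Finset.mem_of_mem_erase this) (Finset.ne_of_mem_erase this)).2.le

open Classical in
/-- The facet of `T` opposite to its vertex `z₀` is a facet of no other element. -/
def IsFreeFacet (T : M.cells) (z₀ : E d) : Prop :=
  ∀ T' : M.cells, T.1.erase z₀ ⊆ T'.1 → T' = T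

/-- A facet that belongs to only one element lies on the boundary. -/
theorem IsFreeFacet.notMem (hΩ : IsOpen Ω) {T : M.cells} {z₀ : E d} (hz₀ : z₀ ∈ T.1)
    (h : M.IsFreeFacet T z₀) {x : E d} (hx0 : M.bary T z₀ x = 0)
    (hx : ∀ y ∈ T.1, y ≠ z₀ → 0 < M.bary T y x) : x ∉ Ω := by
  classical
  intro hxΩ
  have hxT : x ∈ closedSimplex T.1 := M.mem_closedSimplex_iff.2 fun y hy => by
    by_cases h : y = z₀
    · rw [h, hx0]
    · exact (hx y hy h).le
  have hmem : x ∈ interior (closure Ω) := interior_maximal subset_closure hΩ hxΩ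
  have hT : ∀ᶠ y in 𝓝 x, y ∈ closedSimplex T.1 := by
    filter_upwards [M.eventually_mem_closedSimplex hmem] with y ⟨T', hxT', hy⟩
    have : T' = T := h T' fun v hv => by
      by_contra hv'
      exact (hx v (Finset.mem_of_mem_erase hv) (Finset.ne_of_mem_erase hv)).ne'
        (M.bary_eq_zero_of_mem_inter hxT hxT' hv')
    exact this ▸ hy
  have : x ∈ openSimplex T.1 := mem_interior_iff_mem_nhds.2 hT
  exact (M.mem_openSimplex_iff.1 this z₀ hz₀).ne' hx0

/-- The vertices of a free facet lie on the boundary too, being limits of points of its relative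
interior. -/
theorem IsFreeFacet.vertex_notMem (hΩ : IsOpen Ω) {T : M.cells} {z₀ z : E d} (hz₀ : z₀ ∈ T.1)
    (hz : z ∈ T.1) (hne : z ≠ z₀) (h : M.IsFreeFacet T z₀) : z ∉ Ω := by
  intro hzΩ
  obtain ⟨p, hp⟩ := M.openSimplex_nonempty T
  rw [M.mem_openSimplex_iff] at hp
  -- the projection of `p` to the facet along the edge from `z₀` to `z`
  set q := p + M.bary T z₀ p • (z - z₀) with hq
  have hqb : ∀ y, M.bary T y q
      = M.bary T y p + M.bary T z₀ p * (M.bary T y z - M.bary T y z₀) := fun y => by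
    rw [hq, add_comm, ← vadd_eq_add, AffineMap.map_vadd, vadd_eq_add, map_smul, ← vsub_eq_sub z z₀,
      AffineMap.linearMap_vsub]
    simp [add_comm]
  have hq0 : M.bary T z₀ q = 0 := by
    rw [hqb, M.bary_of_ne T hz hne.symm, M.bary_self hz₀]; ring
  have hqpos : ∀ y ∈ T.1, y ≠ z₀ → 0 < M.bary T y q := fun y hy hyz => by
    rw [hqb, M.bary_of_ne T hz₀ hyz, sub_zero]
    have := M.bary_nonneg (subset_closedSimplex T.1 hz) y
    have := mul_nonneg (hp z₀ hz₀).le this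
    linarith [hp y hy]
  have hev : ∀ᶠ t : ℝ in 𝓝[>] 0, z + t • (q - z) ∈ Ω := by
    have hc : Continuous fun t : ℝ => z + t • (q - z) := by fun_prop
    exact nhdsWithin_le_nhds (hc.continuousAt.eventually_mem (by simpa using hΩ.mem_nhds hzΩ))
  obtain ⟨t, ⟨ht, ht0⟩, ht1⟩ := ((hev.and self_mem_nhdsWithin).and
      (nhdsWithin_le_nhds (eventually_le_nhds (zero_lt_one' ℝ)))).exists
  have ht0 : 0 < t := ht0
  refine h.notMem M hΩ hz₀ ?_ (fun y hy hyz => ?_) ht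
  · rw [AffineMap.apply_add_smul_sub, hq0, M.bary_of_ne T hz hne.symm]; ring
  · rw [AffineMap.apply_add_smul_sub]
    have h1 := mul_nonneg (sub_nonneg.2 ht1) (M.bary_nonneg (subset_closedSimplex T.1 hz) y)
    have h2 := mul_pos ht0 (hqpos y hy hyz)
    linarith

open Classical in
/-- A family of elements at the vertex `z` that is closed under passing to the neighbour across
each facet containing `z`, and has such a neighbour for each of them, fills a neighbourhood of `z`:
a generic segment avoids all faces of codimension two and can leave the family only
through a facet. -/
theorem biUnion_mem_nhds_of_closed (S : Set M.cells) {z : E d} (hne : S.Nonempty)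
    (hz : ∀ T ∈ S, z ∈ T.1)
    (hS : ∀ T ∈ S, ∀ z₀ ∈ T.1, z₀ ≠ z → ∃ T' ∈ S, T' ≠ T ∧ T.1.erase z₀ ⊆ T'.1) :
    ⋃ T ∈ S, closedSimplex T.1 ∈ 𝓝 z := by
  set A := ⋃ T ∈ S, closedSimplex T.1 with hA
  have hAc : IsClosed A := S.toFinite.isClosed_biUnion fun T _ => isClosed_closedSimplex T.1
  have hev : ∀ᶠ x in 𝓝 z, ∀ T : M.cells, T ∈ S → 0 < M.bary T z x := by
    refine eventually_all.2 fun T => ?_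
    by_cases hT : T ∈ S
    · filter_upwards [(M.continuous_bary T z).continuousAt.eventually_const_lt
        (show 0 < M.bary T z z by rw [M.bary_self (hz T hT)]; exact one_pos)] with x hx _
      exact hx
    · simp [hT]
  obtain ⟨ρ, hρ, hball⟩ := Metric.eventually_nhds_iff_ball.1 hev
  -- a starting point off all hyperplanes spanned by facets
  obtain ⟨T₀, hT₀⟩ := hne
  have hopen : IsOpen (openSimplex T₀.1 ∩ Metric.ball z ρ) :=
    (isOpen_openSimplex _).inter Metric.isOpen_ball
  have hnon : (openSimplex T₀.1 ∩ Metric.ball z ρ).Nonempty := by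
    have : z ∈ closure (openSimplex T₀.1) := by
      rw [M.closure_openSimplex]; exact subset_closedSimplex _ (hz T₀ hT₀)
    obtain ⟨x, hx, hx'⟩ := mem_closure_iff.1 this _ Metric.isOpen_ball (Metric.mem_ball_self hρ)
    exact ⟨x, hx', hx⟩
  have hnull : ∀ᵐ x : E d, ∀ T : M.cells, ∀ y ∈ T.1, M.bary T y x ≠ 0 := by
    refine ae_all_iff.2 fun T => (ae_ball_iff T.1.countable_toSet).2 fun y hy => ?_
    refine measure_eq_zero_iff_ae_notMem.1 (volume_affine_zero_set (M.bary T y) ⟨y, ?_⟩)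
    rw [M.bary_self hy]; exact one_ne_zero
  obtain ⟨p, hp, hpS⟩ : ∃ p, (∀ T : M.cells, ∀ y ∈ T.1, M.bary T y p ≠ 0) ∧
      p ∈ openSimplex T₀.1 ∩ Metric.ball z ρ := by
    have := (Measure.dense_of_ae hnull).inter_open_nonempty _ hopen hnon
    obtain ⟨p, hp, hp'⟩ := this
    exact ⟨p, hp', hp⟩
  -- generic end points: the segment from `p` meets no face of codimension two
  have hgen : ∀ᵐ p' : E d, ∀ T : M.cells, ∀ a ∈ T.1, ∀ b ∈ T.1, a ≠ b →
      M.bary T a p * M.bary T b p' - M.bary T b p * M.bary T a p' ≠ 0 := by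
    refine ae_all_iff.2 fun T => (ae_ball_iff T.1.countable_toSet).2 fun a ha =>
      (ae_ball_iff T.1.countable_toSet).2 fun b hb => ?_
    by_cases hab : a = b
    · simp [hab]
    · have := measure_eq_zero_iff_ae_notMem.1 (volume_affine_zero_set
        (M.bary T a p • M.bary T b - M.bary T b p • M.bary T a) ⟨b, ?_⟩)
      · filter_upwards [this] with p' hp' _
        simpa using hp'
      · simp [M.bary_self (T := T) hb, M.bary_of_ne T hb hab, hp T a ha]
  have hkey : ∀ p' ∈ Metric.ball z ρ, (∀ T : M.cells, ∀ a ∈ T.1, ∀ b ∈ T.1, a ≠ b →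
      M.bary T a p * M.bary T b p' - M.bary T b p * M.bary T a p' ≠ 0) → p' ∈ A := by
    intro p' hp'ball hp'
    -- on the segment the family is relatively open as well as closed
    have hloc : ∀ x ∈ segment ℝ p p', x ∈ A → x ∈ interior A := by
      intro x hx hxA
      have hxball : x ∈ Metric.ball z ρ := (convex_ball z ρ).segment_subset hpS.2 hp'ball hx
      simp only [hA, mem_iUnion, exists_prop] at hxA
      obtain ⟨T, hTS, hxT⟩ := hxA
      have hsubA : ∀ T ∈ S, closedSimplex T.1 ⊆ A := fun T hT =>
        subset_biUnion_of_mem (u := fun T : M.cells => closedSimplex T.1) hT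
      by_cases hall : ∀ y ∈ T.1, M.bary T y x ≠ 0
      · have : x ∈ openSimplex T.1 := M.mem_openSimplex_iff.2 fun y hy =>
          (M.bary_nonneg hxT y).lt_of_ne (hall y hy).symm
        exact interior_mono (hsubA T hTS) this
      · push Not at hall
        obtain ⟨z₀, hz₀, hz₀0⟩ := hall
        have hz₀z : z₀ ≠ z := by
          rintro rfl
          exact (hball x hxball T hTS).ne' hz₀0
        obtain ⟨T', hT'S, hT'ne, hsub⟩ := hS T hTS z₀ hz₀ hz₀z
        rw [segment_eq_image'] at hx
        obtain ⟨t, ht, rfl⟩ := hx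
        refine mem_interior_iff_mem_nhds.2 (mem_of_superset
          (M.union_mem_nhds hT'ne.symm hz₀ hsub hz₀0 fun y hy hyz => ?_)
          (union_subset (hsubA T hTS) (hsubA T' hT'S)))
        refine (M.bary_nonneg hxT y).lt_of_ne fun h0 => hp' T y hy z₀ hz₀ hyz ?_
        -- two vanishing coordinates on the segment make the end values parallel
        have h0 := h0.symm
        rw [AffineMap.apply_add_smul_sub] at h0 hz₀0
        have ht0 : t ≠ 0 := by
          rintro rfl
          exact hp T y hy (by simpa using h0)
        have : t * (M.bary T y p * M.bary T z₀ p' - M.bary T z₀ p * M.bary T y p') = 0 := by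
          linear_combination M.bary T y p * hz₀0 - M.bary T z₀ p * h0
        exact (mul_eq_zero.1 this).resolve_left ht0
    have hpre : IsPreconnected (segment ℝ p p') := (convex_segment p p').isPreconnected
    have hpA : p ∈ A := by
      simp only [hA, mem_iUnion, exists_prop]
      exact ⟨T₀, hT₀, interior_subset hpS.1⟩
    have := hpre.subset_left_of_subset_union isOpen_interior hAc.isOpen_compl
      (disjoint_left.2 fun x hx hx' => hx' (interior_subset hx))
      (fun x hx => (Classical.em (x ∈ A)).imp (hloc x hx) id)
      ⟨p, left_mem_segment ℝ p p', hloc p (left_mem_segment ℝ p p') hpA⟩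
    exact interior_subset (this (right_mem_segment ℝ p p'))
  have hdense := Measure.dense_of_ae hgen
  refine mem_of_superset (Metric.ball_mem_nhds z hρ) fun x hx => ?_
  rw [← hAc.closure_eq]
  refine closure_mono ?_ (hdense.open_subset_closure_inter Metric.isOpen_ball hx)
  rintro y ⟨hy, hy'⟩
  exact hkey y hy hy'

open Classical in
/-- The elements at the vertex `z`, adjacent if they share a facet. -/
def starGraph (z : E d) : SimpleGraph {T : M.cells // z ∈ T.1} where
  Adj T T' := T ≠ T' ∧ (T.1.1 ∩ T'.1.1).card = d
  symm := ⟨fun _ _ h => ⟨h.1.symm, by rw [Finset.inter_comm]; exact h.2⟩⟩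
  loopless := ⟨fun _ h => h.1 rfl⟩

open Classical in
theorem starGraph_adj_of_erase_subset {z : E d} {T T' : {T : M.cells // z ∈ T.1}} (hne : T' ≠ T)
    {z₀ : E d} (hz₀ : z₀ ∈ T.1.1) (hsub : T.1.1.erase z₀ ⊆ T'.1.1) :
    (M.starGraph z).Adj T T' := by
  refine ⟨hne.symm, le_antisymm ?_ ?_⟩
  · have : T.1.1 ∩ T'.1.1 ⊂ T.1.1 := by
      refine Finset.inter_subset_left.ssubset_of_ne fun h => hne ?_
      have hs : T.1.1 ⊆ T'.1.1 := Finset.inter_eq_left.1 h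
      exact Subtype.ext (Subtype.ext (Finset.eq_of_subset_of_card_le hs
        (by rw [M.card_eq _ T.1.2, M.card_eq _ T'.1.2])).symm)
    have := Finset.card_lt_card this
    rw [M.card_eq _ T.1.2] at this
    omega
  · have := Finset.card_le_card (Finset.subset_inter (Finset.erase_subset z₀ T.1.1) hsub)
    rwa [Finset.card_erase_of_mem hz₀, M.card_eq _ T.1.2] at this

/-- Either the elements that can be reached from a given one fill a neighbourhood of the vertex, or
one of them has a free facet at that vertex. -/
theorem reachable_dichotomy {z : E d} (T : {T : M.cells // z ∈ T.1}) :
    (⋃ T' ∈ {T' : M.cells | ∃ h : z ∈ T'.1, (M.starGraph z).Reachable T ⟨T', h⟩},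
      closedSimplex T'.1 ∈ 𝓝 z) ∨
    ∃ T' : {T : M.cells // z ∈ T.1}, (M.starGraph z).Reachable T T' ∧
      ∃ z₀ ∈ T'.1.1, z ≠ z₀ ∧ M.IsFreeFacet T'.1 z₀ := by
  classical
  by_cases hfree : ∃ T' : {T : M.cells // z ∈ T.1}, (M.starGraph z).Reachable T T' ∧
      ∃ z₀ ∈ T'.1.1, z ≠ z₀ ∧ M.IsFreeFacet T'.1 z₀
  · exact Or.inr hfree
  · left
    refine M.biUnion_mem_nhds_of_closed _ ⟨T.1, T.2, SimpleGraph.Reachable.refl _⟩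
      (fun T' hT' => hT'.1) ?_
    rintro T' ⟨hzT', hr⟩ z₀ hz₀ hne
    have : ¬ M.IsFreeFacet T' z₀ := fun h => hfree ⟨⟨T', hzT'⟩, hr, z₀, hz₀, hne.symm, h⟩
    unfold IsFreeFacet at this
    push Not at this
    obtain ⟨T'', hsub, hne'⟩ := this
    have hz'' : z ∈ T''.1 := hsub (Finset.mem_erase.2 ⟨hne.symm, hzT'⟩)
    refine ⟨T'', ⟨hz'', hr.trans (SimpleGraph.Adj.reachable ?_)⟩, hne', ?_⟩
    · refine M.starGraph_adj_of_erase_subset (fun h => hne' ?_) hz₀ ?_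
      · exact congrArg Subtype.val h
      · convert hsub
    · convert hsub

/-- The star of an interior vertex is connected through facets. -/
theorem starGraph_reachable (hΩ : IsOpen Ω) {z : E d} (hz : z ∈ Ω)
    (T T' : {T : M.cells // z ∈ T.1}) : (M.starGraph z).Reachable T T' := by
  rcases M.reachable_dichotomy T with h | ⟨T₁, _, z₀, hz₀, hne, hfree⟩
  · have hcl : z ∈ closure (openSimplex T'.1.1) := by
      rw [M.closure_openSimplex]; exact subset_closedSimplex _ T'.2
    obtain ⟨x, hx, hx'⟩ := mem_closure_iff_nhds.1 hcl _ h
    simp only [mem_iUnion, exists_prop] at hx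
    obtain ⟨T₁, ⟨hz₁, hr⟩, hxT₁⟩ := hx
    have : T'.1 = T₁ := M.subset_of_mem_open_of_mem_closed hx' hxT₁
    have : T' = ⟨T₁, hz₁⟩ := Subtype.ext this
    rwa [this]
  · exact absurd hz (hfree.vertex_notMem M hΩ hz₀ T₁.2 hne)

/-- Each element at a boundary vertex is connected through facets with one that has a free facet
at this vertex. -/
theorem exists_reachable_isFreeFacet (hΩ : IsBoundedLipschitz Ω) {z : E d} (hz : z ∉ Ω)
    (T : {T : M.cells // z ∈ T.1}) :
    ∃ T' : {T : M.cells // z ∈ T.1}, (M.starGraph z).Reachable T T' ∧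
      ∃ z₀ ∈ T'.1.1, z ≠ z₀ ∧ M.IsFreeFacet T'.1 z₀ := by
  refine (M.reachable_dichotomy T).resolve_left fun h => hz ?_
  rw [← hΩ.interior_closure, mem_interior_iff_mem_nhds]
  exact mem_of_superset h (iUnion₂_subset fun T _ => M.closedSimplex_subset_closure T)

end Mesh

/-! ### Poincaré and trace inequalities by translation -/

theorem sq_lintegral_le_of_isProbabilityMeasure {α : Type*} [MeasurableSpace α] (μ : Measure α)
    [IsProbabilityMeasure μ] {f : α → ℝ≥0∞} (hf : AEMeasurable f μ) :
    (∫⁻ x, f x ∂μ) ^ 2 ≤ ∫⁻ x, f x ^ 2 ∂μ := by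
  have h := ENNReal.lintegral_mul_le_Lp_mul_Lq μ Real.HolderConjugate.two_two hf
    (aemeasurable_const (b := (1 : ℝ≥0∞)))
  simp only [Pi.mul_apply, mul_one, lintegral_const, measure_univ, ENNReal.rpow_two, one_pow,
    ENNReal.one_rpow] at h
  calc (∫⁻ x, f x ∂μ) ^ 2 ≤ ((∫⁻ x, f x ^ 2 ∂μ) ^ (1 / 2 : ℝ)) ^ 2 := by gcongr
    _ = ∫⁻ x, f x ^ 2 ∂μ := by
      rw [← ENNReal.rpow_natCast, ← ENNReal.rpow_mul]; norm_num

/-- Jensen's inequality for the square of a mean value. -/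
theorem sq_setIntegral_le {α : Type*} [MeasurableSpace α] {μ : Measure α} [IsFiniteMeasure μ]
    {g : α → ℝ} (hg : Integrable g μ) (hg2 : Integrable (fun x => g x ^ 2) μ) :
    (∫ x, g x ∂μ) ^ 2 ≤ μ.real univ * ∫ x, g x ^ 2 ∂μ := by
  rcases eq_or_ne (μ.real univ) 0 with h0 | h0
  · have : μ = 0 := by
      rw [Measure.real, ENNReal.toReal_eq_zero_iff] at h0
      exact Measure.measure_univ_eq_zero.1 (h0.resolve_right (measure_ne_top μ _))
    simp [this]
  have hpos : 0 < μ.real univ := lt_of_le_of_ne measureReal_nonneg h0.symm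
  set m := (∫ x, g x ∂μ) / μ.real univ with hm
  have h1 : 0 ≤ ∫ x, (g x - m) ^ 2 ∂μ := integral_nonneg fun _ => sq_nonneg _
  have h2 : ∫ x, (g x - m) ^ 2 ∂μ
      = (∫ x, g x ^ 2 ∂μ) - 2 * m * (∫ x, g x ∂μ) + m ^ 2 * μ.real univ := by
    have : ∀ x, (g x - m) ^ 2 = g x ^ 2 - 2 * m * g x + m ^ 2 := fun x => by ring
    simp_rw [this]
    rw [integral_add (f := fun x => g x ^ 2 - 2 * m * g x) (hg2.sub (hg.const_mul _))
      (integrable_const _), integral_sub hg2 (hg.const_mul _), integral_const_mul, integral_const,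
      smul_eq_mul]
    ring
  have h3 : m * μ.real univ = ∫ x, g x ∂μ := by rw [hm]; field_simp
  have h4 := mul_nonneg hpos.le (h2 ▸ h1)
  nlinarith [h4, h3]

variable {d : ℕ}

/-- The increment of a function along part of a segment is bounded by the derivative on those
points of the segment that belong to a given set. -/
theorem enorm_sub_sq_le_lintegral {u : E d → ℝ} (hu : ContDiff ℝ 1 u) {K : Set (E d)}
    (hK : MeasurableSet K) (x w : E d) {τ : ℝ} (hτ0 : 0 ≤ τ) (hτ1 : τ ≤ 1)
    (hseg : ∀ s, 0 ≤ s → s < τ → x + s • w ∈ K) :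
    ‖u (x + τ • w) - u x‖ₑ ^ 2 ≤ ‖w‖ₑ ^ 2 *
      ∫⁻ s in Icc (0 : ℝ) 1, K.indicator (fun y => ‖fderiv ℝ u y‖ₑ ^ 2) (x + s • w) := by
  have hcf : Continuous (fderiv ℝ u) := hu.continuous_fderiv one_ne_zero
  have hline : Continuous fun s : ℝ => x + s • w := by fun_prop
  have hftc : u (x + τ • w) - u x = ∫ s in (0 : ℝ)..τ, fderiv ℝ u (x + s • w) w := by
    rw [intervalIntegral.integral_eq_sub_of_hasDerivAt (f := fun s => u (x + s • w))]
    · simp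
    · intro s _
      have h1 : HasDerivAt (fun s : ℝ => x + s • w) w s := by
        simpa using ((hasDerivAt_id s).smul_const w).const_add x
      exact ((hu.differentiable one_ne_zero) _).hasFDerivAt.comp_hasDerivAt s h1
    · exact ((hcf.comp hline).clm_apply continuous_const).intervalIntegrable _ _
  have hmeas : Measurable fun s : ℝ => K.indicator (fun y => ‖fderiv ℝ u y‖ₑ) (x + s • w) :=
    (hcf.enorm.measurable.indicator hK).comp hline.measurable
  have h1 : ‖u (x + τ • w) - u x‖ₑ ≤ ‖w‖ₑ *
      ∫⁻ s in Icc (0 : ℝ) 1, K.indicator (fun y => ‖fderiv ℝ u y‖ₑ) (x + s • w) := by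
    rw [hftc, intervalIntegral.integral_of_le hτ0, ← lintegral_const_mul _ hmeas]
    refine (enorm_integral_le_lintegral_enorm _).trans ?_
    rw [restrict_Ico_eq_restrict_Ioc.symm]
    calc ∫⁻ s in Ico 0 τ, ‖fderiv ℝ u (x + s • w) w‖ₑ
        ≤ ∫⁻ s in Ico 0 τ, ‖w‖ₑ * K.indicator (fun y => ‖fderiv ℝ u y‖ₑ) (x + s • w) := by
          refine setLIntegral_mono (hmeas.const_mul _) fun s hs => ?_
          rw [indicator_of_mem (hseg s hs.1 hs.2), mul_comm]
          exact ContinuousLinearMap.le_opENorm _ _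
      _ ≤ _ := lintegral_mono_set (Ico_subset_Icc_self.trans (Icc_subset_Icc_right hτ1))
  have : IsProbabilityMeasure (volume.restrict (Icc (0 : ℝ) 1)) := ⟨by simp⟩
  calc ‖u (x + τ • w) - u x‖ₑ ^ 2 ≤ (‖w‖ₑ *
      ∫⁻ s in Icc (0 : ℝ) 1, K.indicator (fun y => ‖fderiv ℝ u y‖ₑ) (x + s • w)) ^ 2 := by gcongr
    _ ≤ ‖w‖ₑ ^ 2 * ∫⁻ s in Icc (0 : ℝ) 1,
        (K.indicator (fun y => ‖fderiv ℝ u y‖ₑ) (x + s • w)) ^ 2 := by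
      rw [mul_pow]
      gcongr
      exact sq_lintegral_le_of_isProbabilityMeasure _ hmeas.aemeasurable
    _ = _ := by
      congr 1
      refine lintegral_congr fun s => ?_
      by_cases h : x + s • w ∈ K <;> simp [h]

/-- The translation inequality: the increments of a function along a fixed vector `w`, stopped
at a variable time `τ x` while the segment stays in `K`, are bounded in mean square
by `‖w‖` times the norm of the derivative on `K`. -/
theorem lintegral_enorm_sub_sq_le {u : E d → ℝ} (hu : ContDiff ℝ 1 u) {K A : Set (E d)}
    (hK : MeasurableSet K) (w : E d) (τ : E d → ℝ) (hA : MeasurableSet A)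
    (hτ : ∀ x ∈ A, 0 ≤ τ x ∧ τ x ≤ 1)
    (hseg : ∀ x ∈ A, ∀ s, 0 ≤ s → s < τ x → x + s • w ∈ K) :
    ∫⁻ x in A, ‖u (x + τ x • w) - u x‖ₑ ^ 2 ≤
      ‖w‖ₑ ^ 2 * ∫⁻ x in K, ‖fderiv ℝ u x‖ₑ ^ 2 := by
  have hcf : Continuous (fderiv ℝ u) := hu.continuous_fderiv one_ne_zero
  have hF : Measurable (K.indicator fun y => ‖fderiv ℝ u y‖ₑ ^ 2) :=
    (hcf.enorm.measurable.pow_const 2).indicator hK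
  have hF2 : Measurable fun p : E d × ℝ =>
      K.indicator (fun y => ‖fderiv ℝ u y‖ₑ ^ 2) (p.1 + p.2 • w) :=
    hF.comp (by fun_prop)
  calc ∫⁻ x in A, ‖u (x + τ x • w) - u x‖ₑ ^ 2
      ≤ ∫⁻ x in A, ‖w‖ₑ ^ 2 *
        ∫⁻ s in Icc (0 : ℝ) 1, K.indicator (fun y => ‖fderiv ℝ u y‖ₑ ^ 2) (x + s • w) := by
        refine setLIntegral_mono' hA fun x hx => ?_
        exact enorm_sub_sq_le_lintegral hu hK x w (hτ x hx).1 (hτ x hx).2 (hseg x hx)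
    _ ≤ ∫⁻ x, ‖w‖ₑ ^ 2 *
        ∫⁻ s in Icc (0 : ℝ) 1, K.indicator (fun y => ‖fderiv ℝ u y‖ₑ ^ 2) (x + s • w) :=
        setLIntegral_le_lintegral _ _
    _ = ‖w‖ₑ ^ 2 * ∫⁻ s in Icc (0 : ℝ) 1, ∫⁻ x,
          K.indicator (fun y => ‖fderiv ℝ u y‖ₑ ^ 2) (x + s • w) := by
        rw [lintegral_const_mul _ hF2.lintegral_prod_right', lintegral_lintegral_swap]
        exact hF2.aemeasurable
    _ = ‖w‖ₑ ^ 2 * ∫⁻ x in K, ‖fderiv ℝ u x‖ₑ ^ 2 := by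
        simp_rw [lintegral_add_right_eq_self (μ := (volume : Measure (E d))),
          lintegral_indicator hK]
        simp

theorem integrableOn_openSimplex {f : E d → ℝ} (hf : Continuous f) (T : Finset (E d)) :
    IntegrableOn f (openSimplex T) :=
  (hf.continuousOn.integrableOn_compact (isCompact_closedSimplex T)).mono_set interior_subset

/-- `‖∇u‖²` over an element. -/
def energy (u : E d → ℝ) (T : Finset (E d)) : ℝ := ∫ x in openSimplex T, ‖fderiv ℝ u x‖ ^ 2

theorem energy_nonneg (u : E d → ℝ) (T : Finset (E d)) : 0 ≤ energy u T :=
  integral_nonneg fun _ => sq_nonneg _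

theorem lintegral_enorm_sq_eq {F : Type*} [NormedAddCommGroup F] {g : E d → F} {A : Set (E d)}
    (hg : IntegrableOn (fun x => ‖g x‖ ^ 2) A) :
    ∫⁻ x in A, ‖g x‖ₑ ^ 2 = ENNReal.ofReal (∫ x in A, ‖g x‖ ^ 2) := by
  rw [ofReal_integral_eq_lintegral_ofReal hg (Eventually.of_forall fun _ => sq_nonneg _)]
  refine lintegral_congr fun x => ?_
  rw [ENNReal.ofReal_pow (norm_nonneg _), ofReal_norm]

theorem lintegral_enorm_fderiv_sq {u : E d → ℝ} (hu : ContDiff ℝ 1 u) (T : Finset (E d)) :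
    ∫⁻ x in openSimplex T, ‖fderiv ℝ u x‖ₑ ^ 2 = ENNReal.ofReal (energy u T) :=
  lintegral_enorm_sq_eq (integrableOn_openSimplex
    (((hu.continuous_fderiv one_ne_zero).norm).pow 2) T)

namespace Mesh

variable {Ω : Set (E d)} (M : Mesh Ω)

/-- The affine map `x ↦ x + λ_{z₀}(x) w`, which fixes the facet of `T` opposite to `z₀`
and translates `z₀` by `w`. -/
def shear (T : M.cells) (z₀ w : E d) : E d →ᵃ[ℝ] E d :=
  AffineMap.id ℝ (E d) + (LinearMap.toSpanSingleton ℝ (E d) w).toAffineMap.comp (M.bary T z₀)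

theorem shear_apply (T : M.cells) (z₀ w x : E d) :
    M.shear T z₀ w x = x + M.bary T z₀ x • w := by
  simp [shear]

theorem continuous_shear (T : M.cells) (z₀ w : E d) : Continuous (M.shear T z₀ w) :=
  (M.shear T z₀ w).continuous_of_finiteDimensional

theorem bary_shear (T : M.cells) {z₀ z : E d} (hz : z ∈ T.1) (hz₀ : z₀ ∈ T.1) (x v : E d) (s : ℝ) :
    M.bary T v (x + s • (z - z₀))
      = M.bary T v x + s * ((if v = z then 1 else 0) - (if v = z₀ then 1 else 0)) := by
  classical
  have h : ∀ y ∈ T.1, M.bary T v y = if v = y then 1 else 0 := fun y hy => by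
    split_ifs with hvy
    · rw [hvy, M.bary_self hy]
    · exact M.bary_of_ne T hy hvy
  rw [add_comm, ← vadd_eq_add, AffineMap.map_vadd, vadd_eq_add, map_smul, ← vsub_eq_sub z z₀,
    AffineMap.linearMap_vsub, h z hz, h z₀ hz₀]
  simp [add_comm]

/-- The difference between a function and its trace on a facet, extended constantly along an edge,
is bounded by the gradient: it is an increment over a segment inside the element. -/
theorem integral_sq_sub_facetProj_le {u : E d → ℝ} (hu : ContDiff ℝ 1 u) (T : M.cells)
    {z₀ z : E d} (hz₀ : z₀ ∈ T.1) (hz : z ∈ T.1) (hne : z ≠ z₀) :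
    ∫ x in openSimplex T.1, (u x - u (M.shear T z₀ (z - z₀) x)) ^ 2
      ≤ diam T.1 ^ 2 * energy u T.1 := by
  have hm := (isOpen_openSimplex T.1).measurableSet
  have hcont : Continuous fun x => u x - u (M.shear T z₀ (z - z₀) x) :=
    hu.continuous.sub (hu.continuous.comp (M.continuous_shear T z₀ _))
  have h1 := lintegral_enorm_sub_sq_le hu hm (z - z₀) (M.bary T z₀) hm
    (fun x hx => ⟨M.bary_nonneg (interior_subset hx) _, M.bary_le_one (interior_subset hx) _⟩)
    (fun x hx s hs0 hs1 => by
      rw [M.mem_openSimplex_iff] at hx ⊢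
      intro v hv
      rw [M.bary_shear T hz hz₀]
      have := hx v hv
      by_cases h1 : v = z₀
      · subst h1
        simp only [hne.symm, if_false, if_true]
        linarith
      · simp only [h1, if_false, sub_zero]
        split_ifs <;> linarith)
  rw [lintegral_enorm_fderiv_sq hu] at h1
  have h2 : ∫⁻ x in openSimplex T.1, ‖u (x + M.bary T z₀ x • (z - z₀)) - u x‖ₑ ^ 2
      = ENNReal.ofReal (∫ x in openSimplex T.1, (u x - u (M.shear T z₀ (z - z₀) x)) ^ 2) := by
    rw [← setIntegral_congr_fun hm (f := fun x =>
      ‖u (x + M.bary T z₀ x • (z - z₀)) - u x‖ ^ 2) (fun x _ => ?_), lintegral_enorm_sq_eq]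
    · refine (integrableOn_openSimplex (hcont.pow 2) T.1).congr_fun (fun x _ => ?_) hm
      simp only [shear_apply, Real.norm_eq_abs, sq_abs, Pi.pow_apply]; ring
    · simp only [shear_apply, Real.norm_eq_abs, sq_abs]; ring
  have hE := energy_nonneg u T.1
  have h3 : ‖z - z₀‖ ^ 2 ≤ diam T.1 ^ 2 := by
    gcongr
    exact norm_sub_le_diam (subset_closedSimplex _ hz) (subset_closedSimplex _ hz₀)
  rw [h2, ← ofReal_norm, ← ENNReal.ofReal_pow (norm_nonneg _),
    ← ENNReal.ofReal_mul (by positivity), ENNReal.ofReal_le_ofReal_iff (by positivity)] at h1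
  exact h1.trans (by gcongr)

/-- The mean value over an element. -/
def mean (f : E d → ℝ) (T : Finset (E d)) : ℝ := (∫ x in openSimplex T, f x) / vol T

theorem sq_mean_le {f : E d → ℝ} (hf : Continuous f) (T : M.cells) :
    mean f T.1 ^ 2 ≤ (∫ x in openSimplex T.1, f x ^ 2) / vol T.1 := by
  have := isFiniteMeasure_cell T.1
  have h := sq_setIntegral_le (integrableOn_openSimplex hf T.1).integrable
    (integrableOn_openSimplex (hf.pow 2) T.1).integrable
  rw [measureReal_restrict_apply_univ] at h
  change _ ≤ vol T.1 * _ at h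
  have hv := M.vol_pos T
  rw [mean, div_pow, div_le_div_iff₀ (by positivity) hv]
  nlinarith

/-- The square of the constant in the Poincaré inequality on an element, divided by its volume. -/
def scale (T : Finset (E d)) : ℝ := diam T ^ 2 / vol T

/-- The Poincaré inequality on an element: the mean square of the increments is integrated over
all translation vectors. -/
theorem integral_sq_sub_mean_le {u : E d → ℝ} (hu : ContDiff ℝ 1 u) (T : M.cells) :
    ∫ x in openSimplex T.1, (u x - mean u T.1) ^ 2
      ≤ diam T.1 ^ d * ballVol d / vol T.1 * (diam T.1 ^ 2 * energy u T.1) := by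
  have hm := (isOpen_openSimplex T.1).measurableSet
  have hv := M.vol_pos T
  have hE := energy_nonneg u T.1
  have hD : 0 ≤ diam T.1 := Metric.diam_nonneg
  set t := openSimplex T.1 with ht
  have hcu := hu.continuous
  have h1 : ∀ x, (u x - mean u T.1) ^ 2 ≤ (vol T.1)⁻¹ * ∫ y in t, (u y - u x) ^ 2 := fun x => by
    have := isFiniteMeasure_cell T.1
    have h := M.sq_mean_le (f := fun y => u y - u x) (by fun_prop) T
    have h2 : mean (fun y => u y - u x) T.1 = mean u T.1 - u x := by
      rw [mean, integral_sub (integrableOn_openSimplex hcu T.1) (integrable_const _), sub_div,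
        setIntegral_const, smul_eq_mul, mean]
      congr 1
      change vol T.1 * u x / vol T.1 = u x
      field_simp
    rw [h2] at h
    rw [← neg_sub, neg_sq, inv_mul_eq_div]
    exact h
  have h2 : ∫⁻ x in t, ∫⁻ y in t, ‖u y - u x‖ₑ ^ 2
      ≤ ENNReal.ofReal (diam T.1 ^ d * ballVol d) * ENNReal.ofReal (diam T.1 ^ 2 * energy u T.1) := by
    have hmeas : Measurable fun p : E d × E d =>
        t.indicator (fun _ => (1 : ℝ≥0∞)) (p.1 + p.2) * ‖u (p.1 + p.2) - u p.1‖ₑ ^ 2 := by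
      refine ((measurable_const.indicator hm).comp (measurable_fst.add measurable_snd)).mul ?_
      have : Continuous fun p : E d × E d => u (p.1 + p.2) - u p.1 := by fun_prop
      exact this.enorm.measurable.pow_const 2
    calc ∫⁻ x in t, ∫⁻ y in t, ‖u y - u x‖ₑ ^ 2
        = ∫⁻ x in t, ∫⁻ w, t.indicator (fun _ => (1 : ℝ≥0∞)) (x + w) * ‖u (x + w) - u x‖ₑ ^ 2 := by
          refine lintegral_congr fun x => ?_
          rw [lintegral_add_left_eq_self
            (fun y => t.indicator (fun _ => (1 : ℝ≥0∞)) y * ‖u y - u x‖ₑ ^ 2) x,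
            ← lintegral_indicator hm]
          refine lintegral_congr fun y => ?_
          by_cases hy : y ∈ t <;> simp [hy]
      _ = ∫⁻ w, ∫⁻ x in t, t.indicator (fun _ => (1 : ℝ≥0∞)) (x + w) * ‖u (x + w) - u x‖ₑ ^ 2 :=
          lintegral_lintegral_swap hmeas.aemeasurable
      _ ≤ ∫⁻ w, (Metric.closedBall (0 : E d) (diam T.1)).indicator
            (fun _ => ENNReal.ofReal (diam T.1 ^ 2 * energy u T.1)) w := by
          refine lintegral_mono fun w => ?_
          have hA : MeasurableSet (t ∩ {x | x + w ∈ t}) :=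
            hm.inter (hm.preimage (measurable_add_const w))
          have e1 : ∫⁻ x in t, t.indicator (fun _ => (1 : ℝ≥0∞)) (x + w) * ‖u (x + w) - u x‖ₑ ^ 2
              = ∫⁻ x in t ∩ {x | x + w ∈ t}, ‖u (x + w) - u x‖ₑ ^ 2 := by
            rw [← lintegral_indicator hm, ← lintegral_indicator hA]
            refine lintegral_congr fun x => ?_
            by_cases hx : x ∈ t <;> by_cases hx' : x + w ∈ t <;> simp [hx, hx']
          rw [e1]
          by_cases hw : w ∈ Metric.closedBall (0 : E d) (diam T.1)
          · rw [indicator_of_mem hw]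
            have h3 := lintegral_enorm_sub_sq_le hu hm w (fun _ => 1) hA
              (fun _ _ => ⟨zero_le_one, le_rfl⟩) (fun x hx s hs0 hs1 =>
                by simpa using (convex_openSimplex T.1).add_smul_sub_mem hx.1 hx.2 ⟨hs0, hs1.le⟩)
            simp only [one_smul] at h3
            refine h3.trans ?_
            rw [lintegral_enorm_fderiv_sq hu, ← ofReal_norm,
              ← ENNReal.ofReal_pow (norm_nonneg _), ← ENNReal.ofReal_mul (by positivity)]
            refine ENNReal.ofReal_le_ofReal ?_
            gcongr
            simpa using hw
          · have : t ∩ {x | x + w ∈ t} = ∅ := by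
              refine eq_empty_of_forall_notMem fun x hx => hw ?_
              have := norm_sub_le_diam (interior_subset hx.2) (interior_subset hx.1)
              simpa using this
            rw [this]; simp
      _ = _ := by
          rw [lintegral_indicator Metric.isClosed_closedBall.measurableSet, setLIntegral_const,
            mul_comm, ← volumeReal_closedBall (0 : E d) hD, Measure.real, ENNReal.ofReal_toReal]
          exact (isCompact_closedBall _ _).measure_lt_top.ne
  have hi : IntegrableOn (fun x => (u x - mean u T.1) ^ 2) t :=
    integrableOn_openSimplex (by fun_prop) T.1
  have h3 : ENNReal.ofReal (∫ x in t, (u x - mean u T.1) ^ 2) ≤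
      ENNReal.ofReal (diam T.1 ^ d * ballVol d / vol T.1 * (diam T.1 ^ 2 * energy u T.1)) := by
    have hb := ballVol_nonneg d
    rw [ofReal_integral_eq_lintegral_ofReal hi (Eventually.of_forall fun _ => sq_nonneg _),
      div_eq_inv_mul, mul_assoc (vol T.1)⁻¹, ENNReal.ofReal_mul (by positivity),
      ENNReal.ofReal_mul (p := diam T.1 ^ d * ballVol d) (by positivity)]
    calc ∫⁻ x in t, ENNReal.ofReal ((u x - mean u T.1) ^ 2)
        ≤ ∫⁻ x in t, ENNReal.ofReal (vol T.1)⁻¹ * ∫⁻ y in t, ‖u y - u x‖ₑ ^ 2 := by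
          refine lintegral_mono fun x => ?_
          refine (ENNReal.ofReal_le_ofReal (h1 x)).trans_eq ?_
          rw [ENNReal.ofReal_mul (by positivity), lintegral_enorm_sq_eq]
          · simp
          · exact integrableOn_openSimplex (by fun_prop) T.1
      _ = ENNReal.ofReal (vol T.1)⁻¹ * ∫⁻ x in t, ∫⁻ y in t, ‖u y - u x‖ₑ ^ 2 :=
          lintegral_const_mul' _ _ ENNReal.ofReal_ne_top
      _ ≤ _ := by gcongr
  exact (ENNReal.ofReal_le_ofReal_iff (by have := ballVol_nonneg d; positivity)).1 h3

/-- The mean value over an element compared with the mean value over one of its facets; the latter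
is written as a mean value over the element of the function composed with the projection onto the
facet. -/
theorem mean_sub_facetMean_sq_le {u : E d → ℝ} (hu : ContDiff ℝ 1 u) (T : M.cells)
    {z₀ z : E d} (hz₀ : z₀ ∈ T.1) (hz : z ∈ T.1) (hne : z ≠ z₀) :
    (mean u T.1 - mean (fun x => u (M.shear T z₀ (z - z₀) x)) T.1) ^ 2
      ≤ scale T.1 * energy u T.1 := by
  have hc : Continuous fun x => u (M.shear T z₀ (z - z₀) x) :=
    hu.continuous.comp (M.continuous_shear T z₀ (z - z₀))
  have h1 : mean u T.1 - mean (fun x => u (M.shear T z₀ (z - z₀) x)) T.1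
      = mean (fun x => u x - u (M.shear T z₀ (z - z₀) x)) T.1 := by
    rw [mean, mean, mean, ← sub_div,
      integral_sub (integrableOn_openSimplex hu.continuous T.1) (integrableOn_openSimplex hc T.1)]
  rw [h1]
  refine (M.sq_mean_le (hu.continuous.sub hc) T).trans ?_
  rw [scale, div_mul_eq_mul_div]
  exact div_le_div_of_nonneg_right (M.integral_sq_sub_facetProj_le hu T hz₀ hz hne)
    (M.vol_pos T).le

/-- The shear that moves the vertex `z₀` of `T` to the vertex `z₁` of `T'` maps `T` onto `T'`. -/
theorem shear_mem_openSimplex {T T' : M.cells} {z₀ z₁ : E d} (hz₀ : z₀ ∈ T.1)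
    (h : ∀ v ∈ T'.1, v ≠ z₁ → v ∈ T.1 ∧ v ≠ z₀) (h' : ∀ v ∈ T.1, v ≠ z₀ → v ∈ T'.1 ∧ v ≠ z₁)
    (hz₁ : z₁ ∈ T'.1) (x : E d) :
    M.bary T' z₁ (M.shear T z₀ (z₁ - z₀) x) = M.bary T z₀ x ∧
      (x ∈ openSimplex T.1 → M.shear T z₀ (z₁ - z₀) x ∈ openSimplex T'.1) := by
  have hvert : ∀ y ∈ T.1, y ≠ z₀ → M.shear T z₀ (z₁ - z₀) y = y := fun y hy hne => by
    rw [shear_apply, M.bary_of_ne T hy hne.symm]; simp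
  have hvert0 : M.shear T z₀ (z₁ - z₀) z₀ = z₁ := by
    rw [shear_apply, M.bary_self hz₀]; simp
  have h1 : ∀ x, M.bary T' z₁ (M.shear T z₀ (z₁ - z₀) x) = M.bary T z₀ x := fun x => by
    refine M.affine_ext (T := T) (a := (M.bary T' z₁).comp (M.shear T z₀ (z₁ - z₀)))
      (b := M.bary T z₀) (fun y hy => ?_) x
    rw [AffineMap.comp_apply]
    by_cases hy0 : y = z₀
    · rw [hy0, hvert0, M.bary_self hz₁, M.bary_self hz₀]
    · rw [hvert y hy hy0, M.bary_of_ne T' (h' y hy hy0).1 (h' y hy hy0).2.symm,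
        M.bary_of_ne T hy (Ne.symm hy0)]
  have h2 : ∀ v ∈ T'.1, v ≠ z₁ → ∀ x,
      M.bary T' v (M.shear T z₀ (z₁ - z₀) x) = M.bary T v x := fun v hv hne x => by
    refine M.affine_ext (T := T) (a := (M.bary T' v).comp (M.shear T z₀ (z₁ - z₀)))
      (b := M.bary T v) (fun y hy => ?_) x
    rw [AffineMap.comp_apply]
    by_cases hy0 : y = z₀
    · rw [hy0, hvert0, M.bary_of_ne T' hz₁ hne, M.bary_of_ne T hz₀ (h v hv hne).2]
    · rw [hvert y hy hy0]
      by_cases hvy : v = y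
      · rw [hvy, M.bary_self (h' y hy hy0).1, M.bary_self hy]
      · rw [M.bary_of_ne T' (h' y hy hy0).1 hvy, M.bary_of_ne T hy hvy]
  refine ⟨h1 x, fun hx => ?_⟩
  rw [M.mem_openSimplex_iff] at hx ⊢
  intro v hv
  by_cases hv1 : v = z₁
  · rw [hv1, h1]; exact hx z₀ hz₀
  · rw [h2 v hv hv1]; exact hx v (h v hv hv1).1

/-- The mean values of the traces on a common facet, computed from either side, coincide. -/
theorem mean_facet_eq {T T' : M.cells} {z₀ z₁ : E d} (hz₀ : z₀ ∈ T.1) (hz₁ : z₁ ∈ T'.1)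
    (h : ∀ v ∈ T'.1, v ≠ z₁ → v ∈ T.1 ∧ v ≠ z₀) (h' : ∀ v ∈ T.1, v ≠ z₀ → v ∈ T'.1 ∧ v ≠ z₁)
    (u : E d → ℝ) (z : E d) :
    mean (fun x => u (M.shear T z₀ (z - z₀) x)) T.1
      = mean (fun x => u (M.shear T' z₁ (z - z₁) x)) T'.1 := by
  set Φ := M.shear T z₀ (z₁ - z₀) with hΦ
  set Ψ := M.shear T' z₁ (z₀ - z₁) with hΨ
  have hΨΦ : ∀ x, Ψ (Φ x) = x := fun x => by
    rw [hΨ, shear_apply, (M.shear_mem_openSimplex hz₀ h h' hz₁ x).1, hΦ, shear_apply]; module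
  have hΦΨ : ∀ x, Φ (Ψ x) = x := fun x => by
    rw [hΦ, shear_apply, (M.shear_mem_openSimplex hz₁ h' h hz₀ x).1, hΨ, shear_apply]; module
  have himg : Φ '' openSimplex T.1 = openSimplex T'.1 := by
    refine Subset.antisymm ?_ fun x hx => ?_
    · rintro _ ⟨x, hx, rfl⟩
      exact (M.shear_mem_openSimplex hz₀ h h' hz₁ x).2 hx
    · exact ⟨Ψ x, (M.shear_mem_openSimplex hz₁ h' h hz₀ x).2 hx, hΦΨ x⟩
  have hderiv : ∀ x ∈ openSimplex T.1,
      HasFDerivWithinAt Φ Φ.linear.toContinuousLinearMap (openSimplex T.1) x := fun x _ => by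
    have : (Φ : E d → E d) = fun x => Φ.linear.toContinuousLinearMap x + Φ 0 := by
      conv_lhs => rw [AffineMap.decomp Φ]
      rfl
    rw [this]
    exact ((ContinuousLinearMap.hasFDerivAt _).add_const _).hasFDerivWithinAt
  have hinj : InjOn Φ (openSimplex T.1) := fun x _ y _ hxy => by
    rw [← hΨΦ x, hxy, hΨΦ]
  have hcv : ∀ g : E d → ℝ, ∫ x in openSimplex T'.1, g x
      = |Φ.linear.toContinuousLinearMap.det| * ∫ x in openSimplex T.1, g (Φ x) := fun g => by
    rw [← himg, integral_image_eq_integral_abs_det_fderiv_smul volume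
      (isOpen_openSimplex T.1).measurableSet hderiv hinj]
    simp_rw [smul_eq_mul]
    exact integral_const_mul _ _
  have hvol : vol T'.1 = |Φ.linear.toContinuousLinearMap.det| * vol T.1 := by
    simpa [vol] using hcv fun _ => 1
  have hdet : |Φ.linear.toContinuousLinearMap.det| ≠ 0 := fun h0 => by
    rw [h0, zero_mul] at hvol
    exact (M.vol_pos T').ne' hvol
  have hcomp : ∀ x, M.shear T' z₁ (z - z₁) (Φ x) = M.shear T z₀ (z - z₀) x := fun x => by
    rw [shear_apply, (M.shear_mem_openSimplex hz₀ h h' hz₁ x).1, hΦ, shear_apply, shear_apply]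
    module
  rw [mean, mean, hcv, hvol, mul_div_mul_left _ _ hdet]
  simp_rw [hcomp]

/-- The mean values over two elements with a common facet differ by the energy. -/
theorem abs_mean_sub_mean_le_of_adj {u : E d → ℝ} (hu : ContDiff ℝ 1 u) {z : E d}
    {T T' : {T : M.cells // z ∈ T.1}} (hadj : (M.starGraph z).Adj T T') :
    |mean u T.1.1 - mean u T'.1.1| ≤
      √(scale T.1.1 * energy u T.1.1) + √(scale T'.1.1 * energy u T'.1.1) := by
  classical
  obtain ⟨hne, hcard⟩ := hadj
  have key : ∀ T T' : {T : M.cells // z ∈ T.1}, (T.1.1 ∩ T'.1.1).card = d →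
      ∃ z₀ ∈ T.1.1, z₀ ∉ T'.1.1 ∧ ∀ v ∈ T.1.1, v ≠ z₀ → v ∈ T'.1.1 := fun T T' hc => by
    have h1 : (T.1.1 \ T'.1.1).card = 1 := by
      have := Finset.card_sdiff_add_card_inter T.1.1 T'.1.1
      rw [M.card_eq _ T.1.2] at this
      have hc' : (T.1.1 ∩ T'.1.1).card = d := by convert hc
      omega
    obtain ⟨z₀, hz₀⟩ := Finset.card_eq_one.1 h1
    have h2 : z₀ ∈ T.1.1 \ T'.1.1 := hz₀ ▸ Finset.mem_singleton_self z₀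
    refine ⟨z₀, (Finset.mem_sdiff.1 h2).1, (Finset.mem_sdiff.1 h2).2, fun v hv hvz => ?_⟩
    by_contra hv'
    have : v ∈ T.1.1 \ T'.1.1 := Finset.mem_sdiff.2 ⟨hv, hv'⟩
    rw [hz₀] at this
    exact hvz (Finset.mem_singleton.1 this)
  obtain ⟨z₀, hz₀, hz₀', h₀⟩ := key T T' (by convert hcard)
  obtain ⟨z₁, hz₁, hz₁', h₁⟩ := key T' T (by rw [Finset.inter_comm]; convert hcard)
  have heq := M.mean_facet_eq (T := T.1) (T' := T'.1) hz₀ hz₁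
    (fun v hv hvz => ⟨h₁ v hv hvz, fun h => hz₀' (h ▸ hv)⟩)
    (fun v hv hvz => ⟨h₀ v hv hvz, fun h => hz₁' (h ▸ hv)⟩) u z
  have hb := M.mean_sub_facetMean_sq_le hu T.1 hz₀ T.2 fun h => hz₀' (h ▸ T'.2)
  have hb' := M.mean_sub_facetMean_sq_le hu T'.1 hz₁ T'.2 fun h => hz₁' (h ▸ T.2)
  rw [heq] at hb
  have e1 := Real.abs_le_sqrt hb
  have e2 := Real.abs_le_sqrt hb'
  calc |mean u T.1.1 - mean u T'.1.1| ≤ _ + _ := abs_sub_le _ _ _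
    _ ≤ _ := add_le_add e1 (by rw [abs_sub_comm]; exact e2)

/-- A function that vanishes outside `Ω` has a small mean value over each element with
a free facet. -/
theorem abs_mean_le_of_isFreeFacet (hΩ : IsOpen Ω) {u : E d → ℝ} (hu : ContDiff ℝ 1 u)
    (hu0 : ∀ x ∉ Ω, u x = 0) (T : M.cells) {z₀ z : E d} (hz₀ : z₀ ∈ T.1) (hz : z ∈ T.1)
    (hne : z ≠ z₀) (hfree : M.IsFreeFacet T z₀) :
    |mean u T.1| ≤ √(scale T.1 * energy u T.1) := by
  have hb := M.mean_sub_facetMean_sq_le hu T hz₀ hz hne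
  have h0 : mean (fun x => u (M.shear T z₀ (z - z₀) x)) T.1 = 0 := by
    rw [mean, setIntegral_congr_fun (isOpen_openSimplex T.1).measurableSet (g := fun _ => 0)]
    · simp
    · intro x hx
      rw [M.mem_openSimplex_iff] at hx
      refine hu0 _ (hfree.notMem M hΩ hz₀ ?_ fun y hy hyz => ?_)
      · rw [shear_apply, M.bary_shear T hz hz₀]
        simp [hne.symm]
      · rw [shear_apply, M.bary_shear T hz hz₀]
        have h1 := hx y hy
        have h2 := hx z₀ hz₀
        simp only [hyz, if_false, sub_zero]
        split_ifs
        · linarith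
        · linarith
  rw [h0, sub_zero] at hb
  exact Real.abs_le_sqrt hb

end Mesh

/-! ### Lipschitz functions in `H₀¹` -/

/-- A continuous function that is Lipschitz on each of finitely many closed sets that cover
a normed space is Lipschitz: along a segment its right difference quotients are bounded. -/
theorem lipschitzWith_of_finite_closed_cover {F ι : Type*} [NormedAddCommGroup F]
    [NormedSpace ℝ F] [Finite ι] {f : F → ℝ} (hf : Continuous f) (K : ι → Set F)
    (hK : ∀ i, IsClosed (K i)) (hcov : ∀ x, ∃ i, x ∈ K i) {L : ℝ≥0}
    (hL : ∀ i, LipschitzOnWith L f (K i)) : LipschitzWith L f := by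
  have key : ∀ x y, f y - f x ≤ L * ‖y - x‖ := by
    intro x y
    set p : ℝ → F := fun t => x + t • (y - x) with hp
    have hpc : Continuous p := by fun_prop
    set m : ℝ := L * ‖y - x‖ with hm
    have hslope : ∀ t ∈ Ico (0 : ℝ) 1, ∀ r, m < r →
        ∃ᶠ s in 𝓝[>] t, slope (fun t => f (p t) - f x) t s < r := by
      intro t _ r hr
      have h1 : ∃ᶠ s in 𝓝[>] t, ∃ i, p s ∈ K i :=
        (Eventually.of_forall fun s => hcov (p s)).frequently
      rw [frequently_exists] at h1
      obtain ⟨i, hi⟩ := h1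
      have hti : p t ∈ K i := by
        have : ∃ᶠ s in 𝓝 t, p s ∈ K i := hi.filter_mono nhdsWithin_le_nhds
        exact (hK i).mem_of_frequently_of_tendsto this hpc.continuousAt
      refine (hi.and_eventually self_mem_nhdsWithin).mono fun s ⟨hs, hts⟩ => lt_of_le_of_lt ?_ hr
      have hts : 0 < s - t := sub_pos.2 hts
      have h2 := (hL i).dist_le_mul _ hs _ hti
      rw [Real.dist_eq, dist_eq_norm] at h2
      have h3 : p s - p t = (s - t) • (y - x) := by simp only [hp]; module
      rw [h3, norm_smul, Real.norm_eq_abs, abs_of_pos hts] at h2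
      rw [slope_def_field, div_le_iff₀ hts]
      have h4 := le_abs_self (f (p s) - f (p t))
      rw [hm]
      linarith
    refine le_of_forall_pos_le_add fun η hη => ?_
    have := image_le_of_liminf_slope_right_lt_deriv_boundary (a := 0) (b := 1)
      (f := fun t => f (p t) - f x) (f' := fun _ => m) (by fun_prop) hslope
      (B := fun t => (m + η) * t) (B' := fun _ => m + η) (by simp [hp])
      (fun t => by simpa using (hasDerivAt_id t).const_mul (m + η)) (fun _ _ _ => by linarith)
      (right_mem_Icc.2 zero_le_one)
    simpa [hp] using this
  refine LipschitzWith.of_dist_le_mul fun x y => ?_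
  rw [Real.dist_eq, dist_eq_norm, abs_le]
  have h1 := key x y
  have h2 := key y x
  rw [norm_sub_rev] at h1
  constructor <;> linarith

/-- The mollification of `g` by the bump function `φ`. -/
def mollify (φ : ContDiffBump (0 : E d)) (g : E d → ℝ) (x : E d) : ℝ :=
  ∫ t, φ.normed volume t * g (x - t)

theorem integrable_normed_mul (φ : ContDiffBump (0 : E d)) {k : E d → ℝ} (hk : Continuous k) :
    Integrable fun t => φ.normed volume t * k t :=
  (φ.continuous_normed.mul hk).integrable_of_hasCompactSupport
    φ.hasCompactSupport_normed.mul_right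

theorem contDiff_mollify (φ : ContDiffBump (0 : E d)) {g : E d → ℝ} (hg : Continuous g) :
    ContDiff ℝ (⊤ : ℕ∞) (mollify φ g) := by
  have := HasCompactSupport.contDiff_convolution_left (μ := (volume : Measure (E d)))
    (ContinuousLinearMap.lsmul ℝ ℝ) (n := ⊤) (f := φ.normed volume) (g := g)
    φ.hasCompactSupport_normed φ.contDiff_normed hg.locallyIntegrable
  exact this

/-- An average over the support of the bump function inherits bounds. -/
theorem abs_integral_normed_mul_sub_le (φ : ContDiffBump (0 : E d)) {k : E d → ℝ}
    (hk : Continuous k) {c η : ℝ} (h : ∀ t ∈ Metric.ball (0 : E d) φ.rOut, |k t - c| ≤ η) :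
    |(∫ t, φ.normed volume t * k t) - c| ≤ η := by
  have h1 : (∫ t, φ.normed volume t * k t) - c = ∫ t, φ.normed volume t * (k t - c) := by
    simp_rw [mul_sub]
    rw [integral_sub (integrable_normed_mul φ hk) (φ.integrable_normed.mul_const c),
      integral_mul_const, φ.integral_normed, one_mul]
  have h2 : ∫ t, φ.normed volume t * η = η := by
    rw [integral_mul_const, φ.integral_normed, one_mul]
  rw [h1, ← h2, ← Real.norm_eq_abs]
  refine norm_integral_le_of_norm_le (φ.integrable_normed.mul_const η)
    (Eventually.of_forall fun t => ?_)
  rw [norm_mul, Real.norm_eq_abs, Real.norm_eq_abs, abs_of_nonneg (φ.nonneg_normed t)]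
  by_cases ht : t ∈ Metric.ball (0 : E d) φ.rOut
  · exact mul_le_mul_of_nonneg_left (h t ht) (φ.nonneg_normed t)
  · rw [← φ.support_normed_eq (μ := volume), Function.notMem_support] at ht
    simp [ht]

theorem abs_mollify_sub_le (φ : ContDiffBump (0 : E d)) {g : E d → ℝ} (hg : Continuous g)
    {x : E d} {c η : ℝ} (h : ∀ y ∈ Metric.ball x φ.rOut, |g y - c| ≤ η) :
    |mollify φ g x - c| ≤ η :=
  abs_integral_normed_mul_sub_le φ (k := fun t => g (x - t)) (by fun_prop) fun t ht =>
    h _ (by simpa [dist_eq_norm] using ht)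

theorem abs_mollify_sub_mollify_sub_le (φ : ContDiffBump (0 : E d)) {g : E d → ℝ}
    (hg : Continuous g) {x y : E d} {c η : ℝ}
    (h : ∀ t ∈ Metric.ball (0 : E d) φ.rOut, |g (x - t) - g (y - t) - c| ≤ η) :
    |mollify φ g x - mollify φ g y - c| ≤ η := by
  have h1 : mollify φ g x - mollify φ g y
      = ∫ t, φ.normed volume t * (g (x - t) - g (y - t)) := by
    rw [mollify, mollify, ← integral_sub (integrable_normed_mul φ (by fun_prop))
      (integrable_normed_mul φ (by fun_prop))]
    simp_rw [mul_sub]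
  rw [h1]
  exact abs_integral_normed_mul_sub_le φ (k := fun t => g (x - t) - g (y - t)) (by fun_prop) h

theorem lipschitzWith_mollify (φ : ContDiffBump (0 : E d)) {g : E d → ℝ} {L : ℝ≥0}
    (hg : LipschitzWith L g) : LipschitzWith L (mollify φ g) := by
  refine LipschitzWith.of_dist_le_mul fun x y => ?_
  have := abs_mollify_sub_mollify_sub_le φ hg.continuous (x := x) (y := y) (c := 0)
    (η := L * dist x y) fun t _ => by
      have := hg.dist_le_mul (x - t) (y - t)
      rwa [dist_sub_right, Real.dist_eq, ← sub_zero (g (x - t) - g (y - t))] at this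
  rwa [sub_zero, ← Real.dist_eq] at this

/-- Near a point of strict differentiability the derivative of the mollification is close to
that of the function. -/
theorem norm_fderiv_mollify_sub_le (φ : ContDiffBump (0 : E d)) {g : E d → ℝ}
    (hg : Continuous g) {x : E d} {g' : E d →L[ℝ] ℝ} {η : ℝ≥0} {r : ℝ} (hφ : φ.rOut < r)
    (h : LipschitzOnWith η (fun y => g y - g' y) (Metric.ball x r)) :
    ‖fderiv ℝ (mollify φ g) x - g'‖ ≤ η := by
  have hdiff : HasFDerivAt (fun y => mollify φ g y - g' y) (fderiv ℝ (mollify φ g) x - g') x :=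
    (((contDiff_mollify φ hg).differentiable (by simp)) x).hasFDerivAt.sub g'.hasFDerivAt
  refine hdiff.le_of_lipschitzOn (s := Metric.ball x (r - φ.rOut))
    (Metric.ball_mem_nhds x (sub_pos.2 hφ)) (LipschitzOnWith.of_dist_le_mul fun y hy z hz => ?_)
  have hmem : ∀ y ∈ Metric.ball x (r - φ.rOut), ∀ t ∈ Metric.ball (0 : E d) φ.rOut,
      y - t ∈ Metric.ball x r := fun y hy t ht => by
    rw [mem_ball_iff_norm] at hy ⊢
    rw [mem_ball_zero_iff] at ht
    calc ‖y - t - x‖ = ‖(y - x) - t‖ := by congr 1; abel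
      _ ≤ ‖y - x‖ + ‖t‖ := norm_sub_le _ _
      _ < r := by linarith
  have := abs_mollify_sub_mollify_sub_le φ hg (x := y) (y := z) (c := g' (y - z))
    (η := η * dist y z) fun t ht => by
      have h1 := h.dist_le_mul _ (hmem y hy t ht) _ (hmem z hz t ht)
      rw [dist_sub_right, Real.dist_eq] at h1
      refine le_trans (le_of_eq ?_) h1
      congr 1
      have : g' (y - z) = g' (y - t) - g' (z - t) := by rw [← map_sub]; congr 1; abel
      rw [this]; ring
  rw [Real.dist_eq]
  refine le_trans (le_of_eq ?_) this
  rw [map_sub]; congr 1; ring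

/-- The element `w` of `H₀¹(ω)` consists of the function `f` and its pointwise gradient. -/
def Represents {ω : Set (E d)} (w : H10 ω) (f : E d → ℝ) : Prop :=
  fn w =ᵐ[volume.restrict ω] f ∧ grad w =ᵐ[volume.restrict ω] gradient f ∧
    ∀ᵐ x ∂volume.restrict ω, DifferentiableAt ℝ f x

/-- The function `f` belongs to `H₀¹(ω)`, and its weak gradient is the pointwise one. -/
def IsH10Rep (ω : Set (E d)) (f : E d → ℝ) : Prop := ∃ w : H10 ω, Represents w f

/-- Dominated convergence in `L²`. -/
theorem tendsto_toLp_of_bounded {F : Type*} [NormedAddCommGroup F] {α : Type*}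
    [MeasurableSpace α] {μ : Measure α} [IsFiniteMeasure μ] {g : ℕ → α → F} {g' : α → F} {B : ℝ}
    (hg : ∀ n, MemLp (g n) 2 μ) (hg' : MemLp g' 2 μ) (hB : ∀ n, ∀ x, ‖g n x‖ ≤ B)
    (hB' : ∀ᵐ x ∂μ, ‖g' x‖ ≤ B) (hlim : ∀ᵐ x ∂μ, Tendsto (fun n => g n x) atTop (𝓝 (g' x))) :
    Tendsto (fun n => (hg n).toLp (g n)) atTop (𝓝 (hg'.toLp g')) := by
  rw [Lp.tendsto_Lp_iff_tendsto_eLpNorm'']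
  have h2 : ∀ n, eLpNorm (g n - g') 2 μ = (∫⁻ x, ‖g n x - g' x‖ₑ ^ (2 : ℝ) ∂μ) ^ (1 / 2 : ℝ) :=
    fun n => by
      rw [eLpNorm_eq_lintegral_rpow_enorm_toReal two_ne_zero ENNReal.ofNat_ne_top]
      simp
  simp_rw [h2]
  have h3 : Tendsto (fun n => ∫⁻ x, ‖g n x - g' x‖ₑ ^ (2 : ℝ) ∂μ) atTop (𝓝 (∫⁻ _, 0 ∂μ)) := by
    refine tendsto_lintegral_of_dominated_convergence' (fun _ => ENNReal.ofReal (2 * B) ^ (2 : ℝ))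
      (fun n => (((hg n).1.sub hg'.1).enorm.pow_const _)) (fun n => ?_) ?_ ?_
    · filter_upwards [hB'] with x hx
      gcongr
      rw [← ofReal_norm]
      refine ENNReal.ofReal_le_ofReal ((norm_sub_le _ _).trans ?_)
      linarith [hB n x]
    · rw [lintegral_const]
      exact ENNReal.mul_ne_top (ENNReal.rpow_ne_top_of_nonneg zero_le_two ENNReal.ofReal_ne_top)
        (measure_ne_top μ _)
    · filter_upwards [hlim] with x hx
      have h4 : Tendsto (fun n => ‖g n x - g' x‖ₑ) atTop (𝓝 0) := by
        have := (hx.sub_const (g' x)).enorm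
        simpa using this
      have := (ENNReal.continuous_rpow_const (y := 2)).tendsto 0 |>.comp h4
      simpa [Function.comp_def] using this
  have := (ENNReal.continuous_rpow_const (y := (1 / 2 : ℝ))).tendsto 0 |>.comp
    (by simpa using h3)
  simpa [Function.comp_def] using this

theorem norm_gradient_le_of_lipschitzWith {f : E d → ℝ} {L : ℝ≥0} (hf : LipschitzWith L f)
    (x : E d) : ‖gradient f x‖ ≤ L := by
  rw [gradient, LinearIsometryEquiv.norm_map]
  exact norm_fderiv_le_of_lipschitz ℝ hf

/-- A nonnegative Lipschitz function that vanishes outside a bounded open set `ω` and is strictly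
differentiable almost everywhere belongs to `H₀¹(ω)`: cut off its values below `ε`
and mollify on a scale smaller than `ε`. -/
theorem isH10Rep_of_lipschitz {ω : Set (E d)} (hωb : Bornology.IsBounded ω)
    {f : E d → ℝ} {L : ℝ≥0} (hf : LipschitzWith L f) (hf0 : ∀ x, 0 ≤ f x)
    (hfω : ∀ x ∉ ω, f x = 0)
    (hdiff : ∀ᵐ x ∂volume.restrict ω, ∃ f' : E d →L[ℝ] ℝ, HasStrictFDerivAt f f' x) :
    IsH10Rep ω f := by
  have hfin : IsFiniteMeasure (volume.restrict ω) :=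
    ⟨by rw [Measure.restrict_apply_univ]; exact hωb.measure_lt_top⟩
  set ε : ℕ → ℝ := fun n => 1 / ((n : ℝ) + 1) with hε
  have hεpos : ∀ n, 0 < ε n := fun n => by positivity
  have hε1 : ∀ n, ε n ≤ 1 := fun n => by
    rw [hε]; simp only; rw [div_le_one (by positivity)]; linarith [(n.cast_nonneg : (0 : ℝ) ≤ n)]
  have hεlim : Tendsto ε atTop (𝓝 0) := tendsto_one_div_add_atTop_nhds_zero_nat
  -- on the scale `δ n` the function varies by at most `ε n / 2`, so the mollification of its
  -- truncation at height `ε n` is supported where `f` is at least `ε n / 2`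
  set δ : ℕ → ℝ := fun n => ε n / (2 * (L + 1)) with hδ
  have hL0 : (0 : ℝ) ≤ L := L.coe_nonneg
  have hδpos : ∀ n, 0 < δ n := fun n => div_pos (hεpos n) (by positivity)
  have hLδ : ∀ n, L * δ n ≤ ε n / 2 := fun n => by
    simp only [hδ]
    rw [mul_div_assoc', div_le_div_iff₀ (by positivity) two_pos]
    nlinarith [hεpos n]
  have hδlim : Tendsto δ atTop (𝓝 0) := by
    simpa using hεlim.div_const (2 * ((L : ℝ) + 1))
  let φ : ℕ → ContDiffBump (0 : E d) := fun n =>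
    ⟨δ n / 2, δ n, by linarith [hδpos n], by linarith [hδpos n]⟩
  have hφ : ∀ n, (φ n).rOut = δ n := fun n => rfl
  set g : ℕ → E d → ℝ := fun n x => max (f x - ε n) 0 with hg
  have hgL : ∀ n, LipschitzWith L (g n) := fun n => by
    have h1 : LipschitzWith L fun x => f x - ε n := fun x y => by
      simpa [edist_sub_right] using hf x y
    exact h1.max_const 0
  have hgc : ∀ n, Continuous (g n) := fun n => (hgL n).continuous
  set u : ℕ → E d → ℝ := fun n => mollify (φ n) (g n) with hu
  have huL : ∀ n, LipschitzWith L (u n) := fun n => lipschitzWith_mollify _ (hgL n)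
  have hus : ∀ n, ContDiff ℝ (⊤ : ℕ∞) (u n) := fun n => contDiff_mollify _ (hgc n)
  have hfball : ∀ n x, ∀ y ∈ Metric.ball x (φ n).rOut, |f y - f x| ≤ ε n / 2 := fun n x y hy => by
    have h1 := hf.dist_le_mul y x
    rw [Real.dist_eq] at h1
    rw [Metric.mem_ball, hφ] at hy
    have h2 : (L : ℝ) * dist y x ≤ L * δ n := by gcongr
    linarith [hLδ n]
  have hclose : ∀ n x, |u n x - f x| ≤ 2 * ε n := fun n x => by
    refine abs_mollify_sub_le _ (hgc n) fun y hy => ?_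
    have h1 := hfball n x y hy
    have h2 : |g n y - f y| ≤ ε n := by
      simp only [hg]
      rw [abs_le]
      have := hf0 y
      have := hεpos n
      constructor
      · linarith [le_max_left (f y - ε n) 0]
      · rw [sub_le_iff_le_add, max_le_iff]; constructor <;> linarith
    calc |g n y - f x| ≤ |g n y - f y| + |f y - f x| := abs_sub_le _ _ _
      _ ≤ 2 * ε n := by linarith [hεpos n]
  have hzero : ∀ n x, f x < ε n / 2 → u n x = 0 := fun n x hx => by
    have := abs_mollify_sub_le (φ n) (hgc n) (x := x) (c := 0) (η := 0) fun y hy => by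
      have h1 := (abs_le.1 (hfball n x y hy)).2
      simp only [hg]
      rw [max_eq_right (by linarith)]; simp
    simpa using this
  have hts : ∀ n, tsupport (u n) ⊆ {x | ε n / 2 ≤ f x} := fun n => by
    refine closure_minimal (fun x hx => ?_) (isClosed_le continuous_const hf.continuous)
    by_contra hlt
    exact hx (hzero n x (not_le.1 hlt))
  have hsubω : ∀ n, {x | ε n / 2 ≤ f x} ⊆ ω := fun n x hx => by
    by_contra hxω
    have hx : ε n / 2 ≤ f x := hx
    rw [hfω x hxω] at hx
    linarith [hεpos n]
  have hcomp : ∀ n, HasCompactSupport (u n) := fun n =>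
    Metric.isCompact_of_isClosed_isBounded (isClosed_tsupport _)
      (hωb.subset ((hts n).trans (hsubω n)))
  have hfb : ∃ B, ∀ x, f x ≤ B := by
    obtain ⟨B, hB⟩ := (hωb.isCompact_closure).exists_bound_of_continuousOn hf.continuous.continuousOn
    refine ⟨max B 0, fun x => ?_⟩
    by_cases hx : x ∈ ω
    · exact ((le_abs_self _).trans (hB x (subset_closure hx))).trans (le_max_left _ _)
    · rw [hfω x hx]; exact le_max_right _ _
  obtain ⟨B, hB⟩ := hfb
  have hub : ∀ n x, ‖u n x‖ ≤ B + 2 := fun n x => by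
    rw [Real.norm_eq_abs]
    have h1 := abs_le.1 (hclose n x)
    have := hf0 x
    have := hB x
    have := hε1 n
    rw [abs_le]
    constructor <;> linarith
  -- the gradients converge at each point of strict differentiability
  have hgradlim : ∀ᵐ x ∂volume.restrict ω,
      Tendsto (fun n => gradient (u n) x) atTop (𝓝 (gradient f x)) := by
    filter_upwards [hdiff] with x ⟨f', hf'⟩
    have hfd : fderiv ℝ f x = f' := hf'.hasFDerivAt.fderiv
    suffices h : Tendsto (fun n => fderiv ℝ (u n) x) atTop (𝓝 f') by
      unfold gradient
      rw [hfd]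
      exact ((InnerProductSpace.toDual ℝ (E d)).symm.continuous.tendsto f').comp h
    rcases (hf0 x).eq_or_lt with h0 | h0
    · have hmin : IsLocalMin f x := Eventually.of_forall fun y => by rw [← h0]; exact hf0 y
      have hf'0 : f' = 0 := by rw [← hfd]; exact hmin.fderiv_eq_zero
      have : ∀ n, fderiv ℝ (u n) x = f' := fun n => by
        have hev : u n =ᶠ[𝓝 x] fun _ => 0 := by
          filter_upwards [hf.continuous.continuousAt.eventually_lt_const
            (show f x < ε n / 2 by rw [← h0]; linarith [hεpos n])] with y hy
          exact hzero n y hy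
        rw [hev.fderiv_eq, hf'0]; simp
      simp_rw [this]
      exact tendsto_const_nhds
    · rw [Metric.tendsto_atTop]
      intro η hη
      obtain ⟨c, hc⟩ : ∃ c : ℝ≥0, (c : ℝ) = η / 2 := ⟨⟨η / 2, by positivity⟩, rfl⟩
      obtain ⟨s, hs, hlip⟩ := hf'.approximates_deriv_on_nhds (c := c)
        (Or.inr (by rw [← NNReal.coe_pos, hc]; positivity))
      have hs2 : {y | f x / 2 < f y} ∈ 𝓝 x :=
        (isOpen_lt continuous_const hf.continuous).mem_nhds (show f x / 2 < f x by linarith)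
      obtain ⟨r, hr, hrs⟩ := Metric.mem_nhds_iff.1 (inter_mem hs hs2)
      obtain ⟨N, hN⟩ := eventually_atTop.1 ((hδlim.eventually_lt_const hr).and
        (hεlim.eventually_lt_const (show 0 < f x / 2 by linarith)))
      refine ⟨N, fun n hn => ?_⟩
      obtain ⟨h1, h2⟩ := hN n hn
      have := norm_fderiv_mollify_sub_le (φ n) (hgc n) (x := x) (g' := f')
        (η := c) (r := r) (by rw [hφ]; exact h1) ?_
      · rw [dist_eq_norm]
        refine lt_of_le_of_lt this ?_
        rw [hc]; linarith
      · have h3 : LipschitzOnWith c (fun y => f y - f' y)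
            (Metric.ball x r) := by
          have := (hlip.mono_set (hrs.trans inter_subset_left)).lipschitzOnWith
          exact this
        intro y hy z hz
        have hgy : ∀ y ∈ Metric.ball x r, g n y - f' y = (f y - f' y) - ε n := fun y hy => by
          have h4 : f x / 2 < f y := (hrs hy).2
          simp only [hg]
          rw [max_eq_left (by linarith)]; ring
        simp only [hgy y hy, hgy z hz, edist_sub_right]
        exact h3 hy hz
  have hgm : ∀ n, Continuous (gradient (u n)) := fun n =>
    (InnerProductSpace.toDual ℝ (E d)).symm.continuous.comp ((hus n).continuous_fderiv (by simp))
  have hum : ∀ n, MemLp (u n) 2 (volume.restrict ω) := fun n =>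
    MemLp.of_bound (hus n).continuous.aestronglyMeasurable (B + 2) (Eventually.of_forall (hub n))
  have hugm : ∀ n, MemLp (gradient (u n)) 2 (volume.restrict ω) := fun n =>
    MemLp.of_bound (hgm n).aestronglyMeasurable L
      (Eventually.of_forall (norm_gradient_le_of_lipschitzWith (huL n)))
  have hfm : MemLp f 2 (volume.restrict ω) :=
    MemLp.of_bound hf.continuous.aestronglyMeasurable B (Eventually.of_forall fun x => by
      rw [Real.norm_eq_abs, abs_of_nonneg (hf0 x)]; exact hB x)
  have hfgm : MemLp (gradient f) 2 (volume.restrict ω) :=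
    MemLp.of_bound (aestronglyMeasurable_of_tendsto_ae atTop
      (fun n => (hgm n).aestronglyMeasurable) hgradlim) L
      (Eventually.of_forall (norm_gradient_le_of_lipschitzWith hf))
  have h1 : Tendsto (fun n => (hum n).toLp (u n)) atTop (𝓝 (hfm.toLp f)) := by
    refine tendsto_toLp_of_bounded hum hfm hub (Eventually.of_forall fun x => ?_)
      (Eventually.of_forall fun x => ?_)
    · rw [Real.norm_eq_abs, abs_of_nonneg (hf0 x)]; linarith [hB x]
    · rw [tendsto_iff_dist_tendsto_zero]
      refine squeeze_zero (fun _ => dist_nonneg) (fun n => hclose n x) ?_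
      simpa using hεlim.const_mul 2
  have h2 : Tendsto (fun n => (hugm n).toLp (gradient (u n))) atTop
      (𝓝 (hfgm.toLp (gradient f))) :=
    tendsto_toLp_of_bounded hugm hfgm
      (fun n => norm_gradient_le_of_lipschitzWith (huL n))
      (Eventually.of_forall (norm_gradient_le_of_lipschitzWith hf)) hgradlim
  let p : WithLp 2 (L2 ω × L2Vec ω) := WithLp.toLp 2 (hfm.toLp f, hfgm.toLp (gradient f))
  have hp : p ∈ H10 ω := by
    have hlim : Tendsto (fun n => (WithLp.toLp 2 ((hum n).toLp (u n),
        (hugm n).toLp (gradient (u n))) : WithLp 2 (L2 ω × L2Vec ω))) atTop (𝓝 p) :=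
      (WithLp.prod_continuous_toLp 2 _ _).continuousAt.tendsto.comp (h1.prodMk_nhds h2)
    refine mem_closure_of_tendsto hlim (Eventually.of_forall fun n => ?_)
    refine Submodule.subset_span ⟨u n, hus n, hcomp n, (hts n).trans (hsubω n), ?_, ?_⟩
    · exact (hum n).coeFn_toLp
    · exact (hugm n).coeFn_toLp
  refine ⟨⟨p, hp⟩, hfm.coeFn_toLp, hfgm.coeFn_toLp, ?_⟩
  filter_upwards [hdiff] with x ⟨f', hf'⟩
  exact hf'.hasFDerivAt.differentiableAt

/-! ### Hat and bubble functions -/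

theorem abs_prod_sub_prod_le {ι : Type*} (s : Finset ι) {a b : ι → ℝ}
    (ha : ∀ i ∈ s, 0 ≤ a i ∧ a i ≤ 1) (hb : ∀ i ∈ s, 0 ≤ b i ∧ b i ≤ 1) :
    |∏ i ∈ s, a i - ∏ i ∈ s, b i| ≤ ∑ i ∈ s, |a i - b i| := by
  classical
  induction s using Finset.induction_on with
  | empty => simp
  | insert i s hi ih =>
    rw [Finset.prod_insert hi, Finset.prod_insert hi, Finset.sum_insert hi]
    have ih := ih (fun j hj => ha j (Finset.mem_insert_of_mem hj))
      (fun j hj => hb j (Finset.mem_insert_of_mem hj))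
    have hA0 : 0 ≤ ∏ j ∈ s, a j :=
      Finset.prod_nonneg fun j hj => (ha j (Finset.mem_insert_of_mem hj)).1
    have hA1 : ∏ j ∈ s, a j ≤ 1 :=
      Finset.prod_le_one (fun j hj => (ha j (Finset.mem_insert_of_mem hj)).1)
        fun j hj => (ha j (Finset.mem_insert_of_mem hj)).2
    obtain ⟨hb0, hb1⟩ := hb i (Finset.mem_insert_self i s)
    have e : a i * ∏ j ∈ s, a j - b i * ∏ j ∈ s, b j
        = (a i - b i) * ∏ j ∈ s, a j + b i * (∏ j ∈ s, a j - ∏ j ∈ s, b j) := by ring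
    rw [e]
    refine (abs_add_le _ _).trans ?_
    rw [abs_mul, abs_mul, abs_of_nonneg hA0, abs_of_nonneg hb0]
    refine add_le_add (mul_le_of_le_one_right (abs_nonneg _) hA1) ?_
    exact (mul_le_of_le_one_left (abs_nonneg _) hb1).trans ih

namespace Mesh

variable {Ω : Set (E d)} (M : Mesh Ω)

/-- A point of an element at an interior vertex `z` lies in the interior of the domain unless it is
on the face opposite to `z`: shrinking towards `z` moves the point into a neighbourhood of `z`, and
along the segment to `z` the local structure of the mesh does not change. -/
theorem mem_of_bary_pos (hΩ : IsBoundedLipschitz Ω) {T : M.cells} {z : E d} (hz : z ∈ T.1)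
    (hzΩ : z ∈ Ω) {x : E d} (hx : x ∈ closedSimplex T.1) (hpos : 0 < M.bary T z x) : x ∈ Ω := by
  have hev : ∀ᶠ t : ℝ in 𝓝[>] 0, z + t • (x - z) ∈ Ω := by
    have hc : Continuous fun t : ℝ => z + t • (x - z) := by fun_prop
    exact nhdsWithin_le_nhds (hc.continuousAt.eventually_mem
      (by simpa using hΩ.isOpen.mem_nhds hzΩ))
  obtain ⟨t, ⟨htΩ, ht0⟩, ht1⟩ := ((hev.and self_mem_nhdsWithin).and
      (nhdsWithin_le_nhds (eventually_le_nhds (zero_lt_one' ℝ)))).exists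
  have ht0 : 0 < t := ht0
  set p := z + t • (x - z) with hp
  have hpT : p ∈ closedSimplex T.1 :=
    (convex_closedSimplex T.1).add_smul_sub_mem (subset_closedSimplex _ hz) hx ⟨ht0.le, ht1⟩
  -- the elements at `p` contain the whole segment from `z` to `x`
  have hcell : ∀ T' : M.cells, p ∈ closedSimplex T'.1 → z ∈ T'.1 ∧ x ∈ closedSimplex T'.1 := by
    intro T' hpT'
    have h0 : ∀ v ∈ T.1, v ∉ T'.1 → (1 - t) * M.bary T v z + t * M.bary T v x = 0 :=
      fun v _ hv' => by
        rw [← AffineMap.apply_add_smul_sub]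
        exact M.bary_eq_zero_of_mem_inter hpT hpT' hv'
    have hzT' : z ∈ T'.1 := by
      by_contra hz'
      have := h0 z hz hz'
      rw [M.bary_self hz] at this
      have := mul_pos ht0 hpos
      linarith
    refine ⟨hzT', M.mem_closedSimplex_iff.2 fun w _ => ?_⟩
    rw [M.affine_eq_sum_bary T (M.bary T' w) x]
    refine Finset.sum_nonneg fun v hv => ?_
    by_cases hv' : v ∈ T'.1
    · exact mul_nonneg (M.bary_nonneg (subset_closedSimplex _ hv') w) (M.bary_nonneg hx v)
    · have hvz : v ≠ z := fun h => hv' (h ▸ hzT')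
      have := h0 v hv hv'
      rw [M.bary_of_ne T hz hvz, mul_zero, zero_add] at this
      rw [(mul_eq_zero.1 this).resolve_left ht0.ne', mul_zero]
  -- a translation carries a neighbourhood of `x` to one of `p`, which those elements cover
  have hpint : p ∈ interior (closure Ω) := by rw [hΩ.interior_closure]; exact htΩ
  have h1 : ∀ᶠ y in 𝓝 x, ∃ T' : M.cells, p ∈ closedSimplex T'.1 ∧
      y + (p - x) ∈ closedSimplex T'.1 := by
    have hc : Continuous fun y : E d => y + (p - x) := by fun_prop
    have : Tendsto (fun y : E d => y + (p - x)) (𝓝 x) (𝓝 p) := by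
      simpa using hc.tendsto x
    exact this.eventually (M.eventually_mem_closedSimplex hpint)
  have h2 : ∀ᶠ y in 𝓝 x, ∀ T' : M.cells, ∀ v ∈ T'.1, 0 < M.bary T' v x → 0 < M.bary T' v y := by
    refine eventually_all.2 fun T' => (Finset.eventually_all T'.1).2 fun v _ => ?_
    by_cases hv : 0 < M.bary T' v x
    · filter_upwards [(M.continuous_bary T' v).continuousAt.eventually_const_lt hv] with y hy _
      exact hy
    · simp [hv]
  rw [← hΩ.interior_closure, mem_interior_iff_mem_nhds]
  filter_upwards [h1, h2] with y ⟨T', hpT', hyT'⟩ hy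
  obtain ⟨hzT', hxT'⟩ := hcell T' hpT'
  refine M.closedSimplex_subset_closure T' (M.mem_closedSimplex_iff.2 fun v hv => ?_)
  by_cases hv0 : 0 < M.bary T' v x
  · exact (hy T' v hv hv0).le
  · have hvx : M.bary T' v x = 0 := le_antisymm (not_lt.1 hv0) (M.bary_nonneg hxT' v)
    have hvz : v ≠ z := by
      rintro rfl
      rw [← M.bary_eq_of_mem_inter hx hxT'] at hvx
      exact hpos.ne' hvx
    have h3 := M.bary_nonneg hyT' v
    have h4 : M.bary T' v (y + (p - x)) = M.bary T' v y := by
      rw [add_comm, ← vadd_eq_add, AffineMap.map_vadd, vadd_eq_add, ← vsub_eq_sub p x,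
        AffineMap.linearMap_vsub, hvx, hp, AffineMap.apply_add_smul_sub,
        M.bary_of_ne T' hzT' hvz, hvx]
      simp
    rwa [h4] at h3

open Classical in
/-- The hat function of the vertex `z`, continuous across the boundaries of the elements
and extended by zero. -/
def nodal (z x : E d) : ℝ :=
  if h : ∃ T : M.cells, x ∈ closedSimplex T.1 then M.bary h.choose z x else 0

theorem nodal_eq {T : M.cells} {x : E d} (hx : x ∈ closedSimplex T.1) (z : E d) :
    M.nodal z x = M.bary T z x := by
  have h : ∃ T : M.cells, x ∈ closedSimplex T.1 := ⟨T, hx⟩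
  rw [nodal, dif_pos h]
  exact M.bary_eq_of_mem_inter h.choose_spec hx z

theorem nodal_nonneg (z x : E d) : 0 ≤ M.nodal z x := by
  unfold nodal
  split_ifs with h
  · exact M.bary_nonneg h.choose_spec z
  · exact le_rfl

theorem nodal_eq_zero_of_notMem (hΩ : IsBoundedLipschitz Ω) {z : E d} (hz : z ∈ Ω) {x : E d}
    (hx : x ∉ Ω) : M.nodal z x = 0 := by
  unfold nodal
  split_ifs with h
  · by_contra hne
    have hzT : z ∈ h.choose.1 := by
      by_contra hzT
      rw [M.bary_of_notMem hzT] at hne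
      exact hne rfl
    exact hx (M.mem_of_bary_pos hΩ hzT hz h.choose_spec
      ((M.bary_nonneg h.choose_spec z).lt_of_ne (Ne.symm hne)))
  · rfl

theorem hat_eq_bary {T : M.cells} {x : E d} (hx : x ∈ openSimplex T.1) (z : E d) :
    M.hat z x = M.bary T z x := by
  rw [hat, Finset.sum_eq_single T]
  · rw [indicator_of_mem hx]
  · intro T' _ hne
    rw [indicator_of_notMem fun hx' => hne ?_]
    exact M.subset_of_mem_open_of_mem_closed hx' (interior_subset hx)
  · exact fun h => absurd (Finset.mem_univ T) h

theorem nodal_eq_hat {T : M.cells} {x : E d} (hx : x ∈ openSimplex T.1) (z : E d) :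
    M.nodal z x = M.hat z x := by
  rw [M.nodal_eq (interior_subset hx), M.hat_eq_bary hx]

theorem bubble_eq_prod {T : M.cells} {x : E d} (hx : x ∈ openSimplex T.1) :
    M.bubble T x = ∏ z ∈ T.1, M.bary T z x :=
  Finset.prod_congr rfl fun z _ => M.hat_eq_bary hx z

theorem bubble_eq_zero {T T' : M.cells} (hne : T' ≠ T) {x : E d} (hx : x ∈ openSimplex T'.1) :
    M.bubble T x = 0 := by
  obtain ⟨z, hz, hz'⟩ : ∃ z ∈ T.1, z ∉ T'.1 := by
    by_contra! hcon
    exact hne (Subtype.ext (Finset.eq_of_subset_of_card_le hcon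
      (by rw [M.card_eq T.1 T.2, M.card_eq T'.1 T'.2])).symm)
  refine Finset.prod_eq_zero hz ?_
  rw [M.hat_eq_bary hx, M.bary_of_notMem hz']
  rfl

/-- The bubble function of `T`, continuous across the boundary of `T`. -/
def contBubble (T : M.cells) (x : E d) : ℝ := ∏ z ∈ T.1, max (M.bary T z x) 0

theorem contBubble_nonneg (T : M.cells) (x : E d) : 0 ≤ M.contBubble T x :=
  Finset.prod_nonneg fun _ _ => le_max_right _ _

theorem contBubble_eq_prod {T : M.cells} {x : E d} (hx : x ∈ closedSimplex T.1) :
    M.contBubble T x = ∏ z ∈ T.1, M.bary T z x :=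
  Finset.prod_congr rfl fun z _ => max_eq_left (M.bary_nonneg hx z)

theorem contBubble_eq_zero {T : M.cells} {x : E d} (hx : x ∉ openSimplex T.1) :
    M.contBubble T x = 0 := by
  rw [M.mem_openSimplex_iff] at hx
  push Not at hx
  obtain ⟨z, hz, h⟩ := hx
  exact Finset.prod_eq_zero hz (max_eq_right h)

theorem contBubble_eq_bubble {T T' : M.cells} {x : E d} (hx : x ∈ openSimplex T'.1) :
    M.contBubble T x = M.bubble T x := by
  by_cases h : T' = T
  · subst h
    rw [M.contBubble_eq_prod (interior_subset hx), M.bubble_eq_prod hx]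
  · rw [M.bubble_eq_zero h hx, M.contBubble_eq_zero fun hx' => h
      (M.subset_of_mem_open_of_mem_closed hx' (interior_subset hx)).symm]

variable {M} {Creg : ℝ}

theorem ShapeRegular.abs_prod_bary_sub_le (h : M.ShapeRegular Creg) (hd : 1 ≤ d) (T : M.cells)
    {x y : E d} (hx : x ∈ closedSimplex T.1) (hy : y ∈ closedSimplex T.1) :
    |∏ z ∈ T.1, M.bary T z x - ∏ z ∈ T.1, M.bary T z y|
      ≤ ((d : ℝ) + 1) * (Creg / diam T.1) * ‖x - y‖ := by
  refine (abs_prod_sub_prod_le T.1 (fun z _ => ⟨M.bary_nonneg hx z, M.bary_le_one hx z⟩)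
    (fun z _ => ⟨M.bary_nonneg hy z, M.bary_le_one hy z⟩)).trans ?_
  refine (Finset.sum_le_card_nsmul _ _ _ fun z _ => h.abs_bary_sub_le hd T z x y).trans_eq ?_
  rw [M.card_eq T.1 T.2, nsmul_eq_mul]
  push_cast
  ring

/-- The Lipschitz constant is not tracked here: the quantitative bound for the gradient is derived
element by element. -/
theorem ShapeRegular.exists_lipschitzWith_nodal (h : M.ShapeRegular Creg) (hd : 1 ≤ d)
    (hΩ : IsBoundedLipschitz Ω) {z : E d} (hz : z ∈ Ω) :
    ∃ L : ℝ≥0, LipschitzWith L (M.nodal z) := by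
  let K : Option M.cells → Set (E d) := fun i => i.elim Ωᶜ fun T => closedSimplex T.1
  have hK : ∀ i, IsClosed (K i) := by
    rintro (_ | T)
    · exact hΩ.isOpen.isClosed_compl
    · exact isClosed_closedSimplex T.1
  have hcov : ∀ x, ∃ i, x ∈ K i := fun x => by
    by_cases hx : x ∈ Ω
    · obtain ⟨T, hT⟩ := M.exists_mem_closedSimplex (subset_closure hx)
      exact ⟨some T, hT⟩
    · exact ⟨none, hx⟩
  let L : Option M.cells → ℝ≥0 := fun i => i.elim 0 fun T => (Creg / diam T.1).toNNReal
  have hL : ∀ i, LipschitzOnWith (L i) (M.nodal z) (K i) := by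
    rintro (_ | T)
    · refine LipschitzOnWith.of_dist_le_mul fun x hx y hy => ?_
      rw [M.nodal_eq_zero_of_notMem hΩ hz hx, M.nodal_eq_zero_of_notMem hΩ hz hy]
      simp [L]
    · refine LipschitzOnWith.of_dist_le_mul fun x hx y hy => ?_
      have hpos := h.pos hd T
      have hD := M.diam_pos hd T
      rw [M.nodal_eq hx, M.nodal_eq hy, Real.dist_eq, dist_eq_norm]
      simp only [L, Option.elim]
      rw [Real.coe_toNNReal _ (by positivity)]
      exact h.abs_bary_sub_le hd T z x y
  have hcont : Continuous (M.nodal z) :=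
    (locallyFinite_of_finite K).continuous (iUnion_eq_univ_iff.2 hcov) hK
      fun i => (hL i).continuousOn
  exact ⟨Finset.univ.sup L, lipschitzWith_of_finite_closed_cover hcont K hK hcov fun i =>
    (hL i).weaken (Finset.le_sup (Finset.mem_univ i))⟩

theorem ShapeRegular.exists_lipschitzWith_contBubble (h : M.ShapeRegular Creg) (hd : 1 ≤ d)
    (T : M.cells) : ∃ L : ℝ≥0, LipschitzWith L (M.contBubble T) := by
  have hcont : Continuous (M.contBubble T) :=
    continuous_finsetProd _ fun z _ => (M.continuous_bary T z).max continuous_const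
  let K : Bool → Set (E d) := fun b => bif b then closedSimplex T.1 else (openSimplex T.1)ᶜ
  refine ⟨(((d : ℝ) + 1) * (Creg / diam T.1)).toNNReal, lipschitzWith_of_finite_closed_cover hcont K
    ?_ (fun x => ?_) ?_⟩
  · rintro (_ | _)
    · exact (isOpen_openSimplex T.1).isClosed_compl
    · exact isClosed_closedSimplex T.1
  · by_cases hx : x ∈ openSimplex T.1
    · exact ⟨true, interior_subset hx⟩
    · exact ⟨false, hx⟩
  · rintro (_ | _)
    · refine LipschitzOnWith.of_dist_le_mul fun x hx y hy => ?_
      rw [M.contBubble_eq_zero hx, M.contBubble_eq_zero hy, dist_self]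
      positivity
    · refine LipschitzOnWith.of_dist_le_mul fun x hx y hy => ?_
      have hpos := h.pos hd T
      have hD := M.diam_pos hd T
      have hx : x ∈ closedSimplex T.1 := hx
      have hy : y ∈ closedSimplex T.1 := hy
      rw [M.contBubble_eq_prod hx, M.contBubble_eq_prod hy, Real.dist_eq, dist_eq_norm,
        Real.coe_toNNReal _ (by positivity)]
      exact h.abs_prod_bary_sub_le hd T hx hy

theorem contDiff_bary (M : Mesh Ω) (T : M.cells) (z : E d) : ContDiff ℝ 1 (M.bary T z) := by
  have : (M.bary T z : E d → ℝ)
      = fun x => (M.bary T z).linear.toContinuousLinearMap x + M.bary T z 0 := by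
    conv_lhs => rw [AffineMap.decomp (M.bary T z)]
    rfl
  rw [this]
  exact (ContinuousLinearMap.contDiff _).add contDiff_const

/-- Inside an element the hat functions are affine. -/
theorem exists_hasStrictFDerivAt_nodal (M : Mesh Ω) {T : M.cells} {x : E d}
    (hx : x ∈ openSimplex T.1) (z : E d) :
    ∃ f' : E d →L[ℝ] ℝ, HasStrictFDerivAt (M.nodal z) f' x := by
  refine ⟨_, ((M.contDiff_bary T z).contDiffAt.hasStrictFDerivAt one_ne_zero).congr_of_eventuallyEq
    ?_⟩
  filter_upwards [(isOpen_openSimplex T.1).mem_nhds hx] with y hy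
  exact (M.nodal_eq (interior_subset hy) z).symm

theorem exists_hasStrictFDerivAt_contBubble (M : Mesh Ω) {T T' : M.cells} {x : E d}
    (hx : x ∈ openSimplex T'.1) :
    ∃ f' : E d →L[ℝ] ℝ, HasStrictFDerivAt (M.contBubble T) f' x := by
  have hnhds := (isOpen_openSimplex T'.1).mem_nhds hx
  by_cases h : T' = T
  · subst h
    refine ⟨_, ((contDiff_prod fun z _ => M.contDiff_bary T' z).contDiffAt.hasStrictFDerivAt
      (f := fun x => ∏ z ∈ T'.1, M.bary T' z x) one_ne_zero).congr_of_eventuallyEq ?_⟩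
    filter_upwards [hnhds] with y hy
    exact (M.contBubble_eq_prod (interior_subset hy)).symm
  · refine ⟨0, (hasStrictFDerivAt_const (0 : ℝ) x).congr_of_eventuallyEq ?_⟩
    filter_upwards [hnhds] with y hy
    rw [M.contBubble_eq_zero fun hy' => h
      (M.subset_of_mem_open_of_mem_closed hy' (interior_subset hy)).symm]

variable {ω : Set (E d)}

theorem ShapeRegular.isH10Rep_nodal (h : M.ShapeRegular Creg) (hd : 1 ≤ d)
    (hΩ : IsBoundedLipschitz Ω) (hω : ω ⊆ Ω) {z : E d} (hz : z ∈ Ω)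
    (hsupp : ∀ x ∉ ω, M.nodal z x = 0) : IsH10Rep ω (M.nodal z) := by
  obtain ⟨L, hL⟩ := h.exists_lipschitzWith_nodal hd hΩ hz
  refine isH10Rep_of_lipschitz (hΩ.isBounded.subset hω) hL (M.nodal_nonneg z) hsupp ?_
  filter_upwards [ae_restrict_of_ae_restrict_of_subset hω (M.ae_exists_mem_openSimplex hΩ.isOpen)]
    with x ⟨T, hx⟩
  exact M.exists_hasStrictFDerivAt_nodal hx z

theorem ShapeRegular.isH10Rep_contBubble (h : M.ShapeRegular Creg) (hd : 1 ≤ d)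
    (hΩ : IsBoundedLipschitz Ω) (hω : ω ⊆ Ω) {T : M.cells} (hT : openSimplex T.1 ⊆ ω) :
    IsH10Rep ω (M.contBubble T) := by
  obtain ⟨L, hL⟩ := h.exists_lipschitzWith_contBubble hd T
  refine isH10Rep_of_lipschitz (hΩ.isBounded.subset hω) hL (M.contBubble_nonneg T)
    (fun x hx => M.contBubble_eq_zero fun hx' => hx (hT hx')) ?_
  filter_upwards [ae_restrict_of_ae_restrict_of_subset hω (M.ae_exists_mem_openSimplex hΩ.isOpen)]
    with x ⟨T, hx⟩
  exact M.exists_hasStrictFDerivAt_contBubble hx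

end Mesh

namespace Mesh

variable {Ω : Set (E d)} (M : Mesh Ω)

/-! ### The operators on piecewise constant functions -/

open Classical in
/-- The elements at the vertex `z`. -/
def star (z : E d) : Finset M.cells := Finset.univ.filter fun T => z ∈ T.1

theorem mem_star {z : E d} {T : M.cells} : T ∈ M.star z ↔ z ∈ T.1 := by
  simp [star]

theorem mem_interiorVertices {z : E d} :
    z ∈ M.interiorVertices ↔ (∃ T : M.cells, z ∈ T.1) ∧ z ∉ frontier Ω := by
  classical
  simp [interiorVertices]

theorem mem_interiorVertices_iff (hΩ : IsOpen Ω) {T : M.cells} {z : E d} (hz : z ∈ T.1) :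
    z ∈ M.interiorVertices ↔ z ∈ Ω := by
  rw [mem_interiorVertices, frontier, hΩ.interior_eq]
  have hcl : z ∈ closure Ω := M.closedSimplex_subset_closure T (subset_closedSimplex _ hz)
  refine ⟨fun h => by_contra fun hz' => h.2 ⟨hcl, hz'⟩, fun h => ⟨⟨T, hz⟩, fun h' => h'.2 h⟩⟩

theorem sum_patch_vol {T : M.cells} {z : E d} (hz : z ∈ T.1) :
    ∑ T' ∈ M.patch {z}, vol T' = ∑ T' ∈ M.star z, vol T'.1 := by
  classical
  refine Finset.sum_nbij' (i := fun T' => if h : T' ∈ M.cells then ⟨T', h⟩ else T)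
    (j := fun T' => T'.1) ?_ ?_ ?_ ?_ ?_
  · intro T' hT'
    have hc : T' ∈ M.cells := (Finset.mem_filter.1 hT').1
    rw [dif_pos hc, mem_star]
    exact (M.mem_patch_singleton_iff hz (T' := ⟨T', hc⟩)).1 hT'
  · exact fun T' hT' => (M.mem_patch_singleton_iff hz).2 (M.mem_star.1 hT')
  · intro T' hT'
    rw [dif_pos (Finset.mem_filter.1 hT').1]
  · intro T' _
    simp
  · intro T' hT'
    rw [dif_pos (Finset.mem_filter.1 hT').1]

theorem sum_star_vol_pos {T : M.cells} {z : E d} (hz : z ∈ T.1) :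
    0 < ∑ T' ∈ M.star z, vol T'.1 :=
  Finset.sum_pos (fun T' _ => M.vol_pos T') ⟨T, M.mem_star.2 hz⟩

theorem sum_weight {T : M.cells} {z : E d} (hz : z ∈ T.1) :
    ∑ T' ∈ M.star z, M.weight T'.1 z = 1 := by
  simp only [weight, M.sum_patch_vol hz]
  rw [← Finset.sum_div, div_self (M.sum_star_vol_pos hz).ne']

theorem weight_nonneg (T : Finset (E d)) (z : E d) : 0 ≤ M.weight T z :=
  div_nonneg (vol_nonneg T) (Finset.sum_nonneg fun T' _ => vol_nonneg T')

theorem weight_le_one {T : M.cells} {z : E d} (hz : z ∈ T.1) : M.weight T.1 z ≤ 1 := by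
  rw [← M.sum_weight hz]
  exact Finset.single_le_sum (f := fun T' : M.cells => M.weight T'.1 z)
    (fun T' _ => M.weight_nonneg T'.1 z) (M.mem_star.2 hz)

theorem inner_affineL2 (hΩ : IsBoundedLipschitz Ω) (T : M.cells) (a : E d →ᵃ[ℝ] ℝ) (v : L2 Ω) :
    inner ℝ (M.affineL2 T a) v = ∫ x in openSimplex T.1, a x * v x := by
  rw [L2.inner_def]
  have h1 : ∀ᵐ x ∂volume.restrict Ω, inner ℝ (M.affineL2 T a x) (v x)
      = (openSimplex T.1).indicator (fun x => a x * v x) x := by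
    filter_upwards [(M.memLp (bddMeas_indicator T.1 a)).coeFn_toLp] with x hx
    rw [affineL2, hx]
    by_cases hxT : x ∈ openSimplex T.1
    · simp [hxT, mul_comm]
    · simp [hxT]
  rw [integral_congr_ae h1, integral_indicator (isOpen_openSimplex T.1).measurableSet,
    Measure.restrict_restrict (isOpen_openSimplex T.1).measurableSet,
    inter_eq_left.2 (M.openSimplex_subset hΩ T)]

theorem inner_charL2 (hΩ : IsBoundedLipschitz Ω) (T : M.cells) (v : L2 Ω) :
    inner ℝ (M.charL2 T) v = ∫ x in openSimplex T.1, v x := by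
  rw [charL2, M.inner_affineL2 hΩ]
  simp

theorem ae_restrict_cell (hΩ : IsBoundedLipschitz Ω) (T : M.cells) {p : E d → Prop}
    (h : ∀ᵐ x ∂volume.restrict Ω, p x) : ∀ᵐ x ∂volume.restrict (openSimplex T.1), p x :=
  ae_restrict_of_ae_restrict_of_subset (M.openSimplex_subset hΩ T) h

/-- The piecewise constant function with given values on the elements. -/
def step (c : M.cells → ℝ) : L2 Ω := ∑ T : M.cells, c T • M.charL2 T

theorem coeFn_finsetSum {ω : Set (E d)} {F : Type*} [NormedAddCommGroup F] {ι : Type*}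
    (s : Finset ι) (f : ι → Lp F 2 (volume.restrict ω)) :
    ⇑(∑ i ∈ s, f i) =ᵐ[volume.restrict ω] fun x => ∑ i ∈ s, f i x := by
  classical
  induction s using Finset.induction_on with
  | empty =>
    simp only [Finset.sum_empty]
    exact Lp.coeFn_zero _ _ _
  | insert i s hi ih =>
    rw [Finset.sum_insert hi]
    filter_upwards [Lp.coeFn_add (f i) (∑ i ∈ s, f i), ih] with x h1 h2
    rw [h1, Pi.add_apply, h2, Finset.sum_insert hi]

theorem step_ae_eq (hΩ : IsBoundedLipschitz Ω) (c : M.cells → ℝ) (T : M.cells) :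
    ∀ᵐ x ∂volume.restrict (openSimplex T.1), M.step c x = c T := by
  have h1 : ∀ᵐ x ∂volume.restrict Ω, ∀ T : M.cells, (c T • M.charL2 T : L2 Ω) x
      = c T * (openSimplex T.1).indicator (fun _ => (1 : ℝ)) x := by
    refine ae_all_iff.2 fun T => ?_
    filter_upwards [Lp.coeFn_smul (c T) (M.charL2 T),
      (M.memLp (bddMeas_indicator T.1 (AffineMap.const ℝ (E d) 1))).coeFn_toLp] with x h1 h2
    rw [h1, Pi.smul_apply, charL2, affineL2, h2, smul_eq_mul]
    rfl
  filter_upwards [M.ae_restrict_cell hΩ T h1,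
    M.ae_restrict_cell hΩ T (coeFn_finsetSum Finset.univ fun T => c T • M.charL2 T),
    ae_restrict_mem (isOpen_openSimplex T.1).measurableSet] with x h1 h2 hx
  rw [step, h2, Finset.sum_eq_single T]
  · rw [h1, indicator_of_mem hx, mul_one]
  · intro T' _ hne
    rw [h1, indicator_of_notMem fun hx' => hne ?_, mul_zero]
    exact M.subset_of_mem_open_of_mem_closed hx' (interior_subset hx)
  · exact fun h => absurd (Finset.mem_univ T) h

theorem setIntegral_mul_step (hΩ : IsBoundedLipschitz Ω) (c : M.cells → ℝ) (T : M.cells)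
    (a : E d → ℝ) : ∫ x in openSimplex T.1, a x * M.step c x
      = c T * ∫ x in openSimplex T.1, a x := by
  rw [← integral_const_mul]
  refine integral_congr_ae ?_
  filter_upwards [M.step_ae_eq hΩ c T] with x hx
  rw [hx, mul_comm]

theorem setIntegral_step (hΩ : IsBoundedLipschitz Ω) (c : M.cells → ℝ) (T : M.cells) :
    ∫ x in openSimplex T.1, M.step c x = c T * vol T.1 := by
  have h := M.setIntegral_mul_step hΩ c T fun _ => 1
  simp only [one_mul] at h
  rw [h, setIntegral_const, smul_eq_mul, mul_one]
  rfl

/-- The dual function has integral one, because the barycentric coordinates sum to one. -/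
theorem integral_dualFunction (T : M.cells) {z : E d} (hz : z ∈ T.1) :
    ∫ x in openSimplex T.1, M.dualFunction T z x = 1 := by
  classical
  have h : ∀ y ∈ T.1, ∫ x in openSimplex T.1, M.dualFunction T z x * M.bary T y x
      = if y = z then 1 else 0 := fun y hy => by
    convert (M.existsUnique_dualFunction T z).choose_spec.1 y hy
    rfl
  have h1 : ∀ x, M.dualFunction T z x = ∑ y ∈ T.1, M.dualFunction T z x * M.bary T y x := fun x => by
    rw [← Finset.mul_sum, M.sum_bary, mul_one]
  rw [integral_congr_ae (.of_forall h1),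
    integral_finsetSum _ fun y _ => (M.integrableOn_affine_mul T _ _)]
  rw [Finset.sum_congr rfl h]
  rw [Finset.sum_ite_eq' T.1 z, if_pos hz]

open Classical in
/-- The coefficient of the hat function of `z` in `J` applied to a piecewise constant function:
the mean value over the vertex star at an interior vertex, zero at a boundary vertex. -/
def vertexValue (c : M.cells → ℝ) (z : E d) : ℝ :=
  if z ∈ M.interiorVertices then ∑ T ∈ M.star z, M.weight T.1 z * c T else 0

/-- On piecewise constant functions the functional `α_z` takes the weighted average over the star.
-/
theorem alpha_step (hΩ : IsBoundedLipschitz Ω) (c : M.cells → ℝ) {z : E d}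
    (hz : z ∈ M.interiorVertices) : M.alpha z (M.step c) = M.vertexValue c z := by
  classical
  obtain ⟨⟨T₀, hz₀⟩, _⟩ := M.mem_interiorVertices.1 hz
  rw [alpha, vertexValue, if_pos hz, _root_.sum_apply]
  refine Finset.sum_congr ?_ fun T hT => ?_
  · ext T
    simp [mem_star, M.mem_patch_singleton_iff hz₀]
  · rw [_root_.smul_apply, innerSL_apply_apply, M.inner_affineL2 hΩ,
      M.setIntegral_mul_step hΩ, M.integral_dualFunction T (M.mem_star.1 hT), mul_one, smul_eq_mul]

/-- The bubble coefficients that restore the mean values. -/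
def bubbleCoeff (c : M.cells → ℝ) (T : M.cells) : ℝ :=
  (∫ x in openSimplex T.1, M.bubble T x)⁻¹ *
    ∫ x in openSimplex T.1, (c T - ∑ z ∈ T.1, M.vertexValue c z * M.bary T z x)

/-- The continuous representative of `P` applied to a piecewise constant function. -/
def quasi (c : M.cells → ℝ) (x : E d) : ℝ :=
  ∑ z ∈ M.interiorVertices, M.vertexValue c z * M.nodal z x
    + ∑ T : M.cells, M.bubbleCoeff c T * M.contBubble T x

/-- Since the vertex values vanish on the boundary, the sum over the interior vertices is on each
element the affine interpolation of the values at all its vertices. -/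
theorem sum_interiorVertices_eq (c : M.cells → ℝ) {T : M.cells} {x : E d}
    (hx : x ∈ closedSimplex T.1) :
    ∑ z ∈ M.interiorVertices, M.vertexValue c z * M.nodal z x
      = ∑ z ∈ T.1, M.vertexValue c z * M.bary T z x := by
  classical
  have h1 : ∀ z, M.nodal z x = M.bary T z x := M.nodal_eq hx
  simp_rw [h1]
  rw [← Finset.sum_subset (Finset.inter_subset_left (s₁ := M.interiorVertices) (s₂ := T.1)),
    ← Finset.sum_subset (Finset.inter_subset_right (s₁ := M.interiorVertices) (s₂ := T.1))]
  · intro z hz hz'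
    rw [vertexValue, if_neg fun h => hz' (Finset.mem_inter.2 ⟨h, hz⟩), zero_mul]
  · intro z hz hz'
    rw [M.bary_of_notMem fun h => hz' (Finset.mem_inter.2 ⟨hz, h⟩)]
    simp

/-- The local form of the quasi-interpolation on an element. -/
theorem quasi_eq (c : M.cells → ℝ) {T : M.cells} {x : E d} (hx : x ∈ openSimplex T.1) :
    M.quasi c x = ∑ z ∈ T.1, M.vertexValue c z * M.bary T z x
      + M.bubbleCoeff c T * ∏ z ∈ T.1, M.bary T z x := by
  rw [quasi, M.sum_interiorVertices_eq c (interior_subset hx), Finset.sum_eq_single T]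
  · rw [M.contBubble_eq_prod (interior_subset hx)]
  · intro T' _ hne
    rw [M.contBubble_eq_bubble hx, M.bubble_eq_zero hne.symm hx, mul_zero]
  · exact fun h => absurd (Finset.mem_univ T) h

theorem J_step_ae_eq (hΩ : IsBoundedLipschitz Ω) (c : M.cells → ℝ) :
    M.J (M.step c) =ᵐ[volume.restrict Ω]
      fun x => ∑ z ∈ M.interiorVertices, M.vertexValue c z * M.nodal z x := by
  have h0 : M.J (M.step c) = ∑ z ∈ M.interiorVertices, M.vertexValue c z • M.hatL2 z := by
    rw [J, _root_.sum_apply]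
    refine Finset.sum_congr rfl fun z hz => ?_
    rw [ContinuousLinearMap.smulRight_apply, M.alpha_step hΩ c hz]
  have h1 : ∀ᵐ x ∂volume.restrict Ω, ∀ z ∈ M.interiorVertices,
      (M.vertexValue c z • M.hatL2 z : L2 Ω) x = M.vertexValue c z * M.hat z x := by
    refine (ae_ball_iff M.interiorVertices.countable_toSet).2 fun z _ => ?_
    filter_upwards [Lp.coeFn_smul (M.vertexValue c z) (M.hatL2 z),
      (M.memLp (M.bddMeas_hat z)).coeFn_toLp] with x h1 h2
    rw [h1, Pi.smul_apply, hatL2, h2, smul_eq_mul]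
  rw [h0]
  filter_upwards [h1, coeFn_finsetSum M.interiorVertices fun z => M.vertexValue c z • M.hatL2 z,
    M.ae_exists_mem_openSimplex hΩ.isOpen] with x h1 h2 ⟨T, hx⟩
  rw [h2]
  refine Finset.sum_congr rfl fun z hz => ?_
  rw [h1 z hz, M.nodal_eq_hat hx]

theorem B_apply (hΩ : IsBoundedLipschitz Ω) (v : L2 Ω) :
    M.B v = ∑ T : M.cells, ((∫ x in openSimplex T.1, M.bubble T x)⁻¹ *
      ∫ x in openSimplex T.1, v x) • M.bubbleL2 T := by
  rw [B, _root_.sum_apply]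
  refine Finset.sum_congr rfl fun T _ => ?_
  rw [ContinuousLinearMap.smulRight_apply, _root_.smul_apply, innerSL_apply_apply,
    M.inner_charL2 hΩ, smul_eq_mul]

theorem bubbleL2_ae_eq (hΩ : IsBoundedLipschitz Ω) (T : M.cells) :
    M.bubbleL2 T =ᵐ[volume.restrict Ω] M.contBubble T := by
  filter_upwards [(M.memLp (M.bddMeas_bubble T)).coeFn_toLp,
    M.ae_exists_mem_openSimplex hΩ.isOpen] with x h1 ⟨T', hx⟩
  rw [bubbleL2, h1, M.contBubble_eq_bubble hx]

theorem hatL2_ae_eq (hΩ : IsBoundedLipschitz Ω) (z : E d) :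
    M.hatL2 z =ᵐ[volume.restrict Ω] M.nodal z := by
  filter_upwards [(M.memLp (M.bddMeas_hat z)).coeFn_toLp,
    M.ae_exists_mem_openSimplex hΩ.isOpen] with x h1 ⟨T', hx⟩
  rw [hatL2, h1, M.nodal_eq_hat hx]

/-- The bubble coefficients of the quasi-interpolation of a piecewise constant function. -/
theorem bubbleCoeff_eq (hΩ : IsBoundedLipschitz Ω) (c : M.cells → ℝ) (T : M.cells) :
    (∫ x in openSimplex T.1, M.bubble T x)⁻¹ *
      ∫ x in openSimplex T.1, (M.step c - M.J (M.step c) : L2 Ω) x = M.bubbleCoeff c T := by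
  have hJ := M.J_step_ae_eq hΩ c
  rw [bubbleCoeff]
  congr 1
  refine integral_congr_ae ?_
  filter_upwards [M.ae_restrict_cell hΩ T hJ, M.step_ae_eq hΩ c T,
    M.ae_restrict_cell hΩ T (Lp.coeFn_sub (M.step c) (M.J (M.step c))),
    ae_restrict_mem (isOpen_openSimplex T.1).measurableSet] with x h1 h2 h3 hx
  rw [h3, Pi.sub_apply, h1, h2, M.sum_interiorVertices_eq c (interior_subset hx)]

theorem P_step_ae_eq (hΩ : IsBoundedLipschitz Ω) (c : M.cells → ℝ) :
    M.P (M.step c) =ᵐ[volume.restrict Ω] M.quasi c := by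
  have hJ := M.J_step_ae_eq hΩ c
  have hP : M.P (M.step c) = M.J (M.step c) + M.B (M.step c - M.J (M.step c)) := by
    simp [P]
  have h1 : ∀ᵐ x ∂volume.restrict Ω, ∀ T : M.cells,
      (M.bubbleCoeff c T • M.bubbleL2 T : L2 Ω) x = M.bubbleCoeff c T * M.contBubble T x := by
    refine ae_all_iff.2 fun T => ?_
    filter_upwards [Lp.coeFn_smul (M.bubbleCoeff c T) (M.bubbleL2 T), M.bubbleL2_ae_eq hΩ T]
      with x h1 h2
    rw [h1, Pi.smul_apply, h2, smul_eq_mul]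
  rw [hP, M.B_apply hΩ]
  simp_rw [M.bubbleCoeff_eq hΩ]
  filter_upwards [hJ, h1, Lp.coeFn_add (M.J (M.step c)) (∑ T : M.cells,
    M.bubbleCoeff c T • M.bubbleL2 T),
    coeFn_finsetSum Finset.univ fun T : M.cells => M.bubbleCoeff c T • M.bubbleL2 T]
    with x h1 h2 h3 h4
  rw [h3, Pi.add_apply, h1, h4, quasi]
  simp_rw [h2]

theorem integral_bubble_pos (T : M.cells) : 0 < ∫ x in openSimplex T.1, M.bubble T x := by
  have h := M.le_integral_prod_bary T
  rw [setIntegral_congr_fun (isOpen_openSimplex T.1).measurableSet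
    fun x hx => M.bubble_eq_prod hx]
  refine lt_of_lt_of_le ?_ h
  have := M.vol_pos T
  positivity

/-- `P` preserves the mean values over the elements. -/
theorem inner_charL2_P (hΩ : IsBoundedLipschitz Ω) (T : M.cells) (v : L2 Ω) :
    inner ℝ (M.charL2 T) (M.P v) = inner ℝ (M.charL2 T) v := by
  have hP : M.P v = M.J v + M.B (v - M.J v) := by simp [P]
  have hb : ∀ T' : M.cells, inner ℝ (M.charL2 T) (M.bubbleL2 T')
      = if T' = T then ∫ x in openSimplex T.1, M.bubble T x else 0 := fun T' => by
    rw [M.inner_charL2 hΩ, bubbleL2, integral_congr_ae (M.ae_restrict_cell hΩ T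
      (M.memLp (M.bddMeas_bubble T')).coeFn_toLp)]
    split_ifs with h
    · rw [h]
    · rw [setIntegral_congr_fun (isOpen_openSimplex T.1).measurableSet
        fun x hx => M.bubble_eq_zero (Ne.symm h) hx]
      simp
  rw [hP, inner_add_right, M.B_apply hΩ, inner_sum]
  simp_rw [real_inner_smul_right, hb]
  simp only [mul_ite, mul_zero, Finset.sum_ite_eq', Finset.mem_univ, if_true]
  rw [mul_right_comm, inv_mul_cancel₀ (M.integral_bubble_pos T).ne', one_mul,
    ← M.inner_charL2 hΩ, inner_sub_right]
  ring

theorem charL2_mem_P0 (T : M.cells) : M.charL2 T ∈ M.P0 :=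
  Submodule.subset_span (mem_range_self T)

theorem step_mem_P0 (c : M.cells → ℝ) : M.step c ∈ M.P0 :=
  Submodule.sum_mem _ fun T _ => Submodule.smul_mem _ _ (M.charL2_mem_P0 T)

/-- The projection onto piecewise constants takes mean values. -/
theorem Pi0_eq_step (hΩ : IsBoundedLipschitz Ω) (v : L2 Ω) :
    M.Pi0 v = M.step fun T => mean v T.1 := by
  refine Submodule.eq_starProjection_of_mem_of_inner_eq_zero (M.step_mem_P0 _) fun w hw => ?_
  induction hw using Submodule.span_induction with
  | mem w hw =>
    obtain ⟨T, rfl⟩ := hw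
    rw [real_inner_comm, inner_sub_right, M.inner_charL2 hΩ, M.inner_charL2 hΩ,
      M.setIntegral_step hΩ, mean, div_mul_cancel₀ _ (M.vol_pos T).ne', sub_self]
  | zero => simp
  | add x y _ _ hx hy => rw [inner_add_right, hx, hy, add_zero]
  | smul a x _ hx => rw [real_inner_smul_right, hx, mul_zero]

/-- The projection `Π⁰` depends only on mean values, and `P` preserves these. -/
theorem Pi0_P (hΩ : IsBoundedLipschitz Ω) (v : L2 Ω) : M.Pi0 (M.P v) = M.Pi0 v := by
  rw [M.Pi0_eq_step hΩ, M.Pi0_eq_step hΩ]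
  congr 1
  funext T
  rw [mean, mean, ← M.inner_charL2 hΩ, ← M.inner_charL2 hΩ, M.inner_charL2_P hΩ]

theorem inner_Pi0_left (v w : L2 Ω) : inner ℝ (M.Pi0 v) w = inner ℝ v (M.Pi0 w) :=
  M.P0.inner_starProjection_left_eq_right v w

/-- The dual form of the fact that `P` preserves mean values. -/
theorem P'_Pi0 (hΩ : IsBoundedLipschitz Ω) (v : L2 Ω) : M.P' (M.Pi0 v) = M.Pi0 v := by
  refine ext_inner_right ℝ fun w => ?_
  rw [P', ContinuousLinearMap.adjoint_inner_left, inner_Pi0_left, M.Pi0_P hΩ, inner_Pi0_left]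

theorem Pi0_Pi0 (v : L2 Ω) : M.Pi0 (M.Pi0 v) = M.Pi0 v :=
  Submodule.starProjection_eq_self_iff.2 (Submodule.starProjection_apply_mem _ _)

theorem Q_comp_Q (hΩ : IsBoundedLipschitz Ω) : M.Q ∘L M.Q = M.Q := by
  ext1 v
  change M.Pi0 (M.P' (M.Pi0 (M.P' v))) = M.Pi0 (M.P' v)
  rw [M.P'_Pi0 hΩ, M.Pi0_Pi0]

theorem range_Q (hΩ : IsBoundedLipschitz Ω) : LinearMap.range M.Q.toLinearMap = M.P0 := by
  refine le_antisymm ?_ fun v hv => ⟨v, ?_⟩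
  · rintro _ ⟨v, rfl⟩
    exact Submodule.starProjection_apply_mem _ _
  · have h1 : M.Pi0 v = v := Submodule.starProjection_eq_self_iff.2 hv
    change M.Pi0 (M.P' v) = v
    rw [← h1, M.P'_Pi0 hΩ, M.Pi0_Pi0]

theorem inner_Q_left (φ v : L2 Ω) : inner ℝ (M.Q φ) v = inner ℝ φ (M.P (M.Pi0 v)) := by
  change inner ℝ (M.Pi0 (M.P' φ)) v = _
  rw [inner_Pi0_left, P', ContinuousLinearMap.adjoint_inner_left]

end Mesh

/-! ### Bounds for the quasi-interpolation by local oscillations -/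

section

variable {ω : Set (E d)} {f g : E d → ℝ} {v w : H10 ω}

theorem represents_zero : Represents (0 : H10 ω) fun _ => 0 := by
  refine ⟨?_, ?_, Eventually.of_forall fun x => by fun_prop⟩
  · exact Lp.coeFn_zero _ _ _
  · refine (Lp.coeFn_zero _ _ _).trans (Eventually.of_forall fun x => ?_)
    simp [gradient]

theorem Represents.add (hf : Represents v f) (hg : Represents w g) :
    Represents (v + w) fun x => f x + g x := by
  obtain ⟨hv1, hv2, hv3⟩ := hf
  obtain ⟨hw1, hw2, hw3⟩ := hg
  refine ⟨?_, ?_, ?_⟩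
  · filter_upwards [Lp.coeFn_add (fn v) (fn w), hv1, hw1] with x h1 h2 h3
    rw [← h2, ← h3]
    exact h1
  · filter_upwards [Lp.coeFn_add (grad v) (grad w), hv2, hw2, hv3, hw3] with x h1 h2 h3 h4 h5
    have : gradient (fun x => f x + g x) x = gradient f x + gradient g x := by
      simp only [gradient]
      rw [fderiv_fun_add h4 h5, map_add]
    rw [this, ← h2, ← h3]
    exact h1
  · filter_upwards [hv3, hw3] with x h4 h5
    exact h4.fun_add h5

theorem Represents.const_smul (hf : Represents v f) (c : ℝ) :
    Represents (c • v) fun x => c * f x := by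
  obtain ⟨hv1, hv2, hv3⟩ := hf
  refine ⟨?_, ?_, ?_⟩
  · filter_upwards [Lp.coeFn_smul c (fn v), hv1] with x h1 h2
    rw [← h2, ← smul_eq_mul]
    exact h1
  · filter_upwards [Lp.coeFn_smul c (grad v), hv2, hv3] with x h1 h2 h4
    have : gradient (fun x => c * f x) x = c • gradient f x := by
      simp only [gradient]
      rw [fderiv_const_mul h4, map_smul]
    rw [this, ← h2]
    exact h1
  · filter_upwards [hv3] with x h4
    exact h4.const_mul c

theorem represents_sum {ι : Type*} (s : Finset ι) {v : ι → H10 ω} {f : ι → E d → ℝ}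
    (hf : ∀ i ∈ s, Represents (v i) (f i)) :
    Represents (∑ i ∈ s, v i) fun x => ∑ i ∈ s, f i x := by
  classical
  induction s using Finset.induction_on with
  | empty => simpa using represents_zero
  | insert i s hi ih =>
    simp_rw [Finset.sum_insert hi]
    exact (hf i (Finset.mem_insert_self i s)).add
      (ih fun j hj => hf j (Finset.mem_insert_of_mem hj))

theorem isH10Rep_zero : IsH10Rep ω fun _ => 0 := ⟨0, represents_zero⟩

theorem IsH10Rep.add (hf : IsH10Rep ω f) (hg : IsH10Rep ω g) : IsH10Rep ω fun x => f x + g x :=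
  ⟨_, hf.choose_spec.add hg.choose_spec⟩

theorem IsH10Rep.const_mul (hf : IsH10Rep ω f) (c : ℝ) : IsH10Rep ω fun x => c * f x :=
  ⟨_, hf.choose_spec.const_smul c⟩

theorem isH10Rep_sum {ι : Type*} (s : Finset ι) {f : ι → E d → ℝ}
    (hf : ∀ i ∈ s, IsH10Rep ω (f i)) : IsH10Rep ω fun x => ∑ i ∈ s, f i x := by
  choose! v hv using hf
  exact ⟨_, represents_sum s hv⟩

end

theorem enorm_sq_eq_lintegral {F α : Type*} [NormedAddCommGroup F] [MeasurableSpace α]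
    {μ : Measure α} (v : Lp F 2 μ) : ‖v‖ₑ ^ 2 = ∫⁻ x, ‖v x‖ₑ ^ 2 ∂μ := by
  rw [Lp.enorm_def, eLpNorm_eq_lintegral_rpow_enorm_toReal two_ne_zero ENNReal.ofNat_ne_top,
    ← ENNReal.rpow_natCast, ← ENNReal.rpow_mul]
  simp

theorem norm_sq_le_of_lintegral_le {F α : Type*} [NormedAddCommGroup F] [MeasurableSpace α]
    {μ : Measure α} {v : Lp F 2 μ} {A : ℝ} (hA : 0 ≤ A)
    (h : ∫⁻ x, ‖v x‖ₑ ^ 2 ∂μ ≤ ENNReal.ofReal A) : ‖v‖ ^ 2 ≤ A := by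
  rw [← enorm_sq_eq_lintegral, ← ofReal_norm, ← ENNReal.ofReal_pow (norm_nonneg _)] at h
  exact (ENNReal.ofReal_le_ofReal_iff hA).1 h

/-- A lower bound for the mean value of the bubble functions. -/
def bubbleConst (d : ℕ) : ℝ := (2 * ((d : ℝ) + 1))⁻¹ ^ (d + 1) * 2⁻¹ ^ d

theorem bubbleConst_pos (d : ℕ) : 0 < bubbleConst d := by
  unfold bubbleConst; positivity

namespace Mesh

variable {Ω : Set (E d)} (M : Mesh Ω)

/-- The oscillation of the vertex values around the value on the element. -/
def osc (c : M.cells → ℝ) (T : M.cells) : ℝ := ∑ z ∈ T.1, |M.vertexValue c z - c T|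

theorem osc_nonneg (c : M.cells → ℝ) (T : M.cells) : 0 ≤ M.osc c T :=
  Finset.sum_nonneg fun _ _ => abs_nonneg _

/-- Constants are reproduced, so only differences of vertex values matter. -/
theorem sum_vertexValue_sub (c : M.cells → ℝ) (T : M.cells) (x : E d) :
    ∑ z ∈ T.1, M.vertexValue c z * M.bary T z x - c T
      = ∑ z ∈ T.1, (M.vertexValue c z - c T) * M.bary T z x := by
  simp_rw [sub_mul]
  rw [Finset.sum_sub_distrib, ← Finset.mul_sum, M.sum_bary, mul_one]

theorem abs_sum_vertexValue_sub_le (c : M.cells → ℝ) {T : M.cells} {x : E d}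
    (hx : x ∈ closedSimplex T.1) :
    |∑ z ∈ T.1, M.vertexValue c z * M.bary T z x - c T| ≤ M.osc c T := by
  rw [sum_vertexValue_sub]
  refine (Finset.abs_sum_le_sum_abs _ _).trans (Finset.sum_le_sum fun z _ => ?_)
  rw [abs_mul, abs_of_nonneg (M.bary_nonneg hx z)]
  exact mul_le_of_le_one_right (abs_nonneg _) (M.bary_le_one hx z)

/-- The bubble corrects the mean of a function bounded by the oscillation. -/
theorem abs_bubbleCoeff_le (c : M.cells → ℝ) (T : M.cells) :
    |M.bubbleCoeff c T| ≤ (bubbleConst d)⁻¹ * M.osc c T := by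
  have hb := M.integral_bubble_pos T
  have hκ := bubbleConst_pos d
  have ho := M.osc_nonneg c T
  have h1 : bubbleConst d * vol T.1 ≤ ∫ x in openSimplex T.1, M.bubble T x := by
    refine (M.le_integral_prod_bary T).trans_eq ?_
    exact (setIntegral_congr_fun (isOpen_openSimplex T.1).measurableSet
      fun x hx => M.bubble_eq_prod hx).symm
  have h2 : |∫ x in openSimplex T.1, (c T - ∑ z ∈ T.1, M.vertexValue c z * M.bary T z x)|
      ≤ M.osc c T * vol T.1 := by
    rw [← Real.norm_eq_abs]
    refine norm_setIntegral_le_of_norm_le_const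
      (volume_openSimplex_ne_top T.1).lt_top fun x hx => ?_
    rw [Real.norm_eq_abs, abs_sub_comm]
    exact M.abs_sum_vertexValue_sub_le c (interior_subset hx)
  rw [bubbleCoeff, abs_mul, abs_of_pos (inv_pos.2 hb), inv_mul_eq_div, inv_mul_eq_div,
    div_le_div_iff₀ hb hκ]
  calc _ ≤ M.osc c T * vol T.1 * bubbleConst d := by gcongr
    _ = M.osc c T * (bubbleConst d * vol T.1) := by ring
    _ ≤ _ := by gcongr

/-- On an element the quasi-interpolation differs from the given constant by the oscillation. -/
theorem abs_quasi_sub_le (c : M.cells → ℝ) {T : M.cells} {x : E d} (hx : x ∈ openSimplex T.1) :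
    |M.quasi c x - c T| ≤ (1 + (bubbleConst d)⁻¹) * M.osc c T := by
  have hx' : x ∈ closedSimplex T.1 := interior_subset hx
  have hprod0 : 0 ≤ ∏ z ∈ T.1, M.bary T z x := Finset.prod_nonneg fun z _ => M.bary_nonneg hx' z
  have hprod1 : ∏ z ∈ T.1, M.bary T z x ≤ 1 :=
    Finset.prod_le_one (fun z _ => M.bary_nonneg hx' z) fun z _ => M.bary_le_one hx' z
  rw [M.quasi_eq c hx, add_sub_right_comm, add_mul, one_mul]
  refine (abs_add_le _ _).trans (add_le_add (M.abs_sum_vertexValue_sub_le c hx') ?_)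
  rw [abs_mul, abs_of_nonneg hprod0]
  exact (mul_le_of_le_one_right (abs_nonneg _) hprod1).trans (M.abs_bubbleCoeff_le c T)

variable {M} {Creg : ℝ}

/-- An inverse estimate: the gradient on an element is the oscillation over the diameter. -/
theorem ShapeRegular.norm_gradient_quasi_le (h : M.ShapeRegular Creg) (hd : 1 ≤ d)
    (c : M.cells → ℝ) {T : M.cells} {x : E d} (hx : x ∈ openSimplex T.1) :
    ‖gradient (M.quasi c) x‖
      ≤ Creg * (1 + ((d : ℝ) + 1) * (bubbleConst d)⁻¹) * (M.osc c T / diam T.1) := by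
  have hC := h.pos hd T
  have hD := M.diam_pos hd T
  have hκ := bubbleConst_pos d
  have ho := M.osc_nonneg c T
  obtain ⟨L, hL⟩ : ∃ L : ℝ≥0, (L : ℝ)
      = Creg * (1 + ((d : ℝ) + 1) * (bubbleConst d)⁻¹) * (M.osc c T / diam T.1) :=
    ⟨⟨_, by positivity⟩, rfl⟩
  rw [← hL, gradient, LinearIsometryEquiv.norm_map]
  refine norm_fderiv_le_of_lipschitzOn ℝ ((isOpen_openSimplex T.1).mem_nhds hx)
    (LipschitzOnWith.of_dist_le_mul fun y hy y' hy' => ?_)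
  rw [Real.dist_eq, dist_eq_norm, M.quasi_eq c hy, M.quasi_eq c hy', hL]
  have e : ∑ z ∈ T.1, M.vertexValue c z * M.bary T z y
        + M.bubbleCoeff c T * ∏ z ∈ T.1, M.bary T z y
      - (∑ z ∈ T.1, M.vertexValue c z * M.bary T z y'
        + M.bubbleCoeff c T * ∏ z ∈ T.1, M.bary T z y')
      = ∑ z ∈ T.1, (M.vertexValue c z - c T) * (M.bary T z y - M.bary T z y')
        + M.bubbleCoeff c T * (∏ z ∈ T.1, M.bary T z y - ∏ z ∈ T.1, M.bary T z y') := by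
    simp_rw [mul_sub]
    rw [Finset.sum_sub_distrib, ← M.sum_vertexValue_sub, ← M.sum_vertexValue_sub]
    ring
  rw [e]
  refine (abs_add_le _ _).trans ?_
  have h1 : |∑ z ∈ T.1, (M.vertexValue c z - c T) * (M.bary T z y - M.bary T z y')|
      ≤ M.osc c T * (Creg / diam T.1 * ‖y - y'‖) := by
    rw [osc, Finset.sum_mul]
    refine (Finset.abs_sum_le_sum_abs _ _).trans (Finset.sum_le_sum fun z _ => ?_)
    rw [abs_mul]
    gcongr
    exact h.abs_bary_sub_le hd T z y y'
  have h2 : |M.bubbleCoeff c T * (∏ z ∈ T.1, M.bary T z y - ∏ z ∈ T.1, M.bary T z y')|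
      ≤ ((bubbleConst d)⁻¹ * M.osc c T) * (((d : ℝ) + 1) * (Creg / diam T.1) * ‖y - y'‖) := by
    rw [abs_mul]
    gcongr
    · exact M.abs_bubbleCoeff_le c T
    · exact h.abs_prod_bary_sub_le hd T (interior_subset hy) (interior_subset hy')
  refine (add_le_add h1 h2).trans_eq ?_
  ring

/-- The weak gradient of the quasi-interpolation is controlled by the scaled oscillations. -/
theorem ShapeRegular.norm_grad_sq_le (h : M.ShapeRegular Creg) (hd : 1 ≤ d)
    (hΩ : IsBoundedLipschitz Ω) {ω : Set (E d)} (hω : ω ⊆ Ω) (c : M.cells → ℝ) {w : H10 ω}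
    (hw : grad w =ᵐ[volume.restrict ω] gradient (M.quasi c)) :
    ‖grad w‖ ^ 2 ≤ (Creg * (1 + ((d : ℝ) + 1) * (bubbleConst d)⁻¹)) ^ 2 *
      ∑ T : M.cells, M.osc c T ^ 2 / scale T.1 := by
  set K := Creg * (1 + ((d : ℝ) + 1) * (bubbleConst d)⁻¹) with hK
  have hscale : ∀ T : M.cells, 0 ≤ M.osc c T ^ 2 / scale T.1 := fun T =>
    div_nonneg (sq_nonneg _) (div_nonneg (sq_nonneg _) (vol_nonneg _))
  refine norm_sq_le_of_lintegral_le
    (mul_nonneg (sq_nonneg _) (Finset.sum_nonneg fun T _ => hscale T)) ?_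
  calc ∫⁻ x in ω, ‖grad w x‖ₑ ^ 2 = ∫⁻ x in ω, ‖gradient (M.quasi c) x‖ₑ ^ 2 := by
        refine lintegral_congr_ae ?_
        filter_upwards [hw] with x hx
        rw [hx]
    _ ≤ ∫⁻ x in Ω, ‖gradient (M.quasi c) x‖ₑ ^ 2 := lintegral_mono_set hω
    _ = ∑ T : M.cells, ∫⁻ x in openSimplex T.1, ‖gradient (M.quasi c) x‖ₑ ^ 2 :=
        M.lintegral_eq_sum hΩ _
    _ ≤ ∑ T : M.cells, ENNReal.ofReal (K ^ 2 * (M.osc c T ^ 2 / scale T.1)) := by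
        refine Finset.sum_le_sum fun T _ => ?_
        have hD := M.diam_pos hd T
        have hv := M.vol_pos T
        calc ∫⁻ x in openSimplex T.1, ‖gradient (M.quasi c) x‖ₑ ^ 2
            ≤ ∫⁻ _ in openSimplex T.1, ENNReal.ofReal ((K * (M.osc c T / diam T.1)) ^ 2) := by
              refine setLIntegral_mono' (isOpen_openSimplex T.1).measurableSet fun x hx => ?_
              rw [← ofReal_norm, ← ENNReal.ofReal_pow (norm_nonneg _)]
              refine ENNReal.ofReal_le_ofReal ?_
              gcongr
              exact h.norm_gradient_quasi_le hd c hx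
          _ = ENNReal.ofReal ((K * (M.osc c T / diam T.1)) ^ 2) * ENNReal.ofReal (vol T.1) := by
              rw [setLIntegral_const, vol, Measure.real,
                ENNReal.ofReal_toReal (volume_openSimplex_ne_top T.1)]
          _ = _ := by
              rw [← ENNReal.ofReal_mul (by positivity), scale]
              congr 1
              field_simp
    _ = ENNReal.ofReal (K ^ 2 * ∑ T : M.cells, M.osc c T ^ 2 / scale T.1) := by
        rw [← ENNReal.ofReal_sum_of_nonneg fun T _ => mul_nonneg (sq_nonneg _) (hscale T),
          Finset.mul_sum]

/-- The quasi-interpolation belongs to `H₀¹` of any subset of `Ω` that contains the supports of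
the hat and bubble functions with nonzero coefficients. -/
theorem ShapeRegular.isH10Rep_quasi (h : M.ShapeRegular Creg) (hd : 1 ≤ d)
    (hΩ : IsBoundedLipschitz Ω) {ω : Set (E d)} (hω : ω ⊆ Ω) (c : M.cells → ℝ)
    (h1 : ∀ z ∈ M.interiorVertices, M.vertexValue c z ≠ 0 → ∀ x ∉ ω, M.nodal z x = 0)
    (h2 : ∀ T : M.cells, M.bubbleCoeff c T ≠ 0 → openSimplex T.1 ⊆ ω) :
    IsH10Rep ω (M.quasi c) := by
  refine (isH10Rep_sum _ fun z hz => ?_).add (isH10Rep_sum _ fun T _ => ?_)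
  · by_cases hne : M.vertexValue c z = 0
    · simpa [hne] using isH10Rep_zero
    · obtain ⟨⟨T, hzT⟩, _⟩ := M.mem_interiorVertices.1 hz
      exact (h.isH10Rep_nodal hd hΩ hω ((M.mem_interiorVertices_iff hΩ.isOpen hzT).1 hz)
        (h1 z hz hne)).const_mul _
  · by_cases hne : M.bubbleCoeff c T = 0
    · simpa [hne] using isH10Rep_zero
    · exact (h.isH10Rep_contBubble hd hΩ hω (h2 T hne)).const_mul _

end Mesh

/-! ### Estimates on vertex stars -/

/-- A bound for the number of elements at a vertex. -/
def starCard (d : ℕ) (Creg : ℝ) : ℕ := ⌊Creg * ballVol d⌋₊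

/-- A bound for the ratio of the sizes of two elements with a common facet. -/
def adjRatio (d : ℕ) (Creg : ℝ) : ℝ := 1 + ballVol d * Creg ^ (d + 3)

/-- A bound for the ratio of the sizes of two elements that are connected by a chain of elements
at a vertex. -/
def starRatio (d : ℕ) (Creg : ℝ) : ℝ := adjRatio d Creg ^ starCard d Creg

theorem one_le_adjRatio {Creg : ℝ} (h1 : 1 ≤ Creg) : 1 ≤ adjRatio d Creg := by
  have := ballVol_nonneg d
  exact le_add_of_nonneg_right (by positivity)

theorem one_le_starRatio {Creg : ℝ} (h1 : 1 ≤ Creg) : 1 ≤ starRatio d Creg :=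
  one_le_pow₀ (one_le_adjRatio h1)

namespace Mesh

variable {Ω : Set (E d)} {M : Mesh Ω} {Creg : ℝ}

theorem scale_pos (M : Mesh Ω) (hd : 1 ≤ d) (T : M.cells) : 0 < scale T.1 :=
  div_pos (pow_pos (M.diam_pos hd T) 2) (M.vol_pos T)

theorem ShapeRegular.star_card_le (h : M.ShapeRegular Creg) (hd : 1 ≤ d) (z : E d)
    (hne : (M.star z).Nonempty) : (M.star z).card ≤ starCard d Creg :=
  Nat.le_floor (h.card_star_le hd z _ hne fun _ hT => M.mem_star.1 hT)

/-- Neighbours have `d ≥ 2` vertices in common, hence an edge. -/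
theorem ShapeRegular.diam_le_of_adj (h : M.ShapeRegular Creg) (hd : 2 ≤ d) {z : E d}
    {T T' : {T : M.cells // z ∈ T.1}} (hadj : (M.starGraph z).Adj T T') :
    diam T.1.1 ≤ Creg * diam T'.1.1 := by
  classical
  have hcard : 1 < (T.1.1 ∩ T'.1.1).card := by
    have he : (T.1.1 ∩ T'.1.1).card = d := by
      convert hadj.2
    rw [he]
    exact hd
  obtain ⟨x, hx, y, hy, hxy⟩ := Finset.one_lt_card.1 hcard
  rw [Finset.mem_inter] at hx hy
  exact h.diam_le_mul_diam (by lia) hx.1 hy.1 hx.2 hy.2 hxy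

theorem ShapeRegular.vol_le_of_adj (h : M.ShapeRegular Creg) (h1 : 1 ≤ Creg) (hd : 2 ≤ d)
    {z : E d} {T T' : {T : M.cells // z ∈ T.1}} (hadj : (M.starGraph z).Adj T T') :
    vol T.1.1 ≤ ballVol d * Creg ^ (d + 1) * vol T'.1.1 := by
  have hb := ballVol_nonneg d
  have hD := (M.diam_pos (by lia) T.1).le
  calc vol T.1.1 ≤ diam T.1.1 ^ d * ballVol d := M.vol_le_ballVol _
    _ ≤ (Creg * diam T'.1.1) ^ d * ballVol d := by
      gcongr
      exact h.diam_le_of_adj hd hadj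
    _ = Creg ^ d * diam T'.1.1 ^ d * ballVol d := by rw [mul_pow]
    _ ≤ Creg ^ d * (Creg * vol T'.1.1) * ballVol d := by
      gcongr
      exact h.pow_diam_le _
    _ = _ := by ring

theorem ShapeRegular.vol_le_adjRatio (h : M.ShapeRegular Creg) (h1 : 1 ≤ Creg) (hd : 2 ≤ d)
    {z : E d} {T T' : {T : M.cells // z ∈ T.1}} (hadj : (M.starGraph z).Adj T T') :
    vol T.1.1 ≤ adjRatio d Creg * vol T'.1.1 := by
  have hb := ballVol_nonneg d
  refine (h.vol_le_of_adj h1 hd hadj).trans ?_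
  have : Creg ^ (d + 1) ≤ Creg ^ (d + 3) := pow_le_pow_right₀ h1 (by lia)
  have hle : ballVol d * Creg ^ (d + 1) ≤ adjRatio d Creg := by
    unfold adjRatio
    nlinarith
  exact mul_le_mul_of_nonneg_right hle (vol_nonneg _)

theorem ShapeRegular.inv_scale_le_adjRatio (h : M.ShapeRegular Creg) (h1 : 1 ≤ Creg) (hd : 2 ≤ d)
    {z : E d} {T T' : {T : M.cells // z ∈ T.1}} (hadj : (M.starGraph z).Adj T T') :
    (scale T.1.1)⁻¹ ≤ adjRatio d Creg * (scale T'.1.1)⁻¹ := by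
  have hb := ballVol_nonneg d
  have hD := M.diam_pos (by lia) T.1
  have hD' := M.diam_pos (by lia) T'.1
  have hV' := M.vol_pos T'.1
  rw [scale, scale, inv_div, inv_div, ← mul_div_assoc, div_le_div_iff₀ (by positivity)
    (by positivity)]
  calc vol T.1.1 * diam T'.1.1 ^ 2
      ≤ ballVol d * Creg ^ (d + 1) * vol T'.1.1 * (Creg * diam T.1.1) ^ 2 := by
        gcongr
        · exact h.vol_le_of_adj h1 hd hadj
        · exact h.diam_le_of_adj hd hadj.symm
    _ = ballVol d * Creg ^ (d + 3) * (vol T'.1.1 * diam T.1.1 ^ 2) := by ring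
    _ ≤ adjRatio d Creg * (vol T'.1.1 * diam T.1.1 ^ 2) := by
        gcongr
        exact le_add_of_nonneg_left zero_le_one
    _ = _ := by ring

/-- A chain without repetitions is not longer than the number of elements at the vertex. -/
theorem ShapeRegular.exists_walk_length_le (h : M.ShapeRegular Creg) (hd : 1 ≤ d) {z : E d}
    {T T' : {T : M.cells // z ∈ T.1}} (hr : (M.starGraph z).Reachable T T') :
    ∃ p : (M.starGraph z).Walk T T', p.length ≤ starCard d Creg := by
  classical
  obtain ⟨p, hp⟩ := hr.exists_isPath
  refine ⟨p, hp.length_lt.le.trans ?_⟩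
  have hcard : Fintype.card {T : M.cells // z ∈ T.1} = (M.star z).card := by
    rw [Fintype.card_subtype, star]
  rw [hcard]
  exact h.star_card_le hd z ⟨T.1, M.mem_star.2 T.2⟩

/-- A quantity that changes by at most a factor between neighbours is comparable on all elements
of a chain. It is applied to the volume and to the inverse of `scale`. -/
theorem ShapeRegular.le_starRatio_of_reachable (h : M.ShapeRegular Creg) (h1 : 1 ≤ Creg)
    (hd : 1 ≤ d) {z : E d} {g : M.cells → ℝ} (hg0 : ∀ T, 0 ≤ g T)
    (hg : ∀ T T' : {T : M.cells // z ∈ T.1}, (M.starGraph z).Adj T T' →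
      g T.1 ≤ adjRatio d Creg * g T'.1)
    {T T' : {T : M.cells // z ∈ T.1}} (hr : (M.starGraph z).Reachable T T') :
    g T.1 ≤ starRatio d Creg * g T'.1 := by
  have hκ := one_le_adjRatio (d := d) h1
  obtain ⟨p, hp⟩ := h.exists_walk_length_le hd hr
  have key : ∀ {a b} (p : (M.starGraph z).Walk a b),
      g a.1 ≤ adjRatio d Creg ^ p.length * g b.1 := by
    intro a b p
    induction p with
    | nil => simp
    | cons hadj p ih =>
      rw [SimpleGraph.Walk.length_cons, pow_succ', mul_assoc]
      exact (hg _ _ hadj).trans (by gcongr)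
  refine (key p).trans ?_
  unfold starRatio
  have := hg0 T'.1
  gcongr

theorem ShapeRegular.vol_le_of_reachable (h : M.ShapeRegular Creg) (h1 : 1 ≤ Creg)
    (hd : 2 ≤ d) {z : E d} {T T' : {T : M.cells // z ∈ T.1}}
    (hr : (M.starGraph z).Reachable T T') : vol T.1.1 ≤ starRatio d Creg * vol T'.1.1 :=
  h.le_starRatio_of_reachable h1 (by lia) (g := fun T => vol T.1) (fun T => vol_nonneg _)
    (fun _ _ hadj => h.vol_le_adjRatio h1 hd hadj) hr

theorem ShapeRegular.inv_scale_le_of_reachable (h : M.ShapeRegular Creg) (h1 : 1 ≤ Creg)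
    (hd : 2 ≤ d) {z : E d} {T T' : {T : M.cells // z ∈ T.1}}
    (hr : (M.starGraph z).Reachable T T') :
    (scale T.1.1)⁻¹ ≤ starRatio d Creg * (scale T'.1.1)⁻¹ :=
  h.le_starRatio_of_reachable h1 (by lia) (g := fun T => (scale T.1)⁻¹)
    (fun T => (inv_pos.2 (M.scale_pos (by lia) T)).le)
    (fun _ _ hadj => h.inv_scale_le_adjRatio h1 hd hadj) hr

/-- The sum of the energies over the elements at a vertex. -/
def starEnergy (M : Mesh Ω) (u : E d → ℝ) (z : E d) : ℝ := ∑ T ∈ M.star z, energy u T.1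

theorem starEnergy_nonneg (u : E d → ℝ) (z : E d) : 0 ≤ M.starEnergy u z :=
  Finset.sum_nonneg fun _ _ => energy_nonneg _ _

theorem ShapeRegular.scale_mul_energy_le (h : M.ShapeRegular Creg) (h1 : 1 ≤ Creg) (hd : 2 ≤ d)
    (u : E d → ℝ) {z : E d} {T₀ T : {T : M.cells // z ∈ T.1}}
    (hr : (M.starGraph z).Reachable T₀ T) :
    scale T.1.1 * energy u T.1.1 ≤ starRatio d Creg * scale T₀.1.1 * M.starEnergy u z := by
  have hκ := one_le_starRatio (d := d) h1
  have hs := M.scale_pos (by lia) T.1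
  have hs₀ := M.scale_pos (by lia) T₀.1
  have h2 := h.inv_scale_le_of_reachable h1 hd hr
  have h3 : scale T.1.1 ≤ starRatio d Creg * scale T₀.1.1 := by
    rw [← div_eq_mul_inv, inv_eq_one_div, div_le_div_iff₀ hs₀ hs] at h2
    linarith
  have h4 : energy u T.1.1 ≤ M.starEnergy u z :=
    Finset.single_le_sum (f := fun T : M.cells => energy u T.1)
      (fun _ _ => energy_nonneg _ _) (M.mem_star.2 T.2)
  exact mul_le_mul h3 h4 (energy_nonneg _ _) (by positivity)

/-- Mean values on two elements of a chain at a vertex differ by the energy near the vertex. -/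
theorem ShapeRegular.abs_mean_sub_mean_le (h : M.ShapeRegular Creg) (h1 : 1 ≤ Creg) (hd : 2 ≤ d)
    {u : E d → ℝ} (hu : ContDiff ℝ 1 u) {z : E d} {T₀ T : {T : M.cells // z ∈ T.1}}
    (hr : (M.starGraph z).Reachable T₀ T) :
    |mean u T₀.1.1 - mean u T.1.1| ≤ starCard d Creg *
      (2 * √(starRatio d Creg * scale T₀.1.1 * M.starEnergy u z)) := by
  obtain ⟨p, hp⟩ := h.exists_walk_length_le (by lia) hr
  set A := √(starRatio d Creg * scale T₀.1.1 * M.starEnergy u z) with hA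
  have hA0 : 0 ≤ A := Real.sqrt_nonneg _
  have hle : ∀ T, (M.starGraph z).Reachable T₀ T → √(scale T.1.1 * energy u T.1.1) ≤ A :=
    fun T hr => Real.sqrt_le_sqrt (h.scale_mul_energy_le h1 hd u hr)
  have key : ∀ {a b} (p : (M.starGraph z).Walk a b), (M.starGraph z).Reachable T₀ a →
      |mean u a.1.1 - mean u b.1.1| ≤ p.length * (2 * A) := by
    intro a b p
    induction p with
    | nil => simp
    | @cons a a' b hadj p ih =>
      intro ha
      have ha' : (M.starGraph z).Reachable T₀ a' := ha.trans hadj.reachable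
      have e1 := abs_mean_sub_mean_le_of_adj M hu hadj
      have e2 := abs_sub_le (mean u a.1.1) (mean u a'.1.1) (mean u b.1.1)
      have e3 := ih ha'
      have e4 := hle a ha
      have e5 := hle a' ha'
      rw [SimpleGraph.Walk.length_cons]
      push_cast
      linarith
  refine (key p (SimpleGraph.Reachable.refl _)).trans ?_
  have : (p.length : ℝ) ≤ starCard d Creg := by exact_mod_cast hp
  gcongr

/-- The vertex values of the quasi-interpolation of a function that vanishes outside the domain
approximate its mean values. At a boundary vertex this uses a chain of elements from the given
element to an element with a facet on the boundary. -/
theorem ShapeRegular.sq_vertexValue_sub_mean_le (h : M.ShapeRegular Creg) (h1 : 1 ≤ Creg)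
    (hd : 2 ≤ d) (hΩ : IsBoundedLipschitz Ω) {u : E d → ℝ} (hu : ContDiff ℝ 1 u)
    (hu0 : ∀ x ∉ Ω, u x = 0) {T₀ : M.cells} {z : E d} (hz : z ∈ T₀.1) :
    (M.vertexValue (fun T => mean u T.1) z - mean u T₀.1) ^ 2 ≤
      (4 * ((starCard d Creg : ℝ) + 1) ^ 2 * starRatio d Creg) * scale T₀.1 *
        M.starEnergy u z := by
  have hκ := one_le_starRatio (d := d) h1
  have hs₀ := M.scale_pos (by lia) T₀
  have hE := starEnergy_nonneg (M := M) u z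
  obtain ⟨A, hA⟩ : ∃ A, A = √(starRatio d Creg * scale T₀.1 * M.starEnergy u z) := ⟨_, rfl⟩
  have hA0 : 0 ≤ A := hA ▸ Real.sqrt_nonneg _
  have hA2 : A ^ 2 = starRatio d Creg * scale T₀.1 * M.starEnergy u z :=
    hA ▸ Real.sq_sqrt (by positivity)
  suffices H : |M.vertexValue (fun T => mean u T.1) z - mean u T₀.1|
      ≤ ((starCard d Creg : ℝ) + 1) * (2 * A) by
    rw [← sq_abs]
    calc _ ≤ (((starCard d Creg : ℝ) + 1) * (2 * A)) ^ 2 := by gcongr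
      _ = 4 * ((starCard d Creg : ℝ) + 1) ^ 2 * A ^ 2 := by ring
      _ = _ := by rw [hA2]; ring
  by_cases hzi : z ∈ M.interiorVertices
  · have hzΩ := (M.mem_interiorVertices_iff hΩ.isOpen hz).1 hzi
    rw [vertexValue, if_pos hzi]
    have e : ∑ T ∈ M.star z, M.weight T.1 z * mean u T.1 - mean u T₀.1
        = ∑ T ∈ M.star z, M.weight T.1 z * (mean u T.1 - mean u T₀.1) := by
      simp_rw [mul_sub]
      rw [Finset.sum_sub_distrib, ← Finset.sum_mul, M.sum_weight hz, one_mul]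
    have hT : ∀ T ∈ M.star z, |M.weight T.1 z * (mean u T.1 - mean u T₀.1)|
        ≤ M.weight T.1 z * ((starCard d Creg : ℝ) * (2 * A)) := fun T hT => by
      rw [abs_mul, abs_of_nonneg (M.weight_nonneg _ _)]
      refine mul_le_mul_of_nonneg_left ?_ (M.weight_nonneg _ _)
      have hr := M.starGraph_reachable hΩ.isOpen hzΩ ⟨T₀, hz⟩ ⟨T, M.mem_star.1 hT⟩
      have e1 := h.abs_mean_sub_mean_le h1 hd hu hr
      simp only at e1
      rw [abs_sub_comm, hA]
      exact e1
    rw [e]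
    calc |∑ T ∈ M.star z, M.weight T.1 z * (mean u T.1 - mean u T₀.1)|
        ≤ ∑ T ∈ M.star z, M.weight T.1 z * ((starCard d Creg : ℝ) * (2 * A)) :=
          (Finset.abs_sum_le_sum_abs _ _).trans (Finset.sum_le_sum hT)
      _ = (∑ T ∈ M.star z, M.weight T.1 z) * ((starCard d Creg : ℝ) * (2 * A)) :=
          (Finset.sum_mul _ _ _).symm
      _ ≤ _ := by
          rw [M.sum_weight hz, one_mul]
          linarith
  · have hzΩ : z ∉ Ω := fun hz' => hzi ((M.mem_interiorVertices_iff hΩ.isOpen hz).2 hz')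
    obtain ⟨T', hr, z₀, hz₀, hne, hfree⟩ := M.exists_reachable_isFreeFacet hΩ hzΩ ⟨T₀, hz⟩
    rw [vertexValue, if_neg hzi, zero_sub, abs_neg]
    have e1 := h.abs_mean_sub_mean_le h1 hd hu hr
    have e2 := M.abs_mean_le_of_isFreeFacet hΩ.isOpen hu hu0 T'.1 hz₀ T'.2 hne hfree
    have e3 : √(scale T'.1.1 * energy u T'.1.1) ≤ A := by
      have e := h.scale_mul_energy_le h1 hd u hr
      simp only at e
      rw [hA]
      exact Real.sqrt_le_sqrt e
    have e4 := abs_sub_abs_le_abs_sub (mean u T₀.1) (mean u T'.1.1)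
    simp only at e1
    rw [← hA] at e1
    linarith

open Classical in
/-- Summation over all pairs of an element and one of its vertices. -/
theorem sum_sum_vertices (M : Mesh Ω) (g : M.cells → E d → ℝ) :
    ∑ T : M.cells, ∑ z ∈ T.1, g T z = ∑ z ∈ M.cells.biUnion id, ∑ T ∈ M.star z, g T z := by
  refine Finset.sum_comm' fun T z => ?_
  simp only [Finset.mem_univ, true_and, mem_star, Finset.mem_biUnion, id]
  exact ⟨fun h => ⟨h, T.1, T.2, h⟩, fun h => h.1⟩

/-- Each element contributes to the star energies of only finitely many pairs of an element and a
vertex. -/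
theorem ShapeRegular.sum_sum_starEnergy_le (h : M.ShapeRegular Creg) (hd : 1 ≤ d)
    (u : E d → ℝ) : ∑ T : M.cells, ∑ z ∈ T.1, M.starEnergy u z
      ≤ starCard d Creg * ((d : ℝ) + 1) * ∑ T : M.cells, energy u T.1 := by
  classical
  calc _ = ∑ z ∈ M.cells.biUnion id, ∑ T ∈ M.star z, M.starEnergy u z :=
        M.sum_sum_vertices fun _ z => M.starEnergy u z
    _ ≤ ∑ z ∈ M.cells.biUnion id, (starCard d Creg : ℝ) * M.starEnergy u z := by
        refine Finset.sum_le_sum fun z hz => ?_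
        rw [Finset.sum_const, nsmul_eq_mul]
        refine mul_le_mul_of_nonneg_right ?_ (starEnergy_nonneg u z)
        simp only [Finset.mem_biUnion, id] at hz
        obtain ⟨T, hT, hzT⟩ := hz
        exact_mod_cast h.star_card_le hd z ⟨⟨T, hT⟩, M.mem_star.2 hzT⟩
    _ = starCard d Creg * ∑ T : M.cells, ∑ z ∈ T.1, energy u T.1 := by
        rw [M.sum_sum_vertices fun T _ => energy u T.1, Finset.mul_sum]
        rfl
    _ = _ := by
        rw [mul_assoc]
        congr 1
        rw [Finset.mul_sum]
        refine Finset.sum_congr rfl fun T _ => ?_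
        rw [Finset.sum_const, M.card_eq T.1 T.2, nsmul_eq_mul]
        push_cast
        ring

theorem sq_osc_le (c : M.cells → ℝ) (T : M.cells) :
    M.osc c T ^ 2 ≤ ((d : ℝ) + 1) * ∑ z ∈ T.1, (M.vertexValue c z - c T) ^ 2 := by
  refine sq_sum_le_card_mul_sum_sq.trans_eq ?_
  rw [M.card_eq T.1 T.2]
  push_cast
  simp_rw [sq_abs]

/-- A bound for the oscillations of the quasi-interpolation in terms of the energy. -/
def oscConst (d : ℕ) (Creg : ℝ) : ℝ :=
  ((d : ℝ) + 1) * (4 * ((starCard d Creg : ℝ) + 1) ^ 2 * starRatio d Creg) *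
    (starCard d Creg * ((d : ℝ) + 1))

theorem oscConst_nonneg (h1 : 1 ≤ Creg) : 0 ≤ oscConst d Creg := by
  have hκ := one_le_starRatio (d := d) h1
  unfold oscConst
  positivity

/-- The scaled oscillations of the mean values of a function that vanishes outside the domain are
bounded by its energy, summed over the mesh. -/
theorem ShapeRegular.sum_sq_osc_mean_le (h : M.ShapeRegular Creg) (h1 : 1 ≤ Creg)
    (hd : 2 ≤ d) (hΩ : IsBoundedLipschitz Ω) {u : E d → ℝ} (hu : ContDiff ℝ 1 u)
    (hu0 : ∀ x ∉ Ω, u x = 0) :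
    ∑ T : M.cells, M.osc (fun T => mean u T.1) T ^ 2 / scale T.1
      ≤ oscConst d Creg * ∑ T : M.cells, energy u T.1 := by
  have hκ := one_le_starRatio (d := d) h1
  set K := 4 * ((starCard d Creg : ℝ) + 1) ^ 2 * starRatio d Creg with hK
  calc _ ≤ ∑ T : M.cells, ((d : ℝ) + 1) * K * ∑ z ∈ T.1, M.starEnergy u z := by
        refine Finset.sum_le_sum fun T _ => ?_
        rw [div_le_iff₀ (M.scale_pos (by lia) T)]
        refine (sq_osc_le _ T).trans ?_
        calc _ ≤ ((d : ℝ) + 1) * ∑ z ∈ T.1, K * scale T.1 * M.starEnergy u z := by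
              gcongr with z hz
              exact h.sq_vertexValue_sub_mean_le h1 hd hΩ hu hu0 hz
          _ = _ := by rw [← Finset.mul_sum]; ring
    _ = ((d : ℝ) + 1) * K * ∑ T : M.cells, ∑ z ∈ T.1, M.starEnergy u z := by
        rw [Finset.mul_sum]
    _ ≤ ((d : ℝ) + 1) * K *
          (starCard d Creg * ((d : ℝ) + 1) * ∑ T : M.cells, energy u T.1) := by
        gcongr
        exact h.sum_sum_starEnergy_le (by lia) u
    _ = _ := by rw [oscConst]; ring

open Classical in
theorem vertexValue_single (M : Mesh Ω) (T : M.cells) (z : E d) :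
    M.vertexValue (Pi.single T 1) z
      = if z ∈ M.interiorVertices ∧ z ∈ T.1 then M.weight T.1 z else 0 := by
  rw [vertexValue]
  by_cases h1 : z ∈ M.interiorVertices
  · simp only [h1, if_true, true_and, Pi.single_apply, mul_ite, mul_one, mul_zero,
      Finset.sum_ite_eq', mem_star]
  · simp [h1]

open Classical in
theorem abs_vertexValue_single_le (M : Mesh Ω) (T : M.cells) (z : E d) :
    0 ≤ M.vertexValue (Pi.single T 1) z ∧ M.vertexValue (Pi.single T 1) z ≤ 1 := by
  rw [vertexValue_single]
  split_ifs with h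
  · exact ⟨M.weight_nonneg _ _, M.weight_le_one h.2⟩
  · exact ⟨le_rfl, zero_le_one⟩

open Classical in
/-- The oscillations of the nodal values for the indicator function of an element are confined to
the neighbours of the element. -/
theorem sq_osc_single_le (T T' : M.cells) :
    M.osc (Pi.single T 1) T' ^ 2 ≤ ((d : ℝ) + 1) *
      (∑ z ∈ T'.1, ((if T' = T then 1 else 0) +
        if z ∈ M.interiorVertices ∧ z ∈ T.1 then 1 else 0)) := by
  refine (sq_osc_le _ T').trans ?_
  gcongr with z hz
  have h0 := M.abs_vertexValue_single_le T z
  by_cases hT : T' = T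
  · subst hT
    rw [Pi.single_eq_same, if_pos rfl]
    have : (M.vertexValue (Pi.single T' 1) z - 1) ^ 2 ≤ 1 := by nlinarith [h0.1, h0.2]
    refine this.trans (le_add_of_nonneg_right ?_)
    split_ifs <;> norm_num
  · rw [Pi.single_eq_of_ne hT, if_neg hT, sub_zero, zero_add]
    split_ifs with h
    · nlinarith [h0.1, h0.2]
    · rw [vertexValue_single, if_neg h]; norm_num

/-- A bound for the oscillations of the indicator function of an element. -/
def singleConst (d : ℕ) (Creg : ℝ) : ℝ :=
  ((d : ℝ) + 1) ^ 2 * (1 + starCard d Creg * starRatio d Creg)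

theorem singleConst_nonneg (h1 : 1 ≤ Creg) : 0 ≤ singleConst d Creg := by
  have hκ := one_le_starRatio (d := d) h1
  unfold singleConst
  positivity

/-- The weighted oscillations for the indicator function of `T` are bounded by the weight of `T`,
as only elements in the stars of the interior vertices of `T` contribute. The weight `ρ` is the
volume in the `L²` bound and the inverse of `scale` in the gradient bound. -/
theorem ShapeRegular.sum_sq_osc_single_le (h : M.ShapeRegular Creg) (h1 : 1 ≤ Creg)
    (hd : 2 ≤ d) (hΩ : IsBoundedLipschitz Ω) (T : M.cells) {ρ : M.cells → ℝ}
    (hρ0 : ∀ T, 0 ≤ ρ T)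
    (hρ : ∀ (z : E d) (T T' : {T : M.cells // z ∈ T.1}), (M.starGraph z).Reachable T T' →
      ρ T.1 ≤ starRatio d Creg * ρ T'.1) :
    ∑ T' : M.cells, M.osc (Pi.single T 1) T' ^ 2 * ρ T' ≤ singleConst d Creg * ρ T := by
  classical
  have hκ := one_le_starRatio (d := d) h1
  have hT := hρ0 T
  have hz : ∀ z : E d, ∑ T' ∈ M.star z, (if z ∈ M.interiorVertices ∧ z ∈ T.1 then 1 else 0) * ρ T'
      ≤ if z ∈ T.1 then starCard d Creg * (starRatio d Creg * ρ T) else 0 := fun z => by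
    by_cases hi : z ∈ M.interiorVertices ∧ z ∈ T.1
    · simp only [hi, and_self, if_true, one_mul]
      have hzΩ := (M.mem_interiorVertices_iff hΩ.isOpen hi.2).1 hi.1
      calc _ ≤ ∑ T' ∈ M.star z, starRatio d Creg * ρ T := Finset.sum_le_sum fun T' hT' =>
            hρ z ⟨T', M.mem_star.1 hT'⟩ ⟨T, hi.2⟩ (M.starGraph_reachable hΩ.isOpen hzΩ _ _)
        _ = (M.star z).card * (starRatio d Creg * ρ T) := by
            rw [Finset.sum_const, nsmul_eq_mul]
        _ ≤ _ := by
            gcongr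
            exact h.star_card_le (by lia) z ⟨T, M.mem_star.2 hi.2⟩
    · simp only [hi, if_false, zero_mul, Finset.sum_const_zero]
      split_ifs
      · positivity
      · exact le_rfl
  have hA : ∑ T' : M.cells, ∑ z ∈ T'.1, (if T' = T then (1 : ℝ) else 0) * ρ T'
      = ((d : ℝ) + 1) * ρ T := by
    rw [Finset.sum_eq_single T]
    · simp [M.card_eq T.1 T.2]
    · intro T' _ hne
      simp [hne]
    · exact fun h => absurd (Finset.mem_univ T) h
  have hB : ∑ T' : M.cells, ∑ z ∈ T'.1,
      (if z ∈ M.interiorVertices ∧ z ∈ T.1 then 1 else 0) * ρ T'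
      ≤ ((d : ℝ) + 1) * (starCard d Creg * (starRatio d Creg * ρ T)) := by
    rw [M.sum_sum_vertices
      fun T' z => (if z ∈ M.interiorVertices ∧ z ∈ T.1 then 1 else 0) * ρ T']
    refine (Finset.sum_le_sum fun z _ => hz z).trans_eq ?_
    rw [← Finset.sum_filter, Finset.filter_mem_eq_inter, Finset.inter_eq_right.2
      (show T.1 ⊆ M.cells.biUnion id from Finset.subset_biUnion_of_mem id T.2), Finset.sum_const, M.card_eq T.1 T.2, nsmul_eq_mul]
    push_cast
    ring
  calc _ ≤ ∑ T' : M.cells, ((d : ℝ) + 1) *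
        (∑ z ∈ T'.1, ((if T' = T then 1 else 0) +
          if z ∈ M.interiorVertices ∧ z ∈ T.1 then 1 else 0)) * ρ T' := by
        gcongr with T'
        · exact hρ0 T'
        · exact sq_osc_single_le T T'
    _ = ((d : ℝ) + 1) * (∑ T' : M.cells, ∑ z ∈ T'.1, (if T' = T then (1 : ℝ) else 0) * ρ T'
        + ∑ T' : M.cells, ∑ z ∈ T'.1,
          (if z ∈ M.interiorVertices ∧ z ∈ T.1 then 1 else 0) * ρ T') := by
        rw [← Finset.sum_add_distrib, Finset.mul_sum]
        refine Finset.sum_congr rfl fun T' _ => ?_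
        rw [mul_assoc, Finset.sum_mul, ← Finset.sum_add_distrib]
        simp_rw [add_mul]
    _ ≤ ((d : ℝ) + 1) * (((d : ℝ) + 1) * ρ T
        + ((d : ℝ) + 1) * (starCard d Creg * (starRatio d Creg * ρ T))) := by
        rw [hA]
        gcongr
    _ = _ := by rw [singleConst]; ring

end Mesh

/-! ### Dual norms and approximation by test functions -/

theorem abs_integral_mul_le {α : Type*} [MeasurableSpace α] {μ : Measure α} {f g : α → ℝ}
    (hf : MemLp f 2 μ) (hg : MemLp g 2 μ) :
    |∫ x, f x * g x ∂μ| ≤ ‖hf.toLp f‖ * ‖hg.toLp g‖ := by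
  refine le_trans (le_of_eq ?_) (abs_real_inner_le_norm (hf.toLp f) (hg.toLp g))
  rw [L2.inner_def]
  congr 1
  refine integral_congr_ae ?_
  filter_upwards [hf.coeFn_toLp, hg.coeFn_toLp] with x h1 h2
  rw [h1, h2, real_inner_eq_re_inner]
  simp [mul_comm]

theorem eLpNorm_eq_ofReal_norm {F α : Type*} [NormedAddCommGroup F] [MeasurableSpace α]
    {μ : Measure α} {f : α → F} (hf : MemLp f 2 μ) :
    eLpNorm f 2 μ = ENNReal.ofReal ‖hf.toLp f‖ := by
  rw [Lp.norm_toLp, ENNReal.ofReal_toReal hf.2.ne]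

section

variable {ω : Set (E d)}

theorem pairing_eq_inner (f : L2 ω) (v : H10 ω) : pairing ω f v = inner ℝ f (fn v) := by
  rw [pairing, L2.inner_def]
  refine integral_congr_ae (Eventually.of_forall fun x => ?_)
  simp [mul_comm]

theorem dualNorm_le {F : H10 ω → ℝ} {A : ℝ≥0∞}
    (h : ∀ v, ENNReal.ofReal (F v) ≤ A * ENNReal.ofReal ‖grad v‖) : dualNorm F ≤ A :=
  iSup_le fun v => ENNReal.div_le_of_le_mul (h v)

/-- The bound includes the case `∇w = 0`: a finite dual norm then forces `F w ≤ 0`, because a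
positive number divided by zero is infinite. -/
theorem ofReal_le_dualNorm_mul {F : H10 ω → ℝ} (hF : dualNorm F ≠ ∞) (w : H10 ω) :
    ENNReal.ofReal (F w) ≤ dualNorm F * ENNReal.ofReal ‖grad w‖ := by
  refine (ENNReal.div_le_iff_le_mul (Or.inr hF) (Or.inl ENNReal.ofReal_ne_top)).1 ?_
  exact le_iSup (fun v : H10 ω => ENNReal.ofReal (F v) / ENNReal.ofReal ‖grad v‖) w

theorem le_toReal_dualNorm_mul {F : H10 ω → ℝ} (hF : dualNorm F ≠ ∞) (w : H10 ω) :
    F w ≤ (dualNorm F).toReal * ‖grad w‖ := by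
  have h := ofReal_le_dualNorm_mul hF w
  rw [← ENNReal.ofReal_toReal hF, ← ENNReal.ofReal_mul ENNReal.toReal_nonneg] at h
  exact (ENNReal.ofReal_le_ofReal_iff (by positivity)).1 h

/-- To compare dual norms it suffices to treat a finite norm on the right-hand side; otherwise the
bound is trivial because the constant is positive. -/
theorem dualNorm_le_mul_dualNorm {F : H10 ω → ℝ} {C : ℝ} (hC : 0 < C)
    {G : Set (E d)} {F' : H10 G → ℝ}
    (h : dualNorm F ≠ ∞ → ∀ v, F' v ≤ C * (dualNorm F).toReal * ‖grad v‖) :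
    dualNorm F' ≤ ENNReal.ofReal C * dualNorm F := by
  by_cases hF : dualNorm F = ∞
  · rw [hF, ENNReal.mul_top (by simpa using hC)]
    exact le_top
  · refine dualNorm_le fun v => ?_
    conv_rhs => rw [← ENNReal.ofReal_toReal hF]
    rw [← ENNReal.ofReal_mul hC.le, ← ENNReal.ofReal_mul (by positivity)]
    exact ENNReal.ofReal_le_ofReal (h hF v)

theorem smul_mem_testPairs {p : WithLp 2 (L2 ω × L2Vec ω)} (hp : p ∈ testPairs ω) (c : ℝ) :
    c • p ∈ testPairs ω := by
  obtain ⟨u, hu, hc, hs, h1, h2⟩ := hp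
  have hts : tsupport (fun x => c * u x) ⊆ tsupport u :=
    closure_mono fun x hx hx' => hx (by simp [hx'])
  refine ⟨fun x => c * u x, contDiff_const.mul hu, hc.of_isClosed_subset
    (isClosed_tsupport _) hts, hts.trans hs, ?_, ?_⟩
  · filter_upwards [Lp.coeFn_smul c p.fst, h1] with x e1 e2
    rw [WithLp.smul_fst, e1, Pi.smul_apply, e2, smul_eq_mul]
  · filter_upwards [Lp.coeFn_smul c p.snd, h2] with x e1 e2
    rw [WithLp.smul_snd, e1, Pi.smul_apply, e2]
    simp only [gradient]
    rw [fderiv_const_mul (hu.differentiable (by simp) x), map_smul]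

theorem add_mem_testPairs {p q : WithLp 2 (L2 ω × L2Vec ω)} (hp : p ∈ testPairs ω)
    (hq : q ∈ testPairs ω) : p + q ∈ testPairs ω := by
  obtain ⟨u, hu, hc, hs, h1, h2⟩ := hp
  obtain ⟨v, hv, hc', hs', h1', h2'⟩ := hq
  refine ⟨fun x => u x + v x, hu.add hv, hc.add hc', ?_, ?_, ?_⟩
  · exact (tsupport_add u v).trans (union_subset hs hs')
  · filter_upwards [Lp.coeFn_add p.fst q.fst, h1, h1'] with x e1 e2 e3
    rw [WithLp.add_fst, e1, Pi.add_apply, e2, e3]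
  · filter_upwards [Lp.coeFn_add p.snd q.snd, h2, h2'] with x e1 e2 e3
    rw [WithLp.add_snd, e1, Pi.add_apply, e2, e3]
    simp only [gradient]
    rw [fderiv_fun_add (hu.differentiable (by simp) x) (hv.differentiable (by simp) x), map_add]

theorem zero_mem_testPairs : (0 : WithLp 2 (L2 ω × L2Vec ω)) ∈ testPairs ω := by
  refine ⟨fun _ => 0, contDiff_const, HasCompactSupport.zero, by simp [tsupport], ?_, ?_⟩
  · exact Lp.coeFn_zero _ _ _
  · refine (Lp.coeFn_zero _ _ _).trans (Eventually.of_forall fun x => ?_)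
    simp [gradient]

/-- A closed condition that holds for test functions holds on `H₀¹`. -/
theorem H10_induction {p : WithLp 2 (L2 ω × L2Vec ω) → Prop} (hp : IsClosed {v | p v})
    (h : ∀ v ∈ testPairs ω, p v) (v : H10 ω) : p v.1 := by
  have hspan : ((Submodule.span ℝ (testPairs ω) : Submodule ℝ _) : Set _) ⊆ {v | p v} := by
    intro w hw
    refine h w ?_
    induction hw using Submodule.span_induction with
    | mem w hw => exact hw
    | zero => exact zero_mem_testPairs
    | add x y _ _ hx hy => exact add_mem_testPairs hx hy
    | smul a x _ hx => exact smul_mem_testPairs hx a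
  exact closure_minimal hspan hp v.2

end

namespace Mesh

variable {Ω : Set (E d)} {M : Mesh Ω} {Creg : ℝ}

/-- The energies of the elements add up to the squared norm of the gradient. -/
theorem sum_energy_eq (hΩ : IsBoundedLipschitz Ω) {u : E d → ℝ} (hu : ContDiff ℝ 1 u)
    {g : L2Vec Ω} (hg : g =ᵐ[volume.restrict Ω] gradient u) :
    ∑ T : M.cells, energy u T.1 = ‖g‖ ^ 2 := by
  have h : ‖g‖ₑ ^ 2 = ENNReal.ofReal (∑ T : M.cells, energy u T.1) := by
    rw [enorm_sq_eq_lintegral, ENNReal.ofReal_sum_of_nonneg fun T _ => energy_nonneg _ _]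
    calc ∫⁻ x in Ω, ‖g x‖ₑ ^ 2 = ∫⁻ x in Ω, ‖fderiv ℝ u x‖ₑ ^ 2 := by
          refine lintegral_congr_ae ?_
          filter_upwards [hg] with x hx
          rw [hx, gradient, ← ofReal_norm, LinearIsometryEquiv.norm_map, ofReal_norm]
      _ = _ := by
          rw [M.lintegral_eq_sum hΩ]
          exact Finset.sum_congr rfl fun T _ => lintegral_enorm_fderiv_sq hu T.1
  rw [← ofReal_norm, ← ENNReal.ofReal_pow (norm_nonneg _)] at h
  exact ((ENNReal.ofReal_eq_ofReal_iff (sq_nonneg _)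
    (Finset.sum_nonneg fun T _ => energy_nonneg _ _)).1 h).symm

theorem Pi0_eq_step_mean (hΩ : IsBoundedLipschitz Ω) {u : E d → ℝ} {f : L2 Ω}
    (hf : f =ᵐ[volume.restrict Ω] u) : M.Pi0 f = M.step fun T => mean u T.1 := by
  rw [M.Pi0_eq_step hΩ]
  congr 1
  funext T
  rw [mean, mean, integral_congr_ae (M.ae_restrict_cell hΩ T hf)]

/-- The value of `Q φ` on `T` is `⟨φ, P χ_T⟩ / |T|`. -/
theorem Q_eq_step (hΩ : IsBoundedLipschitz Ω) (φ : L2 Ω) :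
    M.Q φ = M.step fun T => inner ℝ φ (M.P (M.charL2 T)) / vol T.1 := by
  change M.Pi0 (M.P' φ) = _
  rw [M.Pi0_eq_step hΩ]
  congr 1
  funext T
  rw [mean, ← M.inner_charL2 hΩ, real_inner_comm, P', ContinuousLinearMap.adjoint_inner_left]

theorem charL2_eq_step (M : Mesh Ω) (T : M.cells) : M.charL2 T = M.step (Pi.single T 1) := by
  classical
  rw [step, Finset.sum_eq_single T]
  · simp
  · intro T' _ hne
    rw [Pi.single_eq_of_ne hne, zero_smul]
  · exact fun h => absurd (Finset.mem_univ T) h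

theorem mem_patch_of_mem {T T' : M.cells} {z : E d} (hz : z ∈ T.1) (hz' : z ∈ T'.1) :
    T'.1 ∈ M.patch (openSimplex T.1) := by
  classical
  refine Finset.mem_filter.2 ⟨T'.2, z, subset_closedSimplex _ hz', ?_⟩
  rw [M.closure_openSimplex]
  exact subset_closedSimplex _ hz

theorem openSimplex_subset_patchDomain {T T' : M.cells} {z : E d} (hz : z ∈ T.1)
    (hz' : z ∈ T'.1) : openSimplex T'.1 ⊆ M.patchDomain (openSimplex T.1) :=
  interior_mono (subset_iUnion₂_of_subset T'.1 (mem_patch_of_mem hz hz') Subset.rfl)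

theorem ShapeRegular.nodal_eq_zero_of_notMem_patchDomain (h : M.ShapeRegular Creg) (hd : 1 ≤ d)
    (hΩ : IsBoundedLipschitz Ω) {T : M.cells} {z : E d} (hz : z ∈ T.1) (hzΩ : z ∈ Ω) {x : E d}
    (hx : x ∉ M.patchDomain (openSimplex T.1)) : M.nodal z x = 0 := by
  by_contra hne
  refine hx (mem_interior.2 ⟨{y | M.nodal z y ≠ 0}, fun y hy => ?_, ?_, hne⟩)
  · have hyΩ : y ∈ Ω := by_contra fun hy' => hy (M.nodal_eq_zero_of_notMem hΩ hzΩ hy')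
    obtain ⟨T', hT'⟩ := M.exists_mem_closedSimplex (subset_closure hyΩ)
    have hz' : z ∈ T'.1 := by
      by_contra hz'
      refine hy ?_
      rw [M.nodal_eq hT', M.bary_of_notMem hz']
      rfl
    exact mem_iUnion₂.2 ⟨T'.1, mem_patch_of_mem hz hz', hT'⟩
  · obtain ⟨L, hL⟩ := h.exists_lipschitzWith_nodal hd hΩ hzΩ
    exact isOpen_ne_fun hL.continuous continuous_const

theorem vertexValue_single_ne_zero {T : M.cells} {z : E d}
    (hne : M.vertexValue (Pi.single T 1) z ≠ 0) : z ∈ T.1 := by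
  classical
  rw [vertexValue_single] at hne
  by_contra hz
  simp [hz] at hne

/-- For the indicator function of `T` only the elements that share a vertex with `T` need a bubble
correction. -/
theorem exists_mem_of_bubbleCoeff_ne_zero {T T' : M.cells}
    (hne : M.bubbleCoeff (Pi.single T 1) T' ≠ 0) : ∃ z, z ∈ T.1 ∧ z ∈ T'.1 := by
  classical
  by_contra! hno
  refine hne ?_
  have hTT : T' ≠ T := by
    rintro rfl
    obtain ⟨z, hz⟩ : T'.1.Nonempty := Finset.card_pos.1 (by rw [M.card_eq _ T'.2]; lia)
    exact hno z hz hz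
  have hosc : M.osc (Pi.single T 1) T' = 0 := by
    refine Finset.sum_eq_zero fun z hz => ?_
    have : M.vertexValue (Pi.single T 1) z = 0 :=
      by_contra fun h => hno z (vertexValue_single_ne_zero h) hz
    rw [this, Pi.single_eq_of_ne hTT]
    simp
  have := M.abs_bubbleCoeff_le (Pi.single T 1) T'
  rw [hosc, mul_zero] at this
  exact abs_nonpos_iff.1 this

theorem ShapeRegular.quasi_single_eq_zero (h : M.ShapeRegular Creg) (hd : 1 ≤ d)
    (hΩ : IsBoundedLipschitz Ω) {T : M.cells} {x : E d}
    (hx : x ∉ M.patchDomain (openSimplex T.1)) : M.quasi (Pi.single T 1) x = 0 := by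
  rw [quasi, Finset.sum_eq_zero, Finset.sum_eq_zero, add_zero]
  · intro T' _
    by_cases hne : M.bubbleCoeff (Pi.single T 1) T' = 0
    · rw [hne, zero_mul]
    · obtain ⟨z, hz, hz'⟩ := exists_mem_of_bubbleCoeff_ne_zero hne
      rw [M.contBubble_eq_zero fun hx' => hx (openSimplex_subset_patchDomain hz hz' hx'),
        mul_zero]
  · intro z hzi
    by_cases hne : M.vertexValue (Pi.single T 1) z = 0
    · rw [hne, zero_mul]
    · have hz := vertexValue_single_ne_zero hne
      rw [h.nodal_eq_zero_of_notMem_patchDomain hd hΩ hz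
        ((M.mem_interiorVertices_iff hΩ.isOpen hz).1 hzi) hx, mul_zero]

/-- The function `P χ_T` belongs to `H₀¹` of the element patch. -/
theorem ShapeRegular.isH10Rep_quasi_single (h : M.ShapeRegular Creg) (hd : 1 ≤ d)
    (hΩ : IsBoundedLipschitz Ω) (T : M.cells) :
    IsH10Rep (M.patchDomain (openSimplex T.1)) (M.quasi (Pi.single T 1)) := by
  refine h.isH10Rep_quasi hd hΩ (M.patchDomain_subset hΩ _) _ (fun z hzi hne x hx => ?_)
    fun T' hne => ?_
  · have hz := vertexValue_single_ne_zero hne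
    exact h.nodal_eq_zero_of_notMem_patchDomain hd hΩ hz
      ((M.mem_interiorVertices_iff hΩ.isOpen hz).1 hzi) hx
  · obtain ⟨z, hz, hz'⟩ := exists_mem_of_bubbleCoeff_ne_zero hne
    exact openSimplex_subset_patchDomain hz hz'

/-- The inner product with `P χ_T` is an integral over the element patch. -/
theorem ShapeRegular.inner_P_charL2 (h : M.ShapeRegular Creg) (hd : 1 ≤ d)
    (hΩ : IsBoundedLipschitz Ω) (φ : L2 Ω) (T : M.cells) :
    inner ℝ φ (M.P (M.charL2 T))
      = ∫ x in M.patchDomain (openSimplex T.1), φ x * M.quasi (Pi.single T 1) x := by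
  rw [M.charL2_eq_step, L2.inner_def]
  have h1 : ∫ x in Ω, inner ℝ (φ x) (M.P (M.step (Pi.single T 1)) x)
      = ∫ x in Ω, φ x * M.quasi (Pi.single T 1) x := by
    refine integral_congr_ae ?_
    filter_upwards [M.P_step_ae_eq hΩ (Pi.single T 1)] with x hx
    rw [hx]
    simp [mul_comm]
  rw [h1]
  refine (setIntegral_eq_of_subset_of_forall_sdiff_eq_zero hΩ.isOpen.measurableSet
    (M.patchDomain_subset hΩ _) fun x hx => ?_)
  rw [h.quasi_single_eq_zero hd hΩ hx.2, mul_zero]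

/-- A Friedrichs inequality for the mean value. -/
theorem abs_integral_fn_le (M : Mesh Ω) (hd : 1 ≤ d) (T : M.cells) (v : H10 (openSimplex T.1)) :
    |∫ x in openSimplex T.1, fn v x| ≤ vol T.1 * √(scale T.1) * ‖grad v‖ := by
  classical
  have := isFiniteMeasure_cell T.1
  have hs := (M.scale_pos hd T).le
  have hvol := M.vol_pos T
  let one : L2 (openSimplex T.1) := indicatorConstLp 2 MeasurableSet.univ (measure_ne_top _ _) 1
  have hone : ∀ f : L2 (openSimplex T.1), ∫ x in openSimplex T.1, f x = inner ℝ one f :=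
    fun f => by
      rw [L2.inner_indicatorConstLp_one, setIntegral_univ]
  refine H10_induction (p := fun p => |∫ x in openSimplex T.1, p.fst x|
    ≤ vol T.1 * √(scale T.1) * ‖p.snd‖) ?_ ?_ v
  · simp_rw [hone]
    refine isClosed_le ?_ ?_
    · exact (continuous_const.inner (WithLp.fstL 2 ℝ _ _).continuous).abs
    · exact continuous_const.mul (WithLp.sndL 2 ℝ _ _).continuous.norm
  · rintro p ⟨u, hu, _, hs', h1, h2⟩
    have hu1 : ContDiff ℝ 1 u := hu.of_le (by exact_mod_cast le_top)
    have hu0 : ∀ x ∉ openSimplex T.1, u x = 0 := fun x hx =>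
      image_eq_zero_of_notMem_tsupport fun hx' => hx (hs' hx')
    have hcard : 1 < T.1.card := by rw [M.card_eq _ T.2]; lia
    obtain ⟨z₀, hz₀, z, hz, hne⟩ := Finset.one_lt_card.1 hcard
    have hm := M.mean_sub_facetMean_sq_le hu1 T hz₀ hz hne.symm
    -- the test function vanishes on the facet opposite to `z₀`
    have hfac : mean (fun x => u (M.shear T z₀ (z - z₀) x)) T.1 = 0 := by
      have h0 : ∀ x, u (M.shear T z₀ (z - z₀) x) = 0 := fun x => by
        refine hu0 _ fun hx => ?_
        have hpos := M.mem_openSimplex_iff.1 hx z₀ hz₀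
        rw [M.shear_apply, M.bary_shear T hz hz₀] at hpos
        simp [hne] at hpos
      simp [mean, h0]
    rw [hfac, sub_zero] at hm
    have hE : energy u T.1 = ‖p.snd‖ ^ 2 := by
      have h : ‖p.snd‖ₑ ^ 2 = ENNReal.ofReal (energy u T.1) := by
        rw [enorm_sq_eq_lintegral, ← lintegral_enorm_fderiv_sq hu1]
        refine lintegral_congr_ae ?_
        filter_upwards [h2] with x hx
        rw [hx, gradient, ← ofReal_norm, LinearIsometryEquiv.norm_map, ofReal_norm]
      rw [← ofReal_norm, ← ENNReal.ofReal_pow (norm_nonneg _)] at h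
      exact ((ENNReal.ofReal_eq_ofReal_iff (sq_nonneg _) (energy_nonneg _ _)).1 h).symm
    rw [hE] at hm
    have hint : ∫ x in openSimplex T.1, p.fst x = vol T.1 * mean u T.1 := by
      rw [integral_congr_ae h1, mean, mul_div_cancel₀ _ hvol.ne']
    rw [hint, abs_mul, abs_of_pos hvol, mul_assoc]
    refine mul_le_mul_of_nonneg_left ?_ hvol.le
    refine abs_le_of_sq_le_sq ?_ (by positivity)
    rw [mul_pow, Real.sq_sqrt hs]
    exact hm

end Mesh

/-! ### The bounds for the operators -/

/-- The factor in the pointwise bound for the quasi-interpolation error. -/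
def errConst (d : ℕ) : ℝ := 1 + (bubbleConst d)⁻¹

/-- The factor in the bound for the gradient of the quasi-interpolation. -/
def gradConst (d : ℕ) (Creg : ℝ) : ℝ := Creg * (1 + ((d : ℝ) + 1) * (bubbleConst d)⁻¹)

/-- The constant in the weighted error estimate for the quasi-interpolation. -/
def approxConst (d : ℕ) (Creg : ℝ) : ℝ :=
  2 * (Creg * ballVol d) + 2 * errConst d ^ 2 * Mesh.oscConst d Creg

/-- The constant in the `L²` bound for the quasi-interpolation of an indicator function. -/
def quasiConst (d : ℕ) (Creg : ℝ) : ℝ := 2 + 2 * errConst d ^ 2 * Mesh.singleConst d Creg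

theorem gradConst_nonneg {Creg : ℝ} (h1 : 1 ≤ Creg) : 0 ≤ gradConst d Creg := by
  have := bubbleConst_pos d
  unfold gradConst
  positivity

namespace Mesh

variable {Ω : Set (E d)} {M : Mesh Ω} {Creg : ℝ}

theorem diam_nonneg (T : Finset (E d)) : 0 ≤ diam T := Metric.diam_nonneg

theorem meshSize_eq (M : Mesh Ω) {T : M.cells} {x : E d} (hx : x ∈ openSimplex T.1) :
    M.meshSize x = diam T.1 := by
  rw [meshSize, ← Finset.sum_coe_sort M.cells, Finset.sum_eq_single T]
  · rw [indicator_of_mem hx]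
  · intro T' _ hne
    refine indicator_of_notMem (fun hx' => hne ?_) _
    exact M.subset_of_mem_open_of_mem_closed hx' (interior_subset hx)
  · exact fun h => absurd (Finset.mem_univ T) h

theorem measurable_meshSize (M : Mesh Ω) : Measurable M.meshSize :=
  Finset.measurable_fun_sum _ fun T _ =>
    measurable_const.indicator (isOpen_openSimplex T).measurableSet

theorem memLp_meshSize_mul (M : Mesh Ω) (hΩ : IsBoundedLipschitz Ω) (φ : L2 Ω) :
    MemLp (fun x => M.meshSize x * φ x) 2 (volume.restrict Ω) := by
  refine MemLp.of_le_mul (c := ∑ T : M.cells, diam T.1) (Lp.memLp φ)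
    (M.measurable_meshSize.aestronglyMeasurable.mul (Lp.aestronglyMeasurable φ)) ?_
  filter_upwards [M.ae_exists_mem_openSimplex hΩ.isOpen] with x ⟨T, hx⟩
  rw [M.meshSize_eq hx, norm_mul, Real.norm_of_nonneg (diam_nonneg T.1)]
  gcongr
  exact Finset.single_le_sum (f := fun T : M.cells => diam T.1) (fun _ _ => Metric.diam_nonneg)
    (Finset.mem_univ T)

theorem memLp_inv_meshSize_mul (M : Mesh Ω) (hΩ : IsBoundedLipschitz Ω) (φ : L2 Ω) :
    MemLp (fun x => (M.meshSize x)⁻¹ * φ x) 2 (volume.restrict Ω) := by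
  refine MemLp.of_le_mul (c := ∑ T : M.cells, (diam T.1)⁻¹) (Lp.memLp φ)
    (M.measurable_meshSize.inv.aestronglyMeasurable.mul (Lp.aestronglyMeasurable φ)) ?_
  filter_upwards [M.ae_exists_mem_openSimplex hΩ.isOpen] with x ⟨T, hx⟩
  rw [M.meshSize_eq hx, norm_mul, Real.norm_of_nonneg (inv_nonneg.2 (diam_nonneg T.1))]
  gcongr
  exact Finset.single_le_sum (f := fun T : M.cells => (diam T.1)⁻¹)
    (fun _ _ => inv_nonneg.2 Metric.diam_nonneg) (Finset.mem_univ T)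

/-- The local error is split into `u - mean u`, bounded by the Poincaré inequality, and the
difference of `mean u` and the quasi-interpolation, bounded by the oscillation. -/
theorem ShapeRegular.lintegral_error_le (h : M.ShapeRegular Creg) (hd : 1 ≤ d)
    {u : E d → ℝ} (hu : ContDiff ℝ 1 u) (T : M.cells) {ψ : E d → ℝ}
    (hψ : ∀ᵐ x ∂volume.restrict (openSimplex T.1),
      ψ x = u x - M.quasi (fun T => mean u T.1) x) :
    ∫⁻ x in openSimplex T.1, ‖(M.meshSize x)⁻¹ * ψ x‖ₑ ^ 2 ≤
      ENNReal.ofReal (2 * (Creg * ballVol d) * energy u T.1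
        + 2 * errConst d ^ 2 * (M.osc (fun T => mean u T.1) T ^ 2 / scale T.1)) := by
  have := isFiniteMeasure_cell T.1
  have hD := M.diam_pos hd T
  have hV := M.vol_pos T
  have hb := ballVol_nonneg d
  set c : M.cells → ℝ := fun T => mean u T.1 with hc
  set O := errConst d * M.osc c T with hO
  have hcont : Continuous fun x => (u x - c T) ^ 2 := (hu.continuous.sub continuous_const).pow 2
  have hint : IntegrableOn (fun x => (u x - c T) ^ 2) (openSimplex T.1) :=
    integrableOn_openSimplex hcont T.1
  have hint2 : IntegrableOn (fun x => (diam T.1 ^ 2)⁻¹ * (2 * (u x - c T) ^ 2 + 2 * O ^ 2))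
      (openSimplex T.1) :=
    integrableOn_openSimplex
      (continuous_const.mul ((continuous_const.mul hcont).add continuous_const)) T.1
  calc ∫⁻ x in openSimplex T.1, ‖(M.meshSize x)⁻¹ * ψ x‖ₑ ^ 2
      ≤ ∫⁻ x in openSimplex T.1,
          ENNReal.ofReal ((diam T.1 ^ 2)⁻¹ * (2 * (u x - c T) ^ 2 + 2 * O ^ 2)) := by
        refine lintegral_mono_ae ?_
        filter_upwards [hψ, ae_restrict_mem (isOpen_openSimplex T.1).measurableSet] with x h1 hx
        rw [h1, M.meshSize_eq hx, ← ofReal_norm, ← ENNReal.ofReal_pow (norm_nonneg _),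
          Real.norm_eq_abs, sq_abs, mul_pow, inv_pow]
        refine ENNReal.ofReal_le_ofReal ?_
        gcongr
        have h2 : |M.quasi c x - c T| ≤ O := M.abs_quasi_sub_le c hx
        have h3 : (M.quasi c x - c T) ^ 2 ≤ O ^ 2 := sq_le_sq' (neg_le_of_abs_le h2)
          (le_of_abs_le h2)
        nlinarith [sq_nonneg (u x - c T + (M.quasi c x - c T))]
    _ = ENNReal.ofReal ((diam T.1 ^ 2)⁻¹ *
          (2 * ∫ x in openSimplex T.1, (u x - c T) ^ 2) + (diam T.1 ^ 2)⁻¹ *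
          (2 * O ^ 2 * vol T.1)) := by
        rw [← ofReal_integral_eq_lintegral_ofReal hint2 (Eventually.of_forall fun x => by
          positivity), integral_const_mul, integral_add (hint.integrable.const_mul 2)
          (integrable_const _), integral_const_mul, setIntegral_const, mul_add]
        simp only [smul_eq_mul, vol]
        congr 3
        ring
    _ ≤ _ := by
        refine ENNReal.ofReal_le_ofReal (add_le_add ?_ (le_of_eq ?_))
        · calc _ ≤ (diam T.1 ^ 2)⁻¹ * (2 * (diam T.1 ^ d * ballVol d / vol T.1 *
                (diam T.1 ^ 2 * energy u T.1))) := by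
                gcongr
                exact M.integral_sq_sub_mean_le hu T
            _ = 2 * (diam T.1 ^ d / vol T.1 * ballVol d) * energy u T.1 := by field_simp
            _ ≤ _ := by
                have := energy_nonneg u T.1
                gcongr
                exact h T.1 T.2
        · rw [hO, scale]
          field_simp

/-- The error of the quasi-interpolation on `H₀¹(Ω)`, tested with an `L²` function. -/
theorem ShapeRegular.abs_inner_sub_P_Pi0_le (h : M.ShapeRegular Creg) (h1 : 1 ≤ Creg)
    (hd : 2 ≤ d) (hΩ : IsBoundedLipschitz Ω) (φ : L2 Ω) (v : H10 Ω) :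
    |inner ℝ φ (fn v - M.P (M.Pi0 (fn v)))|
      ≤ √(approxConst d Creg) * ‖(M.memLp_meshSize_mul hΩ φ).toLp _‖ * ‖grad v‖ := by
  have hC : 0 ≤ approxConst d Creg := by
    have := ballVol_nonneg d
    have := oscConst_nonneg (d := d) h1
    unfold approxConst
    positivity
  set N := ‖(M.memLp_meshSize_mul hΩ φ).toLp _‖ with hN
  refine H10_induction (p := fun p => |inner ℝ φ (p.fst - M.P (M.Pi0 p.fst))|
    ≤ √(approxConst d Creg) * N * ‖p.snd‖) ?_ ?_ v
  · have hf : Continuous fun p : WithLp 2 (L2 Ω × L2Vec Ω) => p.fst :=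
      (WithLp.fstL 2 ℝ _ _).continuous
    refine isClosed_le (continuous_const.inner (hf.sub ?_)).abs ?_
    · exact M.P.continuous.comp (M.Pi0.continuous.comp hf)
    · exact continuous_const.mul (WithLp.sndL 2 ℝ _ _).continuous.norm
  · rintro p ⟨u, hu, _, hs, h2, h3⟩
    have hu1 : ContDiff ℝ 1 u := hu.of_le (by exact_mod_cast le_top)
    have hu0 : ∀ x ∉ Ω, u x = 0 := fun x hx =>
      image_eq_zero_of_notMem_tsupport fun hx' => hx (hs hx')
    set ψ := p.fst - M.P (M.Pi0 p.fst) with hψ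
    have hψu : ψ =ᵐ[volume.restrict Ω] fun x => u x - M.quasi (fun T => mean u T.1) x := by
      rw [hψ, Pi0_eq_step_mean hΩ h2]
      filter_upwards [Lp.coeFn_sub p.fst (M.P (M.step fun T => mean u T.1)), h2,
        M.P_step_ae_eq hΩ fun T => mean u T.1] with x e1 e2 e3
      rw [e1, Pi.sub_apply, e2, e3]
    -- the Cauchy–Schwarz inequality is applied with the weights `h` and `h⁻¹`
    have hinner : inner ℝ φ ψ
        = ∫ x in Ω, (M.meshSize x * φ x) * ((M.meshSize x)⁻¹ * ψ x) := by
      rw [L2.inner_def]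
      refine integral_congr_ae ?_
      filter_upwards [M.ae_exists_mem_openSimplex hΩ.isOpen] with x ⟨T, hx⟩
      have := (M.diam_pos (by lia) T).ne'
      rw [M.meshSize_eq hx]
      simp only [RCLike.inner_apply, conj_trivial]
      field_simp
    have hψn : ‖(M.memLp_inv_meshSize_mul hΩ ψ).toLp _‖ ≤ √(approxConst d Creg) * ‖p.snd‖ := by
      refine abs_le_of_sq_le_sq' ?_ (by positivity) |>.2
      rw [mul_pow, Real.sq_sqrt hC, ← sum_energy_eq hΩ hu1 h3]
      refine norm_sq_le_of_lintegral_le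
        (mul_nonneg hC (Finset.sum_nonneg fun T _ => energy_nonneg _ _)) ?_
      calc _ = ∫⁻ x in Ω, ‖(M.meshSize x)⁻¹ * ψ x‖ₑ ^ 2 := by
            refine lintegral_congr_ae ?_
            filter_upwards [(M.memLp_inv_meshSize_mul hΩ ψ).coeFn_toLp] with x hx
            rw [hx]
        _ = ∑ T : M.cells, ∫⁻ x in openSimplex T.1, ‖(M.meshSize x)⁻¹ * ψ x‖ₑ ^ 2 :=
            M.lintegral_eq_sum hΩ _
        _ ≤ ∑ T : M.cells, ENNReal.ofReal (2 * (Creg * ballVol d) * energy u T.1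
              + 2 * errConst d ^ 2 * (M.osc (fun T => mean u T.1) T ^ 2 / scale T.1)) :=
            Finset.sum_le_sum fun T _ =>
              h.lintegral_error_le (by lia) hu1 T (M.ae_restrict_cell hΩ T hψu)
        _ = ENNReal.ofReal (2 * (Creg * ballVol d) * ∑ T : M.cells, energy u T.1
              + 2 * errConst d ^ 2 *
                ∑ T : M.cells, M.osc (fun T => mean u T.1) T ^ 2 / scale T.1) := by
            rw [← ENNReal.ofReal_sum_of_nonneg, Finset.sum_add_distrib, ← Finset.mul_sum,
              ← Finset.mul_sum]
            intro T _
            have := ballVol_nonneg d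
            have := energy_nonneg u T.1
            have := M.scale_pos (by lia) T
            positivity
        _ ≤ _ := by
            refine ENNReal.ofReal_le_ofReal ?_
            rw [approxConst, add_mul, mul_assoc (2 * errConst d ^ 2)]
            gcongr
            exact h.sum_sq_osc_mean_le h1 hd hΩ hu1 hu0
    rw [hinner]
    refine (abs_integral_mul_le (M.memLp_meshSize_mul hΩ φ)
      (M.memLp_inv_meshSize_mul hΩ ψ)).trans ?_
    calc _ ≤ N * (√(approxConst d Creg) * ‖p.snd‖) := by gcongr
      _ = _ := by ring

/-- The approximation property of `Q`, dual to the error estimate for the quasi-interpolation. -/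
theorem ShapeRegular.negNorm_sub_Q_le (h : M.ShapeRegular Creg) (h1 : 1 ≤ Creg)
    (hd : 2 ≤ d) (hΩ : IsBoundedLipschitz Ω) (φ : L2 Ω) :
    negNorm Ω (φ - M.Q φ : L2 Ω) ≤ ENNReal.ofReal √(approxConst d Creg) *
      l2Norm Ω (fun x => M.meshSize x * φ x) := by
  rw [l2Norm, eLpNorm_eq_ofReal_norm (M.memLp_meshSize_mul hΩ φ),
    ← ENNReal.ofReal_mul (Real.sqrt_nonneg _)]
  refine dualNorm_le fun v => ?_
  rw [← ENNReal.ofReal_mul (by positivity), pairing_eq_inner, inner_sub_left, inner_Q_left,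
    ← inner_sub_right]
  exact ENNReal.ofReal_le_ofReal
    ((le_abs_self _).trans (h.abs_inner_sub_P_Pi0_le h1 hd hΩ φ v))

theorem memLp_quasi (M : Mesh Ω) (hΩ : IsBoundedLipschitz Ω) (c : M.cells → ℝ) :
    MemLp (M.quasi c) 2 (volume.restrict Ω) :=
  (memLp_congr_ae (M.P_step_ae_eq hΩ c)).1 (Lp.memLp _)

theorem ShapeRegular.lintegral_quasi_single_le (h : M.ShapeRegular Creg) (h1 : 1 ≤ Creg)
    (hd : 2 ≤ d) (hΩ : IsBoundedLipschitz Ω) (T : M.cells) :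
    ∫⁻ x in Ω, ‖M.quasi (Pi.single T 1) x‖ₑ ^ 2
      ≤ ENNReal.ofReal (quasiConst d Creg * vol T.1) := by
  classical
  set c : M.cells → ℝ := Pi.single T 1 with hc
  have hsum : ∑ T' : M.cells, c T' ^ 2 * vol T'.1 = vol T.1 := by
    rw [Finset.sum_eq_single T]
    · rw [hc, Pi.single_eq_same]; ring
    · intro T' _ hne
      rw [hc, Pi.single_eq_of_ne hne]; ring
    · exact fun h => absurd (Finset.mem_univ T) h
  calc _ = ∑ T' : M.cells, ∫⁻ x in openSimplex T'.1, ‖M.quasi c x‖ₑ ^ 2 :=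
        M.lintegral_eq_sum hΩ _
    _ ≤ ∑ T' : M.cells, ENNReal.ofReal (2 * (c T' ^ 2 * vol T'.1)
          + 2 * errConst d ^ 2 * (M.osc c T' ^ 2 * vol T'.1)) := by
        refine Finset.sum_le_sum fun T' _ => ?_
        calc _ ≤ ∫⁻ _ in openSimplex T'.1,
              ENNReal.ofReal (2 * c T' ^ 2 + 2 * (errConst d * M.osc c T') ^ 2) := by
              refine setLIntegral_mono' (isOpen_openSimplex T'.1).measurableSet fun x hx => ?_
              rw [← ofReal_norm, ← ENNReal.ofReal_pow (norm_nonneg _), Real.norm_eq_abs, sq_abs]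
              refine ENNReal.ofReal_le_ofReal ?_
              have h2 : |M.quasi c x - c T'| ≤ errConst d * M.osc c T' := M.abs_quasi_sub_le c hx
              have h3 := sq_le_sq' (neg_le_of_abs_le h2) (le_of_abs_le h2)
              nlinarith [sq_nonneg (c T' - (M.quasi c x - c T'))]
          _ = ENNReal.ofReal (2 * c T' ^ 2 + 2 * (errConst d * M.osc c T') ^ 2) *
              ENNReal.ofReal (vol T'.1) := by
              rw [setLIntegral_const, vol, Measure.real,
                ENNReal.ofReal_toReal (volume_openSimplex_ne_top T'.1)]
          _ = _ := by
              rw [← ENNReal.ofReal_mul (by positivity)]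
              congr 1
              ring
    _ = ENNReal.ofReal (2 * vol T.1
          + 2 * errConst d ^ 2 * ∑ T' : M.cells, M.osc c T' ^ 2 * vol T'.1) := by
        rw [← ENNReal.ofReal_sum_of_nonneg, Finset.sum_add_distrib, ← Finset.mul_sum,
          ← Finset.mul_sum, hsum]
        intro T' _
        have := M.vol_pos T'
        positivity
    _ ≤ _ := by
        refine ENNReal.ofReal_le_ofReal ?_
        rw [quasiConst, add_mul, mul_assoc (2 * errConst d ^ 2)]
        gcongr
        exact h.sum_sq_osc_single_le h1 hd hΩ T (ρ := fun T => vol T.1) (fun T => vol_nonneg _)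
          fun z T T' hr => h.vol_le_of_reachable h1 hd hr

theorem Q_ae_eq (hΩ : IsBoundedLipschitz Ω) (φ : L2 Ω) (T : M.cells) :
    ∀ᵐ x ∂volume.restrict (openSimplex T.1),
      M.Q φ x = inner ℝ φ (M.P (M.charL2 T)) / vol T.1 := by
  rw [Q_eq_step hΩ]
  exact M.step_ae_eq hΩ _ T

/-- The local `L²` stability of `Q`: its value on `T` is bounded by the Cauchy–Schwarz inequality
on the patch, where `‖P χ_T‖` is of the order of `|T|^{1/2}`. -/
theorem ShapeRegular.l2Norm_Q_le (h : M.ShapeRegular Creg) (h1 : 1 ≤ Creg)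
    (hd : 2 ≤ d) (hΩ : IsBoundedLipschitz Ω) (T : M.cells) (φ : L2 Ω) :
    l2Norm (openSimplex T.1) (M.Q φ) ≤ ENNReal.ofReal √(quasiConst d Creg) *
      l2Norm (M.patchDomain (openSimplex T.1)) φ := by
  have hsub := M.patchDomain_subset hΩ (openSimplex T.1)
  have hV := M.vol_pos T
  have hC : 0 ≤ quasiConst d Creg := by
    have := singleConst_nonneg (d := d) h1
    unfold quasiConst
    positivity
  have hφ : MemLp φ 2 (volume.restrict (M.patchDomain (openSimplex T.1))) :=
    (Lp.memLp φ).mono_measure (Measure.restrict_mono hsub le_rfl)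
  have hq : MemLp (M.quasi (Pi.single T 1)) 2
      (volume.restrict (M.patchDomain (openSimplex T.1))) :=
    (M.memLp_quasi hΩ _).mono_measure (Measure.restrict_mono hsub le_rfl)
  have hqn : ‖hq.toLp _‖ ≤ √(quasiConst d Creg) * √(vol T.1) := by
    rw [← Real.sqrt_mul hC]
    refine Real.le_sqrt_of_sq_le (norm_sq_le_of_lintegral_le (by positivity) ?_)
    calc _ = ∫⁻ x in M.patchDomain (openSimplex T.1), ‖M.quasi (Pi.single T 1) x‖ₑ ^ 2 := by
          refine lintegral_congr_ae ?_
          filter_upwards [hq.coeFn_toLp] with x hx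
          rw [hx]
      _ ≤ ∫⁻ x in Ω, ‖M.quasi (Pi.single T 1) x‖ₑ ^ 2 := lintegral_mono_set hsub
      _ ≤ _ := h.lintegral_quasi_single_le h1 hd hΩ T
  have hin : |inner ℝ φ (M.P (M.charL2 T))|
      ≤ ‖hφ.toLp φ‖ * (√(quasiConst d Creg) * √(vol T.1)) := by
    rw [h.inner_P_charL2 (by lia) hΩ]
    exact (abs_integral_mul_le hφ hq).trans (by gcongr)
  rw [l2Norm, l2Norm, eLpNorm_eq_ofReal_norm hφ, ← ENNReal.ofReal_mul (Real.sqrt_nonneg _)]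
  refine (eLpNorm_le_of_ae_bound (C := |inner ℝ φ (M.P (M.charL2 T))| / vol T.1) ?_).trans ?_
  · filter_upwards [M.Q_ae_eq hΩ φ T] with x hx
    rw [hx, Real.norm_eq_abs, abs_div, abs_of_pos hV]
  · have hμ : (volume.restrict (openSimplex T.1)) univ = ENNReal.ofReal (vol T.1) := by
      rw [Measure.restrict_apply_univ, vol, Measure.real,
        ENNReal.ofReal_toReal (volume_openSimplex_ne_top T.1)]
    rw [hμ, ENNReal.toReal_ofNat, ENNReal.ofReal_rpow_of_pos hV, ← one_div, ← Real.sqrt_eq_rpow,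
      ← ENNReal.ofReal_mul (Real.sqrt_nonneg _)]
    refine ENNReal.ofReal_le_ofReal ?_
    rw [← mul_div_assoc, div_le_iff₀ hV]
    calc _ ≤ √(vol T.1) * (‖hφ.toLp φ‖ * (√(quasiConst d Creg) * √(vol T.1))) := by gcongr
      _ = √(quasiConst d Creg) * ‖hφ.toLp φ‖ * (√(vol T.1) * √(vol T.1)) := by ring
      _ = _ := by rw [Real.mul_self_sqrt hV.le]

/-- The value of `Q φ` on an element, tested with a function in `H₀¹` of the element, is the
pairing of `φ` with a function in `H₀¹` of the element patch. -/
theorem ShapeRegular.negNorm_Q_le (h : M.ShapeRegular Creg) (h1 : 1 ≤ Creg)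
    (hd : 2 ≤ d) (hΩ : IsBoundedLipschitz Ω) (T : M.cells) (φ : L2 Ω) {C : ℝ} (hC0 : 0 < C)
    (hC : gradConst d Creg * √(singleConst d Creg) ≤ C) :
    negNorm (openSimplex T.1) (M.Q φ) ≤ ENNReal.ofReal C *
      negNorm (M.patchDomain (openSimplex T.1)) φ := by
  have hV := M.vol_pos T
  have hs := M.scale_pos (by lia) T
  have hg := gradConst_nonneg (d := d) h1
  have hS := singleConst_nonneg (d := d) h1
  obtain ⟨w, hw1, hw2, _⟩ := h.isH10Rep_quasi_single (by lia) hΩ T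
  refine dualNorm_le_mul_dualNorm hC0 fun hfin v => ?_
  set X := (dualNorm (pairing (M.patchDomain (openSimplex T.1)) φ)).toReal with hX
  have hX0 : 0 ≤ X := ENNReal.toReal_nonneg
  have hpair : ∀ s : ℝ, pairing (M.patchDomain (openSimplex T.1)) φ (s • w)
      = s * inner ℝ φ (M.P (M.charL2 T)) := fun s => by
    rw [h.inner_P_charL2 (by lia) hΩ, pairing, ← integral_const_mul]
    refine integral_congr_ae ?_
    filter_upwards [Lp.coeFn_smul s (fn w), hw1] with x e1 e2
    rw [show fn (s • w) = s • fn w from rfl, e1, Pi.smul_apply, e2, smul_eq_mul]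
    ring
  have hgw : ‖grad w‖ ≤ gradConst d Creg * √(singleConst d Creg) * (√(scale T.1))⁻¹ := by
    refine abs_le_of_sq_le_sq' ?_ (by positivity) |>.2
    have hb : ‖grad w‖ ^ 2 ≤ gradConst d Creg ^ 2 *
        ∑ T' : M.cells, M.osc (Pi.single T 1) T' ^ 2 / scale T'.1 :=
      h.norm_grad_sq_le (by lia) hΩ (M.patchDomain_subset hΩ _) _ hw2
    refine hb.trans ?_
    rw [mul_pow, mul_pow, Real.sq_sqrt hS, inv_pow, Real.sq_sqrt hs.le, mul_assoc]
    refine mul_le_mul_of_nonneg_left ?_ (sq_nonneg _)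
    simp_rw [div_eq_mul_inv]
    exact h.sum_sq_osc_single_le h1 hd hΩ T (ρ := fun T => (scale T.1)⁻¹)
      (fun T => (inv_pos.2 (M.scale_pos (by lia) T)).le)
      fun z T T' hr => h.inv_scale_le_of_reachable h1 hd hr
  have hin : |inner ℝ φ (M.P (M.charL2 T))| ≤ X * ‖grad w‖ := by
    -- the supremum is not over absolute values, so it is tested with both signs of `w`
    have e1 := le_toReal_dualNorm_mul hfin ((1 : ℝ) • w)
    have e2 := le_toReal_dualNorm_mul hfin ((-1 : ℝ) • w)
    rw [hpair] at e1 e2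
    rw [show grad ((1 : ℝ) • w) = (1 : ℝ) • grad w from rfl, one_smul] at e1
    rw [show grad ((-1 : ℝ) • w) = (-1 : ℝ) • grad w from rfl, norm_smul] at e2
    norm_num at e1 e2
    exact abs_le.2 ⟨by linarith, e1⟩
  have hv : pairing (openSimplex T.1) (M.Q φ) v
      = inner ℝ φ (M.P (M.charL2 T)) / vol T.1 * ∫ x in openSimplex T.1, fn v x := by
    rw [pairing, ← integral_const_mul]
    refine integral_congr_ae ?_
    filter_upwards [M.Q_ae_eq hΩ φ T] with x hx
    rw [hx]
  rw [hv]
  refine (le_abs_self _).trans ?_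
  rw [abs_mul, abs_div, abs_of_pos hV]
  calc _ ≤ X * (gradConst d Creg * √(singleConst d Creg) * (√(scale T.1))⁻¹) / vol T.1 *
        (vol T.1 * √(scale T.1) * ‖grad v‖) := by
        gcongr
        · exact hin.trans (by gcongr)
        · exact M.abs_integral_fn_le (by lia) T v
    _ = gradConst d Creg * √(singleConst d Creg) * X * ‖grad v‖ := by
        have := (Real.sqrt_pos.2 hs).ne'
        field_simp
    _ ≤ _ := by gcongr

end Mesh

/-! ### The operators on `H⁻¹` -/

/-- The adjoint of an operator from `L²` to `H₀¹`, as an operator from `H⁻¹` to `L²`. -/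
def dualMap {ω : Set (E d)} (G : L2 ω →L[ℝ] H10 ω) : HNeg ω →L[ℝ] L2 ω :=
  LinearMap.mkContinuous
    { toFun := fun φ : HNeg ω => (InnerProductSpace.toDual ℝ (L2 ω)).symm (φ ∘L G)
      map_add' := fun φ ψ => by rw [ContinuousLinearMap.add_comp, map_add]
      map_smul' := fun c φ => by
        rw [ContinuousLinearMap.smul_comp, LinearIsometryEquiv.map_smulₛₗ]
        simp } ‖G‖ fun φ : HNeg ω => by
      rw [mul_comm]
      have h := (InnerProductSpace.toDual ℝ (L2 ω)).symm.norm_map (φ ∘L G)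
      exact h.trans_le (ContinuousLinearMap.opNorm_comp_le φ G)

theorem inner_dualMap {ω : Set (E d)} (G : L2 ω →L[ℝ] H10 ω) (φ : HNeg ω) (v : L2 ω) :
    inner ℝ (dualMap G φ) v = φ (G v) :=
  InnerProductSpace.toDual_symm_apply (y := φ ∘L G)

theorem toHNeg_apply {ω : Set (E d)} (f : L2 ω) (v : H10 ω) : toHNeg f v = inner ℝ f (fn v) := rfl

namespace Mesh

variable {Ω : Set (E d)} {M : Mesh Ω} {Creg : ℝ}

/-- The operator `P` assembled from given elements of `H₀¹(Ω)` in the place of the hat functions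
and the bubble functions. -/
def lift (M : Mesh Ω) (wz : E d → H10 Ω) (wT : M.cells → H10 Ω) : L2 Ω →L[ℝ] H10 Ω :=
  ∑ z ∈ M.interiorVertices, (M.alpha z).smulRight (wz z) +
    (∑ T : M.cells, ((∫ x in openSimplex T.1, M.bubble T x)⁻¹ • innerSL ℝ (M.charL2 T)).smulRight
      (wT T)) ∘L (ContinuousLinearMap.id ℝ (L2 Ω) - M.J)

theorem lift_apply (M : Mesh Ω) (wz : E d → H10 Ω) (wT : M.cells → H10 Ω) (v : L2 Ω) :
    M.lift wz wT v = ∑ z ∈ M.interiorVertices, M.alpha z v • wz z +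
      ∑ T : M.cells, ((∫ x in openSimplex T.1, M.bubble T x)⁻¹ *
        inner ℝ (M.charL2 T) (v - M.J v)) • wT T := by
  rw [lift, _root_.add_apply, _root_.sum_apply, ContinuousLinearMap.comp_apply, _root_.sum_apply]
  rfl

/-- If the given elements of `H₀¹(Ω)` are the hat and bubble functions, `lift` is `P` as a map
into `H₀¹(Ω)`. -/
theorem fn_lift (hΩ : IsBoundedLipschitz Ω) {wz : E d → H10 Ω} {wT : M.cells → H10 Ω}
    (hz : ∀ z ∈ M.interiorVertices, Represents (wz z) (M.nodal z))
    (hT : ∀ T, Represents (wT T) (M.contBubble T)) (v : L2 Ω) : fn (M.lift wz wT v) = M.P v := by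
  have hz' : ∀ z ∈ M.interiorVertices, fn (wz z) = M.hatL2 z := fun z hzi =>
    Lp.ext ((hz z hzi).1.trans (M.hatL2_ae_eq hΩ z).symm)
  have hT' : ∀ T, fn (wT T) = M.bubbleL2 T := fun T =>
    Lp.ext ((hT T).1.trans (M.bubbleL2_ae_eq hΩ T).symm)
  let F : H10 Ω →L[ℝ] L2 Ω := (WithLp.fstL 2 ℝ (L2 Ω) (L2Vec Ω)).comp (H10 Ω).subtypeL
  have hF : ∀ w : H10 Ω, fn w = F w := fun w => rfl
  have hP : M.P v = M.J v + M.B (v - M.J v) := by simp [P]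
  simp_rw [hF] at hz' hT' ⊢
  rw [lift_apply, map_add, map_sum, map_sum, hP, M.B_apply hΩ]
  simp_rw [map_smul, hT', M.inner_charL2 hΩ]
  congr 1
  rw [J, _root_.sum_apply]
  refine Finset.sum_congr rfl fun z hzi => ?_
  rw [hz' z hzi]
  rfl

theorem represents_lift_step (hΩ : IsBoundedLipschitz Ω) {wz : E d → H10 Ω}
    {wT : M.cells → H10 Ω} (hz : ∀ z ∈ M.interiorVertices, Represents (wz z) (M.nodal z))
    (hT : ∀ T, Represents (wT T) (M.contBubble T)) (c : M.cells → ℝ) :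
    Represents (M.lift wz wT (M.step c)) (M.quasi c) := by
  rw [lift_apply]
  refine (represents_sum _ fun z hzi => ?_).add (represents_sum _ fun T _ => ?_)
  · rw [M.alpha_step hΩ c hzi]
    exact (hz z hzi).const_smul _
  · rw [M.inner_charL2 hΩ, M.bubbleCoeff_eq hΩ]
    exact (hT T).const_smul _

/-- The quasi-interpolation of the piecewise mean values is bounded in `H₀¹`. -/
theorem ShapeRegular.norm_grad_lift_Pi0_le (h : M.ShapeRegular Creg) (h1 : 1 ≤ Creg)
    (hd : 2 ≤ d) (hΩ : IsBoundedLipschitz Ω) {wz : E d → H10 Ω} {wT : M.cells → H10 Ω}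
    (hz : ∀ z ∈ M.interiorVertices, Represents (wz z) (M.nodal z))
    (hT : ∀ T, Represents (wT T) (M.contBubble T)) (v : H10 Ω) :
    ‖grad (M.lift wz wT (M.Pi0 (fn v)))‖ ≤ gradConst d Creg * √(oscConst d Creg) * ‖grad v‖ := by
  have hg := gradConst_nonneg (d := d) h1
  have hO := oscConst_nonneg (d := d) h1
  refine H10_induction (p := fun p => ‖grad (M.lift wz wT (M.Pi0 p.fst))‖
    ≤ gradConst d Creg * √(oscConst d Creg) * ‖p.snd‖) ?_ ?_ v
  · have hgrad : Continuous fun w : H10 Ω => grad w :=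
      (WithLp.sndL 2 ℝ (L2 Ω) (L2Vec Ω)).continuous.comp continuous_subtype_val
    refine isClosed_le (hgrad.comp ((M.lift wz wT).continuous.comp (M.Pi0.continuous.comp
      (WithLp.fstL 2 ℝ _ _).continuous))).norm ?_
    exact continuous_const.mul (WithLp.sndL 2 ℝ _ _).continuous.norm
  · rintro p ⟨u, hu, _, hs, h2, h3⟩
    have hu1 : ContDiff ℝ 1 u := hu.of_le (by exact_mod_cast le_top)
    have hu0 : ∀ x ∉ Ω, u x = 0 := fun x hx =>
      image_eq_zero_of_notMem_tsupport fun hx' => hx (hs hx')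
    rw [Pi0_eq_step_mean hΩ h2]
    refine abs_le_of_sq_le_sq' ?_ (by positivity) |>.2
    rw [mul_pow, mul_pow, Real.sq_sqrt hO, ← sum_energy_eq hΩ hu1 h3, mul_assoc]
    have hb : ‖grad (M.lift wz wT (M.step fun T => mean u T.1))‖ ^ 2 ≤ gradConst d Creg ^ 2 *
        ∑ T : M.cells, M.osc (fun T => mean u T.1) T ^ 2 / scale T.1 :=
      h.norm_grad_sq_le (by lia) hΩ Subset.rfl _ (represents_lift_step hΩ hz hT _).2.1
    refine hb.trans ?_
    gcongr
    exact h.sum_sq_osc_mean_le h1 hd hΩ hu1 hu0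

/-- The adjoint of `P : L²(Ω) → H₀¹(Ω)` extends `P'`, is idempotent after composition with `Π⁰`,
and is stable in `H⁻¹(Ω)` because `P Π⁰` is bounded in the norm of the gradient. -/
theorem ShapeRegular.exists_isAdjointOnHNeg (h : M.ShapeRegular Creg) (h1 : 1 ≤ Creg)
    (hd : 2 ≤ d) (hΩ : IsBoundedLipschitz Ω) {C : ℝ} (hC0 : 0 < C)
    (hC : gradConst d Creg * √(oscConst d Creg) ≤ C) :
    ∃ R : HNeg Ω →L[ℝ] L2 Ω, M.IsAdjointOnHNeg R ∧
      (∀ φ : L2 Ω, R (toHNeg φ) = M.P' φ) ∧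
      (∀ φ : HNeg Ω, M.Pi0 (R (toHNeg (M.Pi0 (R φ)))) = M.Pi0 (R φ)) ∧
      (∀ φ : HNeg Ω, negNorm Ω (M.Pi0 (R φ)) ≤ ENNReal.ofReal C * dualNorm φ) := by
  have hzex : ∀ z, ∃ w : H10 Ω, z ∈ M.interiorVertices → Represents w (M.nodal z) := fun z => by
    by_cases hzi : z ∈ M.interiorVertices
    · obtain ⟨⟨T, hzT⟩, _⟩ := M.mem_interiorVertices.1 hzi
      have hzΩ := (M.mem_interiorVertices_iff hΩ.isOpen hzT).1 hzi
      obtain ⟨w, hw⟩ := h.isH10Rep_nodal (by lia) hΩ Subset.rfl hzΩ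
        fun x hx => M.nodal_eq_zero_of_notMem hΩ hzΩ hx
      exact ⟨w, fun _ => hw⟩
    · exact ⟨0, fun h => absurd h hzi⟩
  choose wz hz using hzex
  choose wT hT using fun T : M.cells =>
    h.isH10Rep_contBubble (by lia) hΩ Subset.rfl (M.openSimplex_subset hΩ T)
  have hfn := fn_lift hΩ hz hT
  have hR : ∀ φ : L2 Ω, dualMap (M.lift wz wT) (toHNeg φ) = M.P' φ := fun φ =>
    ext_inner_right ℝ fun v => by
      rw [inner_dualMap, toHNeg_apply, hfn, P', ContinuousLinearMap.adjoint_inner_left]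
  refine ⟨dualMap (M.lift wz wT), fun v => ⟨_, hfn v, fun φ => inner_dualMap _ φ v⟩, hR,
    fun φ => ?_, fun φ => dualNorm_le_mul_dualNorm hC0 fun hfin v => ?_⟩
  · rw [hR, M.P'_Pi0 hΩ, M.Pi0_Pi0]
  · rw [pairing_eq_inner, inner_Pi0_left, inner_dualMap]
    refine (le_toReal_dualNorm_mul hfin _).trans ?_
    have hX : 0 ≤ (dualNorm φ).toReal := ENNReal.toReal_nonneg
    calc _ ≤ (dualNorm φ).toReal *
          (gradConst d Creg * √(oscConst d Creg) * ‖grad v‖) := by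
          gcongr
          exact h.norm_grad_lift_Pi0_le h1 hd hΩ hz hT v
      _ ≤ (dualNorm φ).toReal * (C * ‖grad v‖) := by gcongr
      _ = _ := by ring

theorem ShapeRegular.mono {C' : ℝ} (h : M.ShapeRegular Creg) (hC : Creg ≤ C') :
    M.ShapeRegular C' := fun T hT => (h T hT).trans hC

end Mesh

end NegSobolev

end

open NegSobolev

theorem mainTheorem7 (d : ℕ) (hd : 2 ≤ d) (Creg : ℝ) :
    ∃ C : ℝ≥0, 0 < C ∧
      ∀ (Ω : Set (E d)), IsBoundedLipschitz Ω → SimplyConnectedSpace Ω →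
      ∀ M : Mesh Ω, M.ShapeRegular Creg →
        (M.Q ∘L M.Q = M.Q ∧ LinearMap.range M.Q.toLinearMap = M.P0) ∧
        (∀ φ : L2 Ω, negNorm Ω (φ - M.Q φ : L2 Ω) ≤ C * l2Norm Ω (fun x => M.meshSize x * φ x)) ∧
        (∀ T ∈ M.cells, ∀ φ : L2 Ω,
          l2Norm (openSimplex T) (M.Q φ) ≤ C * l2Norm (M.patchDomain (openSimplex T)) φ ∧
          negNorm (openSimplex T) (M.Q φ) ≤ C * negNorm (M.patchDomain (openSimplex T)) φ) ∧
        (∃ R : HNeg Ω →L[ℝ] L2 Ω, M.IsAdjointOnHNeg R ∧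
          (∀ φ : L2 Ω, R (toHNeg φ) = M.P' φ) ∧
          (∀ φ : HNeg Ω, M.Pi0 (R (toHNeg (M.Pi0 (R φ)))) = M.Pi0 (R φ)) ∧
          (∀ φ : HNeg Ω, negNorm Ω (M.Pi0 (R φ)) ≤ C * dualNorm φ)) := by
  -- the estimates take a regularity constant that is at least one
  set Cr := max Creg 1
  have h1 : 1 ≤ Cr := le_max_right _ _
  have hg := gradConst_nonneg (d := d) h1
  set C₁ := √(approxConst d Cr) with hC₁
  set C₂ := √(quasiConst d Cr) with hC₂
  set C₃ := gradConst d Cr * √(Mesh.singleConst d Cr) with hC₃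
  set C₄ := gradConst d Cr * √(Mesh.oscConst d Cr) with hC₄
  have hp₁ : 0 ≤ C₁ := Real.sqrt_nonneg _
  have hp₂ : 0 ≤ C₂ := Real.sqrt_nonneg _
  have hp₃ : 0 ≤ C₃ := by positivity
  have hp₄ : 0 ≤ C₄ := by positivity
  have hpos : 0 < 1 + C₁ + C₂ + C₃ + C₄ := by positivity
  -- the sum dominates each of the four constants, and the summand `1` makes it positive
  refine ⟨(1 + C₁ + C₂ + C₃ + C₄).toNNReal, Real.toNNReal_pos.2 hpos, fun Ω hΩ _ M hM => ?_⟩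
  have h : M.ShapeRegular Cr := hM.mono (le_max_left _ _)
  change _ ∧ (∀ φ : L2 Ω, _ ≤ ENNReal.ofReal _ * _) ∧ _
  refine ⟨⟨M.Q_comp_Q hΩ, M.range_Q hΩ⟩, fun φ => ?_, fun T hT φ => ⟨?_, ?_⟩, ?_⟩
  · refine (h.negNorm_sub_Q_le h1 hd hΩ φ).trans ?_
    gcongr
    linarith
  · refine (h.l2Norm_Q_le h1 hd hΩ ⟨T, hT⟩ φ).trans ?_
    refine mul_le_mul_left (ENNReal.ofReal_le_ofReal ?_) _
    linarith
  · exact h.negNorm_Q_le h1 hd hΩ ⟨T, hT⟩ φ hpos (by linarith)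
  · exact h.exists_isAdjointOnHNeg h1 hd hΩ hpos (by linarith)
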